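/- Let $n\ge k\ge 1$ be integers. A \emph{labeled Dyck path} $P$ of size $n$ is a pair of sequences $(a_1,\dots,a_n)$ of nonnegative integers and $(\ell_1,\dots,\ell_n)$ of positive integers such that $a_1=0$, $a_{i+1}\le a_i+1$ for $1\le i<n$, and $\ell_i<\ell_{i+1}$ whenever $a_{i+1}=a_i+1$. (Here $a_i$ is the number of full cells between the Dyck path and the diagonal in the $i$-th row from the bottom, and $\ell_i$ is the label of the $i$-th north step.) Put $x^P=\prod_i x_{\ell_i}$ and $\mathrm{area}(P)=\sum_i a_i$; let $d_i(P)$ be the number of $j>i$ such that either $a_i=a_j$ and $\ell_i<\ell_j$, or $a_i=a_j+1$ and $\ell_i>\ell_j$; put $\mathrm{dinv}(P)=\sum_i d_i(P)$; and let $\mathrm{Val}(P)$ be the set of $2\le i\le n$ such that either $a_i<a_{i-1}$, or $a_i=a_{i-1}$ and $\ell_{i-1}<\ell_i$. For integers $n>m\ge 0$ let $$\mathrm{Val}_{n,m}(x;q,t)=\{z^{\,n-m-1}\}\Bigl[\sum_{P} q^{\mathrm{dinv}(P)}\,t^{\mathrm{area}(P)}\prod_{i\in\mathrm{Val}(P)}\bigl(1+z/q^{\,d_i(P)+1}\bigr)\,x^P\Bigr],$$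 where the sum is over all labeled Dyck paths of size $n$ and $\{z^{r}\}$ extracts the coefficient of $z^{r}$. This is a formal power series in $x=(x_1,x_2,\dots)$ whose coefficients are polynomials in $q$ and $t$ (no negative powers of $q$ occur), so $q$ or $t$ may be set equal to $0$. For a partition $\lambda\vdash n$ (Young diagrams in English notation) let $\mathrm{SYT}(\lambda)$ be the set of standard Young tableaux of shape $\lambda$. A descent of $T\in\mathrm{SYT}(\lambda)$ is an index $1\le i\le n-1$ such that $i+1$ appears in a lower row of $T$ than $i$; let $\mathrm{des}(T)$ be the number of descents of $T$ and $\mathrm{maj}(T)$ their sum. Let ${r\brack s}_q=\frac{[r]!_q}{[s]!_q[r-s]!_q}$ be the $q$-binomial coefficient, where $[r]!_q=\prod_{i=1}^{r}(1+q+\cdots+q^{i-1})$, and ${r\brack s}_q=0$ if $s>r$. Let $s_\lambda$ be the Schur function. Then $\mathrm{Val}_{n,k-1}(x;q,0)=\mathrm{Val}_{n,k-1}(x;0,q)$. This power series is a linear combination of the Schur functions $s_\lambda$, $\lambda\vdash n$, with coefficients in $\mathbb Z[q]$; these coefficients are unique, and the coefficient of $s_\lambda$ is $$\sum_{T\in\mathrm{SYT}(\lambda)}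 q^{\,\mathrm{maj}(T)+\binom{n-k}{2}-(n-k)\,\mathrm{des}(T)}\,{\mathrm{des}(T)\brack n-k}_q .$$ In particular $\mathrm{Val}_{n,k-1}(x;0,q)$ is Schur positive: the coefficient of each $s_\lambda$ is a polynomial in $q$ with nonnegative coefficients. -/

import Mathlib

noncomputable section

namespace DeltaVal

/-! ### Labeled Dyck paths -/

/-- A labeled Dyck path of size `n`. The underlying Dyck path, from `(0, 0)` to `(n, n)` with north
and east steps and weakly above the diagonal, is recorded by its area sequence: `a i` is the number
of full cells between the path and the diagonal in the `i`-th row from the bottom. The area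
sequences of Dyck paths are the sequences with first entry `0` that never grow by more than `1`.
The rows `i` and `i + 1` have their north steps in the same column exactly when
`a (i + 1) = a i + 1`. The north steps carry labels that strictly increase up each column.
The label `m` stands for the variable `x_m`; labels and variables are indexed from `0`. -/
@[ext]
structure LabeledDyckPath (n : ℕ) where
  /-- the area sequence -/
  a : Fin n → ℕ
  /-- the labels of the north steps, from bottom to top -/
  label : Fin n → ℕ
  a_first : ∀ i : Fin n, (i : ℕ) = 0 → a i = 0
  a_step : ∀ i j : Fin n, (j : ℕ) = i + 1 → a j ≤ a i + 1
  label_lt : ∀ i j : Fin n, (j : ℕ) = i + 1 → a j = a i + 1 → label i < label j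

namespace LabeledDyckPath

variable {n : ℕ} (P : LabeledDyckPath n)

/-- The exponent vector of the monomial `x^P`, the product of the variables of all labels. -/
def weight : ℕ →₀ ℕ := ∑ i, Finsupp.single (P.label i) 1

/-- The number `area(P)`. -/
def area : ℕ := ∑ i, P.a i

/-- The rows `i < j` form a (primary or secondary) diagonal inversion. -/
def Attacks (i j : Fin n) : Prop :=
  i < j ∧ ((P.a i = P.a j ∧ P.label i < P.label j) ∨ (P.a i = P.a j + 1 ∧ P.label j < P.label i))

open Classical in
/-- The number `d_i(P)` of diagonal inversions whose lower row is `i`. -/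
def d (i : Fin n) : ℕ := (Finset.univ.filter fun j => P.Attacks i j).card

/-- The number `dinv(P)`. -/
def dinv : ℕ := ∑ i, P.d i

/-- The row `i` is a contractible valley: its north step follows an east step, and exchanging these
two steps (so that `a i` grows by `1`) keeps the labels strictly increasing up columns. In terms of
the row `p` just below, this says `a i < a p`, or `a i = a p` with a smaller label in row `p`. -/
def IsValley (i : Fin n) : Prop :=
  ∃ p : Fin n, (p : ℕ) + 1 = i ∧ (P.a i < P.a p ∨ (P.a i = P.a p ∧ P.label p < P.label i))

open Classical in
/-- The set `Val(P)` of contractible valleys. -/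
def valleys : Finset (Fin n) := Finset.univ.filter fun i => P.IsValley i

theorem exists_level (c m : ℕ) (hm : m < n) (h : c ≤ P.a ⟨m, hm⟩) :
    ∃ (p : ℕ) (hp : p < n), p ≤ m ∧ P.a ⟨p, hp⟩ = c ∧
      (p = m ∨ ∃ hr : p + 1 < n, p + 1 ≤ m ∧ P.a ⟨p + 1, hr⟩ = c + 1) := by
  induction m with
  | zero =>
    have h0 := P.a_first ⟨0, hm⟩ rfl
    exact ⟨0, hm, le_rfl, by omega, Or.inl rfl⟩
  | succ m ih =>
    by_cases hc : P.a ⟨m + 1, hm⟩ = c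
    · exact ⟨m + 1, hm, le_rfl, hc, Or.inl rfl⟩
    · have hs := P.a_step ⟨m, by omega⟩ ⟨m + 1, hm⟩ rfl
      obtain ⟨p, hp, hpm, hpa, hor⟩ := ih (by omega) (by omega)
      refine ⟨p, hp, by omega, hpa, Or.inr ?_⟩
      rcases hor with rfl | ⟨hr, hrm, hra⟩
      · exact ⟨hm, le_rfl, by omega⟩
      · exact ⟨hr, by omega, hra⟩

theorem exists_attacks_aux (i : Fin n) (p : ℕ) (hp : p < n) (hpi : p ≤ i)
    (ha : P.a ⟨p, hp⟩ = P.a i) (hl : P.label ⟨p, hp⟩ ≤ P.label i) (hv : P.IsValley ⟨p, hp⟩) :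
    ∃ j, ¬ P.IsValley j ∧ P.Attacks j i := by
  induction p using Nat.strong_induction_on with
  | _ p ih =>
    obtain ⟨⟨s, hs⟩, hsp, hval⟩ := hv
    simp only at hsp
    obtain ⟨p', hp', hpm, hpa, hor⟩ := P.exists_level (P.a i) s hs (by omega)
    have key : P.label ⟨p', hp'⟩ < P.label i → ∃ j, ¬ P.IsValley j ∧ P.Attacks j i := by
      intro hlt
      by_cases hv' : P.IsValley ⟨p', hp'⟩
      · exact ih p' (by omega) hp' (by omega) hpa hlt.le hv'
      · refine ⟨_, hv', ?_, Or.inl ⟨hpa, hlt⟩⟩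
        rw [Fin.lt_def]
        simp only
        omega
    rcases hor with rfl | ⟨hr, hrm, hra⟩
    · exact key (by omega)
    · have hinc := P.label_lt ⟨p', hp'⟩ ⟨p' + 1, hr⟩ rfl (by omega)
      by_cases hgt : P.label i < P.label ⟨p' + 1, hr⟩
      · refine ⟨⟨p' + 1, hr⟩, ?_, ?_, Or.inr ⟨hra, hgt⟩⟩
        · rintro ⟨⟨u, hu⟩, hup, huv⟩
          simp only at hup
          obtain rfl : u = p' := by omega
          omega
        · rw [Fin.lt_def]
          simp only
          omega
      · exact key (by omega)

/-- Removing `d_i(P) + 1` from `dinv(P)` for each `i` in a set of contractible valleys leaves a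
nonnegative number. -/
theorem sum_le_dinv (S : Finset (Fin n)) (hS : S ⊆ P.valleys) :
    ∑ i ∈ S, (P.d i + 1) ≤ P.dinv := by
  classical
  have h1 : ∀ i ∈ S, ∃ j, ¬ P.IsValley j ∧ P.Attacks j i := fun i hi => by
    have hv : P.IsValley i := by simpa [valleys] using hS hi
    exact P.exists_attacks_aux i i i.2 le_rfl rfl le_rfl hv
  have h2 : S.card ≤ ∑ j ∈ Sᶜ, P.d j := by
    calc S.card = ∑ i ∈ S, 1 := by simp
      _ ≤ ∑ i ∈ S, ∑ j ∈ Sᶜ, (if P.Attacks j i then 1 else 0) := by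
        refine Finset.sum_le_sum fun i hi => ?_
        obtain ⟨j, hj, hji⟩ := h1 i hi
        have hjS : j ∈ Sᶜ := by
          rw [Finset.mem_compl]
          intro hjs
          exact hj (by simpa [valleys] using hS hjs)
        calc 1 = (if P.Attacks j i then 1 else 0) := by simp [hji]
          _ ≤ _ := Finset.single_le_sum (f := fun j => if P.Attacks j i then 1 else 0)
            (fun _ _ => Nat.zero_le _) hjS
      _ = ∑ j ∈ Sᶜ, ∑ i ∈ S, (if P.Attacks j i then 1 else 0) := Finset.sum_comm
      _ ≤ ∑ j ∈ Sᶜ, P.d j := by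
        refine Finset.sum_le_sum fun j _ => ?_
        rw [d, Finset.card_filter]
        exact Finset.sum_le_sum_of_subset (Finset.subset_univ S)
  have h3 : P.dinv = ∑ i ∈ S, P.d i + ∑ i ∈ Sᶜ, P.d i := (Finset.sum_add_sum_compl S _).symm
  rw [Finset.sum_add_distrib, h3]
  simpa using h2

theorem a_le (m : ℕ) (hm : m < n) : P.a ⟨m, hm⟩ ≤ m := by
  induction m with
  | zero => exact (P.a_first ⟨0, hm⟩ rfl).le
  | succ m ih =>
    have h1 := P.a_step ⟨m, by omega⟩ ⟨m + 1, hm⟩ rfl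
    have h2 := ih (by omega)
    omega

theorem label_mem (i : Fin n) : P.label i ∈ P.weight.support := by
  classical
  rw [Finsupp.mem_support_iff, weight, Finsupp.finsetSum_apply]
  refine (Finset.sum_pos' (fun _ _ => Nat.zero_le _) ⟨i, Finset.mem_univ _, ?_⟩).ne'
  simp

instance finite_weight (n : ℕ) (β : ℕ →₀ ℕ) : Finite {P : LabeledDyckPath n // P.weight = β} := by
  let f : {P : LabeledDyckPath n // P.weight = β} → (Fin n → Fin n) × (Fin n → β.support) :=
    fun P => (fun i => ⟨P.1.a i, (P.1.a_le i i.2).trans_lt i.2⟩,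
      fun i => ⟨P.1.label i, by
        have h := P.1.label_mem i
        rwa [P.2] at h⟩)
  refine Finite.of_injective f ?_
  intro P Q h
  apply Subtype.ext
  apply LabeledDyckPath.ext
  · funext i
    simpa [f] using congrFun (congrArg Prod.fst h) i
  · funext i
    simpa [f] using congrFun (congrArg Prod.snd h) i

instance fintype_weight (n : ℕ) (β : ℕ →₀ ℕ) :
    Fintype {P : LabeledDyckPath n // P.weight = β} := Fintype.ofFinite _

end LabeledDyckPath

/-! ### The valley side of the Delta Conjecture -/

/-- The formal power series `Val_{n,k}(x; q, t)` in the variables `x_0, x_1, x_2, …`, for `k < n`,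
with the parameters `q` and `t` taken in any commutative semiring: the coefficient of `z^(n-k-1)` in
`∑_P q^dinv(P) t^area(P) ∏_{i ∈ Val(P)} (1 + z / q^(d_i(P) + 1)) x^P`,
with the product over the contractible valleys expanded. The truncated subtraction in the exponent
never truncates by `LabeledDyckPath.sum_le_dinv`, and `coeff_Val_eq` compares the definition with
the displayed formula for invertible `q`. -/
def Val {R : Type*} [CommSemiring R] (n k : ℕ) (q t : R) : MvPowerSeries ℕ R := fun β =>
  ∑ P : {P : LabeledDyckPath n // P.weight = β},
    ∑ S ∈ P.1.valleys.powersetCard (n - k - 1),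
      q ^ (P.1.dinv - ∑ i ∈ S, (P.1.d i + 1)) * t ^ P.1.area

theorem coeff_Val_eq {K : Type*} [Field K] (n k : ℕ) (q t : K) (hq : q ≠ 0) (β : ℕ →₀ ℕ) :
    MvPowerSeries.coeff β (Val n k q t) =
      (∑ P : {P : LabeledDyckPath n // P.weight = β},
        Polynomial.C (q ^ P.1.dinv * t ^ P.1.area) *
          ∏ i ∈ P.1.valleys,
            (1 + Polynomial.X * Polynomial.C (1 / q ^ (P.1.d i + 1)))).coeff (n - k - 1) := by
  classical
  rw [Polynomial.finsetSum_coeff]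
  refine Finset.sum_congr rfl fun P _ => ?_
  rw [Polynomial.coeff_C_mul, Finset.prod_one_add, Polynomial.finsetSum_coeff, Finset.mul_sum]
  have hterm : ∀ S : Finset (Fin n), (∏ i ∈ S, (Polynomial.X *
      Polynomial.C (1 / q ^ (P.1.d i + 1)))).coeff (n - k - 1) =
      if S.card = n - k - 1 then (q ^ ∑ i ∈ S, (P.1.d i + 1))⁻¹ else 0 := by
    intro S
    rw [Finset.prod_mul_distrib, Finset.prod_const, ← map_prod, mul_comm, Polynomial.coeff_C_mul,
      Polynomial.coeff_X_pow]
    simp only [one_div, Finset.prod_inv_distrib, Finset.prod_pow_eq_pow_sum]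
    simp [eq_comm]
  simp only [hterm]
  rw [Finset.powersetCard_eq_filter, Finset.sum_filter]
  refine Finset.sum_congr rfl fun S hS => ?_
  by_cases hc : S.card = n - k - 1
  · have hle := P.1.sum_le_dinv S (Finset.mem_powerset.1 hS)
    simp only [hc, if_true]
    rw [pow_sub₀ _ hq hle]
    ring
  · simp [hc]

/-! ### Schur functions -/

variable {μ : YoungDiagram}

/-- The content of a semistandard tableau: the number of occurrences of each entry. -/
def content (T : SemistandardYoungTableau μ) : ℕ →₀ ℕ :=
  ∑ c ∈ μ.cells, Finsupp.single (T c.1 c.2) 1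

theorem entry_mem (T : SemistandardYoungTableau μ) (c : ℕ × ℕ) (hc : c ∈ μ.cells) :
    T c.1 c.2 ∈ (content T).support := by
  classical
  rw [Finsupp.mem_support_iff, content, Finsupp.finsetSum_apply]
  refine (Finset.sum_pos' (fun _ _ => Nat.zero_le _) ⟨c, hc, ?_⟩).ne'
  simp


theorem finite_entries (μ : YoungDiagram) (s : Finset ℕ) :
    Finite {T : SemistandardYoungTableau μ // ∀ c ∈ μ.cells, T c.1 c.2 ∈ s} := by
  let f : {T : SemistandardYoungTableau μ // ∀ c ∈ μ.cells, T c.1 c.2 ∈ s} → (μ.cells → s) :=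
    fun T c => ⟨T.1 c.1.1 c.1.2, T.2 c.1 c.2⟩
  refine Finite.of_injective f ?_
  intro T U h
  apply Subtype.ext
  apply SemistandardYoungTableau.ext
  intro i j
  by_cases hc : (i, j) ∈ μ
  · simpa [f] using congrFun h ⟨(i, j), hc⟩
  · rw [T.1.zeros hc, U.1.zeros hc]

instance finite_content (μ : YoungDiagram) (β : ℕ →₀ ℕ) :
    Finite {T : SemistandardYoungTableau μ // content T = β} := by
  have := finite_entries μ β.support
  exact Finite.of_injective
    (fun T : {T : SemistandardYoungTableau μ // content T = β} =>
      (⟨T.1, fun c hc => by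
        have h := entry_mem T.1 c hc
        rwa [T.2] at h⟩ :
        {T : SemistandardYoungTableau μ // ∀ c ∈ μ.cells, T c.1 c.2 ∈ β.support}))
    (fun T U h => Subtype.ext (by simpa using h))

/-- The Schur function `s_μ` in the variables `x_0, x_1, x_2, …`: the coefficient of `x^β` is the
number of semistandard tableaux of shape `μ` and content `β`. -/
def schur (R : Type*) [CommSemiring R] (μ : YoungDiagram) : MvPowerSeries ℕ R := fun β =>
  (Nat.card {T : SemistandardYoungTableau μ // content T = β} : R)

/-- The partitions of `n`, as Young diagrams in English notation. -/
abbrev Shape (n : ℕ) : Type := {μ : YoungDiagram // μ.card = n}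

theorem cells_subset (μ : YoungDiagram) :
    μ.cells ⊆ Finset.range μ.card ×ˢ Finset.range μ.card := by
  rintro ⟨i, j⟩ hc
  have hc' : (i, j) ∈ μ := hc
  have h1 : (Finset.range (i + 1)).image (fun m => (m, j)) ⊆ μ.cells := by
    intro c h
    obtain ⟨m, hm, rfl⟩ := Finset.mem_image.1 h
    exact μ.up_left_mem (Nat.lt_succ_iff.1 (Finset.mem_range.1 hm)) le_rfl hc'
  have h2 : (Finset.range (j + 1)).image (fun m => (i, m)) ⊆ μ.cells := by
    intro c h
    obtain ⟨m, hm, rfl⟩ := Finset.mem_image.1 h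
    exact μ.up_left_mem le_rfl (Nat.lt_succ_iff.1 (Finset.mem_range.1 hm)) hc'
  have h1' := Finset.card_le_card h1
  have h2' := Finset.card_le_card h2
  rw [Finset.card_image_of_injective _ (fun x y h => by simpa using h), Finset.card_range] at h1' h2'
  simp only [Finset.mem_product, Finset.mem_range]
  exact ⟨h1', h2'⟩

instance finite_shape (n : ℕ) : Finite (Shape n) := by
  refine Finite.of_injective
    (fun μ : Shape n =>
      (⟨μ.1.cells, by
        have h := cells_subset μ.1
        rw [μ.2] at h
        exact Finset.mem_powerset.2 h⟩ :
        (Finset.range n ×ˢ Finset.range n).powerset)) ?_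
  intro μ ν h
  exact Subtype.ext (YoungDiagram.ext (by simpa using h))

instance fintype_shape (n : ℕ) : Fintype (Shape n) := Fintype.ofFinite _

/-- A formal power series `f` over `ℤ[q]`, homogeneous of degree `n` in the variables `x`, is Schur
positive if it is a linear combination of the Schur functions `s_μ`, with `μ` a partition of `n`,
whose coefficients are polynomials in `q` with nonnegative coefficients. -/
def SchurPositive (n : ℕ) (f : MvPowerSeries ℕ (Polynomial ℤ)) : Prop :=
  ∃ c : Shape n → Polynomial ℤ, f = ∑ μ : Shape n, c μ • schur (Polynomial ℤ) μ.1 ∧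
    ∀ (μ : Shape n) (m : ℕ), 0 ≤ (c μ).coeff m

/-! ### Standard tableaux -/

/-- The standard Young tableaux of shape `μ`: the tableaux with rows increasing from left to right
and columns increasing from top to bottom in which each of `1, …, |μ|` appears exactly once. -/
abbrev SYT (μ : YoungDiagram) : Type :=
  {T : SemistandardYoungTableau μ //
    Set.BijOn (fun c : ℕ × ℕ => T c.1 c.2) (μ.cells : Set (ℕ × ℕ)) (Set.Icc 1 μ.card)}

instance finite_SYT (μ : YoungDiagram) : Finite (SYT μ) := by
  have := finite_entries μ (Finset.Icc 1 μ.card)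
  exact Finite.of_injective
    (fun T : SYT μ =>
      (⟨T.1, fun c hc => by simpa using T.2.mapsTo (Finset.mem_coe.2 hc)⟩ :
        {T : SemistandardYoungTableau μ // ∀ c ∈ μ.cells, T c.1 c.2 ∈ Finset.Icc 1 μ.card}))
    (fun T U h => Subtype.ext (by simpa using h))

instance fintype_SYT (μ : YoungDiagram) : Fintype (SYT μ) := Fintype.ofFinite _

namespace SYT

open Classical in
/-- The descents of a standard tableau: the `i` with `1 ≤ i ≤ |μ| - 1` such that `i + 1` appears in
a lower row than `i`. -/
def descents (T : SYT μ) : Finset ℕ :=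
  (Finset.Icc 1 (μ.card - 1)).filter fun i =>
    ∃ c ∈ μ.cells, ∃ c' ∈ μ.cells, T.1 c.1 c.2 = i ∧ T.1 c'.1 c'.2 = i + 1 ∧ c.1 < c'.1

/-- The number of descents. -/
def des (T : SYT μ) : ℕ := T.descents.card

/-- The major index, the sum of the descents. -/
def maj (T : SYT μ) : ℕ := ∑ i ∈ T.descents, i

theorem sum_ge (s : Finset ℕ) (h : ∀ i ∈ s, 1 ≤ i) : s.card * (s.card + 1) ≤ 2 * ∑ i ∈ s, i := by
  induction s using Finset.induction_on_max with
  | empty => simp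
  | insert a s ha ih =>
    have has : a ∉ s := fun hs => lt_irrefl a (ha a hs)
    have ih' := ih fun i hi => h i (Finset.mem_insert_of_mem hi)
    have hsub : s ⊆ Finset.Ico 1 a := fun i hi =>
      Finset.mem_Ico.2 ⟨h i (Finset.mem_insert_of_mem hi), ha i hi⟩
    have hcard := Finset.card_le_card hsub
    have ha1 := h a (Finset.mem_insert_self a s)
    rw [Nat.card_Ico] at hcard
    have hle : s.card + 1 ≤ a := by omega
    rw [Finset.card_insert_of_notMem has, Finset.sum_insert has]
    nlinarith

/-- The exponent `maj(T) + (m choose 2) - m des(T)` is nonnegative when `m ≤ des(T)`. -/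
theorem mul_des_le (T : SYT μ) (m : ℕ) (hm : m ≤ T.des) : m * T.des ≤ T.maj + m.choose 2 := by
  have h1 : T.des * (T.des + 1) ≤ 2 * T.maj := sum_ge T.descents fun i hi => by
    have hi' := Finset.mem_of_mem_filter i hi
    exact (Finset.mem_Icc.1 hi').1
  obtain ⟨e, he⟩ := Nat.exists_eq_add_of_le hm
  have h2 : 2 * m.choose 2 + m = m * m := by
    induction m with
    | zero => simp
    | succ m _ =>
      rw [Nat.choose_two_right, Nat.mul_div_cancel' (Nat.even_mul_pred_self (m + 1)).two_dvd]
      simp only [Nat.add_sub_cancel]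
      ring
  rw [he] at h1 ⊢
  nlinarith

end SYT

/-! ### `q`-binomial coefficients -/

variable {R : Type*} [CommSemiring R]

/-- The `q`-number `[r]_q = 1 + q + ⋯ + q^(r-1)`. -/
def qNumber (q : R) (r : ℕ) : R := ∑ i ∈ Finset.range r, q ^ i

/-- The `q`-factorial `[n]!_q = [n]_q [n-1]_q ⋯ [1]_q`. -/
def qFactorial (q : R) (n : ℕ) : R := ∏ r ∈ Finset.range n, qNumber q (r + 1)

/-- The `q`-binomial coefficient, by its Pascal recursion; it is `0` for `k > n`, and
`qBinomial_mul` says that it is `[n]!_q / ([k]!_q [n-k]!_q)` for `k ≤ n`. -/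
def qBinomial (q : R) : ℕ → ℕ → R
  | _, 0 => 1
  | 0, _ + 1 => 0
  | n + 1, k + 1 => qBinomial q n k + q ^ (k + 1) * qBinomial q n (k + 1)

theorem qBinomial_of_lt (q : R) (n k : ℕ) (h : n < k) : qBinomial q n k = 0 := by
  induction n generalizing k with
  | zero =>
    obtain ⟨k, rfl⟩ := Nat.exists_eq_succ_of_ne_zero h.ne'
    simp [qBinomial]
  | succ n ih =>
    obtain ⟨k, rfl⟩ := Nat.exists_eq_succ_of_ne_zero (Nat.ne_zero_of_lt h)
    simp [qBinomial, ih k (by omega), ih (k + 1) (by omega)]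

theorem qBinomial_add_mul (q : R) (a b : ℕ) :
    qBinomial q (a + b) a * (qFactorial q a * qFactorial q b) = qFactorial q (a + b) := by
  induction h : a + b generalizing a b with
  | zero =>
    obtain ⟨rfl, rfl⟩ : a = 0 ∧ b = 0 := by omega
    simp [qBinomial, qFactorial]
  | succ n ih =>
    rcases a with _ | a
    · obtain rfl : b = n + 1 := by omega
      simp [qBinomial, qFactorial]
    have hs : ∀ r, qFactorial q (r + 1) = qFactorial q r * qNumber q (r + 1) := fun r =>
      Finset.prod_range_succ _ _
    have i1 := ih a b (by omega)
    rcases b with _ | b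
    · obtain rfl : a = n := by omega
      have h0 : qFactorial q 0 = (1 : R) := by simp [qFactorial]
      rw [qBinomial, qBinomial_of_lt q a (a + 1) (by omega), hs, h0]
      rw [h0] at i1
      calc _ = (qBinomial q a a * (qFactorial q a * 1)) * qNumber q (a + 1) := by ring
        _ = _ := by rw [i1]
    have i2 := ih (a + 1) b (by omega)
    have hn : qNumber q (n + 1) = qNumber q (a + 1) + q ^ (a + 1) * qNumber q (b + 1) := by
      have : n + 1 = (a + 1) + (b + 1) := by omega
      rw [this]
      simp only [qNumber]
      rw [Finset.sum_range_add, Finset.mul_sum]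
      simp only [pow_add]
    rw [qBinomial, hs n, hn]
    calc _ = (qBinomial q n a * (qFactorial q a * qFactorial q (b + 1))) * qNumber q (a + 1) +
          q ^ (a + 1) * (qBinomial q n (a + 1) * (qFactorial q (a + 1) * qFactorial q b)) *
            qNumber q (b + 1) := by
          rw [hs a, hs b]
          ring
      _ = _ := by
          rw [i1, i2]
          ring

theorem qBinomial_mul (q : R) (n k : ℕ) (h : k ≤ n) :
    qBinomial q n k * (qFactorial q k * qFactorial q (n - k)) = qFactorial q n := by
  obtain ⟨b, rfl⟩ := Nat.exists_eq_add_of_le h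
  rw [Nat.add_sub_cancel_left]
  exact qBinomial_add_mul q k b

end DeltaVal

end

/-!
Encode row `i` of a labeled Dyck path with `a_i` full cells and label `ℓ_i < N` as the position
`a_i N + (N - 1 - ℓ_i)` on a line. The condition on consecutive rows says that the position grows
by less than `N`, a contractible valley is a step that goes down, and a later row `j` counts in
`d_i` exactly if the position of row `i` exceeds that of row `j`, by less than `N`. The
coefficient of `z^(n-k)` marks `n - k` of the downward steps, and after the division by
`q^(d_i + 1)` the exponent of `q` counts, for each step, the unmarked earlier steps that attack
it, less one for a marked step (`coeff_walkSum`). So `Val_{n,k-1}` counts walks with `k` unmarked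
steps (`walkSum`).

For `t = 0` the walk stays below `N`, and cutting it before its unmarked steps gives ordered
multiset partitions into `k` blocks, counted by inversions (`invSum`). For `q = 0` the unmarked
steps form a weakly increasing chain, and each position passed by the chain may be visited once by
a marked step (`chainSum`). Both families satisfy, with an auxiliary index `i` that shifts the
weights, `q^k (f_k(i) + f_{k+1}(i)) = E_i f_k(i+1)` and `f_0 = 1`, where
`E_i = ∏_b (1 + q^i x_b)`. This recurrence determines the family, so the two specializations agree
(`invSum_eq_blockSeries`), and its iteration gives
`∏_{i<j} E_i = ∑_k q^(k choose 2) [j choose k]_q f_k(0)` (`prod_eq_sum_blockSeries`).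

By the dual Cauchy identity `∏_{i<j} E_i` is the sum of `s_λ'(1, q, …, q^(j-1)) s_λ(x)`
(`sum_principalSum_mul_schurSum`). Here `s_λ` is built row by row from interlacing sequences, for
which the dual Pieri rule follows from a local rule (`dual_local_rule`), and `s_λ'` is the sum
over the standard tableaux of shape `λ` of the weights
`q^(maj + (n choose 2) - n des) [des + j choose n]_q`; the recursion of these weights in `j`
removes vertical strips (`principalSum_succ`). The `q`-Vandermonde identity turns such a weight
into `∑_k q^(k choose 2) [j choose k]_q` times the weight of the theorem
(`principalWeight_eq_sum`). The matrix of the `q^(k choose 2) [j choose k]_q` is triangular and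
invertible over the fraction field, so the coefficients at each `k` agree
(`eq_of_sum_qBinomial_eq`, `coeff_blockSeries`).

Uniqueness of the coefficients is the triangularity of the Kostka matrix
(`rowSum_le_of_kostka_ne_zero`). Positivity is visible, as `q`-binomial coefficients come from
polynomials over `ℕ`.
-/

noncomputable section

namespace DeltaVal

/-! ### Identities for `q`-binomial coefficients -/

section QBinomial

variable {R : Type*} [CommRing R] (q : R)

theorem qBinomial_zero_right (n : ℕ) : qBinomial q n 0 = 1 := by
  cases n <;> rfl

theorem qBinomial_self (n : ℕ) : qBinomial q n n = 1 := by
  induction n with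
  | zero => rfl
  | succ n ih => rw [qBinomial, ih, qBinomial_of_lt q n (n + 1) (by omega), mul_zero, add_zero]

/-- The `q`-Pascal rule dual to the one that defines `qBinomial`. For `n < k` both sides vanish. -/
theorem qBinomial_succ_succ (n k : ℕ) :
    qBinomial q (n + 1) (k + 1) = qBinomial q n (k + 1) + q ^ (n - k) * qBinomial q n k := by
  induction n generalizing k with
  | zero =>
    cases k <;> simp [qBinomial]
  | succ n ih =>
    rcases lt_trichotomy (n + 1) k with h | h | h
    · rw [qBinomial_of_lt q _ _ (by omega), qBinomial_of_lt q _ _ (by omega),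
        qBinomial_of_lt q _ _ h]
      simp
    · subst h
      rw [qBinomial_self, qBinomial_self, qBinomial_of_lt q _ _ (by omega)]
      simp
    · rcases k with _ | k
      · have h1 : qBinomial q (n + 1 + 1) (0 + 1) =
            qBinomial q (n + 1) 0 + q ^ (0 + 1) * qBinomial q (n + 1) (0 + 1) := rfl
        have h2 : qBinomial q (n + 1) (0 + 1) =
            qBinomial q n 0 + q ^ (0 + 1) * qBinomial q n (0 + 1) := rfl
        have h3 := ih 0
        simp only [qBinomial_zero_right, Nat.sub_zero] at h1 h2 h3 ⊢
        linear_combination h1 - h2 + q * h3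
      · have e1 : n + 1 - (k + 1) = n - k := by omega
        conv_lhs => rw [qBinomial, ih k, ih (k + 1)]
        conv_rhs => rw [qBinomial, qBinomial]
        rw [e1]
        have e2 : q ^ (k + 1 + 1) * q ^ (n - (k + 1)) = q ^ (n - k) * q ^ (k + 1) := by
          rw [← pow_add, ← pow_add]
          congr 1
          omega
        linear_combination qBinomial q n (k + 1) * e2

/-- The `q`-Vandermonde identity. The subtraction truncates only where `qBinomial q d x.1 = 0`. -/
theorem qBinomial_add (d j n : ℕ) :
    qBinomial q (d + j) n = ∑ x ∈ Finset.HasAntidiagonal.antidiagonal n,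
      qBinomial q d x.1 * qBinomial q j x.2 * q ^ (x.2 * (d - x.1)) := by
  induction d generalizing n with
  | zero =>
    rcases n with _ | n
    · simp [qBinomial_zero_right]
    · rw [Finset.Nat.sum_antidiagonal_succ]
      simp [qBinomial]
  | succ d ih =>
    rcases n with _ | n
    · simp [qBinomial_zero_right]
    · rw [show d + 1 + j = d + j + 1 by omega, qBinomial, ih n, ih (n + 1)]
      rw [Finset.Nat.sum_antidiagonal_succ]
      conv_rhs => rw [Finset.Nat.sum_antidiagonal_succ]
      simp only [qBinomial, qBinomial_zero_right, add_mul, Finset.sum_add_distrib]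
      rw [mul_add, Finset.mul_sum]
      have h1 : ∀ x ∈ Finset.HasAntidiagonal.antidiagonal n,
          q ^ (n + 1) * (qBinomial q d (x.1 + 1) * qBinomial q j x.2 * q ^ (x.2 * (d - (x.1 + 1))))
            = q ^ (x.1 + 1) * qBinomial q d (x.1 + 1) * qBinomial q j x.2 *
              q ^ (x.2 * (d + 1 - (x.1 + 1))) := by
        intro x hx
        rw [Finset.HasAntidiagonal.mem_antidiagonal] at hx
        by_cases h : d < x.1 + 1
        · rw [qBinomial_of_lt q d _ h]
          simp
        · obtain ⟨e, rfl⟩ := Nat.exists_eq_add_of_le (not_lt.1 h)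
          have e1 : x.1 + 1 + e - (x.1 + 1) = e := by omega
          have e2 : x.1 + 1 + e + 1 - (x.1 + 1) = e + 1 := by omega
          rw [e1, e2, ← hx]
          ring
      rw [Finset.sum_congr rfl h1]
      have h2 : ∀ x ∈ Finset.HasAntidiagonal.antidiagonal n,
          qBinomial q d x.1 * qBinomial q j x.2 * q ^ (x.2 * (d + 1 - (x.1 + 1))) =
          qBinomial q d x.1 * qBinomial q j x.2 * q ^ (x.2 * (d - x.1)) := by
        intro x _
        rw [Nat.add_sub_add_right]
      rw [Finset.sum_congr rfl h2]
      simp only [Nat.sub_zero]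
      ring

end QBinomial

/-- The weight `q^(m + (n choose 2) - n d) [d + j choose n]_q` of a standard tableau of size `n`
with `d` descents and major index `m`. It is the principal specialization in the variables
`1, q, …, q^(j-1)` of the fundamental quasisymmetric function that belongs to the complement of the
descent set. -/
def principalWeight {R : Type*} [CommRing R] (q : R) (n j d m : ℕ) : R :=
  q ^ (m + n.choose 2 - n * d) * qBinomial q (d + j) n

/-- The weight of a standard tableau of size `n` with `d` descents and major index `m` in the
expansion of the valley series. -/
def valleyWeight {R : Type*} [CommRing R] (q : R) (r d m : ℕ) : R :=
  q ^ (m + r.choose 2 - r * d) * qBinomial q d r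

theorem choose_two_succ (n : ℕ) : (n + 1).choose 2 = n.choose 2 + n := by
  rw [Nat.choose_succ_succ' n 1, Nat.choose_one_right, add_comm]

theorem choose_two_add (a b : ℕ) : (a + b).choose 2 = a.choose 2 + b.choose 2 + a * b := by
  induction b with
  | zero => simp
  | succ b ih => rw [← add_assoc, choose_two_succ, ih, choose_two_succ, mul_add]; omega

/-- The possible values of the number of descents `d` and the major index `m` of a standard tableau
of size `n`, as far as the exponents in the weights need them. -/
def Admissible (n d m : ℕ) : Prop := d ≤ n - 1 ∧ n * d ≤ m + n.choose 2 ∧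
  d * (d + 1) ≤ 2 * m

theorem Admissible.add_descent {n d m : ℕ} (h : Admissible n d m) (hn : 0 < n) :
    Admissible (n + 1) (d + 1) (m + n) := by
  obtain ⟨h1, h2, h3⟩ := h
  have hd : d + 1 ≤ n := by omega
  refine ⟨by omega, ?_, by nlinarith⟩
  rw [choose_two_succ]
  nlinarith

theorem Admissible.succ {n d m : ℕ} (h : Admissible n d m) : Admissible (n + 1) d m := by
  obtain ⟨h1, h2, h3⟩ := h
  refine ⟨by omega, ?_, h3⟩
  rw [choose_two_succ]
  have : d ≤ n := by omega
  nlinarith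

section Weights

variable {R : Type*} [CommRing R] (q : R)

theorem principalWeight_add_descent {n d m : ℕ} (j : ℕ) (h : Admissible n d m) (hn : 0 < n) :
    principalWeight q (n + 1) (j + 1) (d + 1) (m + n) =
      principalWeight q (n + 1) j (d + 1) (m + n) + q ^ j * principalWeight q n (j + 1) d m := by
  obtain ⟨h1, h2, h3⟩ := h
  have e1 : (n + 1) * (d + 1) = n * d + d + n + 1 := by ring
  simp only [principalWeight]
  rw [show d + 1 + (j + 1) = d + 1 + j + 1 by omega, qBinomial_succ_succ, choose_two_succ, e1,
    show d + (j + 1) = d + 1 + j by omega]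
  by_cases hlt : d + 1 + j < n
  · rw [qBinomial_of_lt q (d + 1 + j) n hlt]
    simp
  have e2 : m + n + (n.choose 2 + n) - (n * d + d + n + 1) + (d + 1 + j - n) =
      j + (m + n.choose 2 - n * d) := by omega
  rw [mul_add, ← mul_assoc, ← mul_assoc, ← pow_add, e2, pow_add]

theorem principalWeight_succ {n d m : ℕ} (j : ℕ) (h : Admissible n d m) :
    principalWeight q (n + 1) (j + 1) d m =
      principalWeight q (n + 1) j d m + q ^ j * principalWeight q n j d m := by
  obtain ⟨h1, h2, h3⟩ := h
  have e1 : (n + 1) * d = n * d + d := by ring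
  simp only [principalWeight]
  rw [show d + (j + 1) = d + j + 1 by omega, qBinomial_succ_succ, choose_two_succ, e1]
  by_cases hlt : d + j < n
  · rw [qBinomial_of_lt q (d + j) n hlt]
    simp
  have e2 : m + (n.choose 2 + n) - (n * d + d) + (d + j - n) =
      j + (m + n.choose 2 - n * d) := by omega
  rw [mul_add, ← mul_assoc, ← mul_assoc, ← pow_add, e2, pow_add]

/-- The `q`-Vandermonde identity as a relation between the two weights of a tableau. -/
theorem principalWeight_eq_sum {n d m : ℕ} (j : ℕ) (h : Admissible n d m) :
    principalWeight q n j d m = ∑ k ∈ Finset.range (n + 1),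
      q ^ k.choose 2 * qBinomial q j k * valleyWeight q (n - k) d m := by
  obtain ⟨-, h, h'⟩ := h
  rw [principalWeight, qBinomial_add, Finset.Nat.sum_antidiagonal_eq_sum_range_succ_mk,
    ← Finset.sum_range_reflect, Finset.mul_sum]
  refine Finset.sum_congr rfl fun k hk => ?_
  have hk' : k ≤ n := by simpa [Nat.lt_succ_iff] using hk
  have e0 : n + 1 - 1 - k = n - k := by omega
  simp only [valleyWeight, e0]
  obtain ⟨r, rfl⟩ := Nat.exists_eq_add_of_le hk'
  have e1 : k + r - k = r := by omega
  have e2 : k + r - r = k := by omega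
  rw [e1, e2]
  by_cases hr : d < r
  · rw [qBinomial_of_lt q d r hr]
    simp
  obtain ⟨e, rfl⟩ := Nat.exists_eq_add_of_le (not_lt.1 hr)
  rw [choose_two_add] at h ⊢
  have e3 : m + (k.choose 2 + r.choose 2 + k * r) - (k + r) * (r + e) + k * (r + e - r) =
      k.choose 2 + (m + r.choose 2 - r * (r + e)) := by
    have e4 : 2 * r.choose 2 + r = r * r := by
      clear * -
      induction r with
      | zero => rfl
      | succ r ih => rw [choose_two_succ]; nlinarith
    have e5 : (k + r) * (r + e) = k * r + k * e + r * (r + e) := by ring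
    have e6 : r * (r + e) ≤ m + r.choose 2 := by nlinarith
    rw [e5] at h
    rw [e5, Nat.add_sub_cancel_left]
    omega
  calc _ = q ^ (m + (k.choose 2 + r.choose 2 + k * r) - (k + r) * (r + e) + k * (r + e - r)) *
        (qBinomial q (r + e) r * qBinomial q j k) := by
        rw [pow_add]
        ring
    _ = _ := by
        rw [e3, pow_add]
        ring

end Weights

/-! ### Sums over walks -/

section Recurrence

variable {R : Type*} [CommRing R] {q : R} {f g : ℕ → ℕ → R} {E : ℕ → R}

/-- The recurrence and the values at `k = 0` determine the family, since `q` is cancellable. -/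
theorem recurrence_unique [IsDomain R] (hq : q ≠ 0) (hf0 : ∀ i, f 0 i = 1) (hg0 : ∀ i, g 0 i = 1)
    (hf : ∀ k i, q ^ k * (f k i + f (k + 1) i) = E i * f k (i + 1))
    (hg : ∀ k i, q ^ k * (g k i + g (k + 1) i) = E i * g k (i + 1)) (k i : ℕ) :
    f k i = g k i := by
  induction k generalizing i with
  | zero => rw [hf0, hg0]
  | succ k ih =>
    have h : q ^ k * (f k i + f (k + 1) i) = q ^ k * (g k i + g (k + 1) i) := by
      rw [hf, hg, ih]
    have h' := mul_left_cancel₀ (pow_ne_zero k hq) h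
    rw [ih i] at h'
    exact add_left_cancel h'

/-- Iterating the recurrence `j` times expands a product of `j` of the factors `E`. -/
theorem recurrence_prod (hf0 : ∀ i, f 0 i = 1)
    (hf : ∀ k i, q ^ k * (f k i + f (k + 1) i) = E i * f k (i + 1)) (j i : ℕ) :
    ∏ s ∈ Finset.range j, E (i + s) =
      ∑ k ∈ Finset.range (j + 1), q ^ k.choose 2 * qBinomial q j k * f k i := by
  induction j generalizing i with
  | zero => simp [hf0, qBinomial]
  | succ j ih =>
    have h1 : ∏ s ∈ Finset.range (j + 1), E (i + s) =
        E i * ∏ s ∈ Finset.range j, E (i + 1 + s) := by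
      rw [Finset.prod_range_succ', mul_comm]
      simp only [add_zero]
      congr 1
      exact Finset.prod_congr rfl fun s _ => by congr 1; omega
    rw [h1, ih, Finset.mul_sum]
    have h2 : ∀ k, E i * (q ^ k.choose 2 * qBinomial q j k * f k (i + 1)) =
        q ^ k.choose 2 * qBinomial q j k * (q ^ k * f k i) +
          q ^ (k + 1).choose 2 * qBinomial q j k * f (k + 1) i := by
      intro k
      rw [choose_two_succ, pow_add]
      linear_combination (-(q ^ k.choose 2 * qBinomial q j k)) * hf k i
    rw [Finset.sum_congr rfl fun k _ => h2 k, Finset.sum_add_distrib, Finset.sum_range_succ']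
    rw [Finset.sum_range_succ' _ (j + 1)]
    have h3 : ∑ k ∈ Finset.range j,
        q ^ (k + 1).choose 2 * qBinomial q j (k + 1) * (q ^ (k + 1) * f (k + 1) i) =
        ∑ k ∈ Finset.range (j + 1),
        q ^ (k + 1).choose 2 * qBinomial q j (k + 1) * (q ^ (k + 1) * f (k + 1) i) := by
      rw [Finset.sum_range_succ, qBinomial_of_lt q j (j + 1) (by omega)]
      simp
    rw [h3]
    have h4 : ∀ k, q ^ (k + 1).choose 2 * qBinomial q (j + 1) (k + 1) * f (k + 1) i =
        q ^ (k + 1).choose 2 * qBinomial q j (k + 1) * (q ^ (k + 1) * f (k + 1) i) +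
        q ^ (k + 1).choose 2 * qBinomial q j k * f (k + 1) i := by
      intro k
      rw [qBinomial]
      ring
    rw [Finset.sum_congr rfl fun k _ => h4 k, Finset.sum_add_distrib]
    simp only [qBinomial_zero_right]
    ring

/-- The matrix of the `q^(k choose 2) [j choose k]_q` is triangular with nonzero diagonal. -/
theorem eq_of_sum_qBinomial_eq [IsDomain R] (hq : q ≠ 0) {a b : ℕ → R} (n : ℕ)
    (h : ∀ j ≤ n, ∑ k ∈ Finset.range (j + 1), q ^ k.choose 2 * qBinomial q j k * a k =
      ∑ k ∈ Finset.range (j + 1), q ^ k.choose 2 * qBinomial q j k * b k) (k : ℕ) (hk : k ≤ n) :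
    a k = b k := by
  induction k using Nat.strong_induction_on with
  | _ k ih =>
    have h1 := h k hk
    rw [Finset.sum_range_succ, Finset.sum_range_succ, qBinomial_self, mul_one,
      Finset.sum_congr rfl fun i hi => by
        rw [ih i (Finset.mem_range.1 hi) (by have := Finset.mem_range.1 hi; omega)]] at h1
    exact mul_left_cancel₀ (pow_ne_zero _ hq) (add_left_cancel h1)

end Recurrence

theorem one_add_sum_mul_prod {R : Type*} [CommRing R] (z : ℕ → R) (c m : ℕ) :
    1 + ∑ p ∈ Finset.range m, z (c + p) * ∏ a ∈ Finset.Ico c (c + p), (1 + z a) =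
      ∏ a ∈ Finset.Ico c (c + m), (1 + z a) := by
  induction m with
  | zero => simp
  | succ m ih =>
    rw [Finset.sum_range_succ, ← add_assoc, ih, ← add_assoc c m 1,
      Finset.prod_Ico_succ_top (by omega)]
    ring

/-- The number of positions in `H` that lie strictly between `p` and `p + N`. -/
def attackers (N : ℕ) (H : List ℕ) (p : ℕ) : ℕ := H.countP fun c => p < c ∧ c < p + N

theorem attackers_nil (N p : ℕ) : attackers N [] p = 0 := rfl

theorem attackers_cons (N c p : ℕ) (H : List ℕ) :
    attackers N (c :: H) p = attackers N H p + if p < c ∧ c < p + N then 1 else 0 := by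
  simp [attackers, List.countP_cons]

/-- The generating function of the walks of length `n` on the positions `0, 1, 2, …` that start
after position `l` and have `k` free steps. A free step goes to a position below `l + N`, a marked
step to a position below `l`. The list `H` consists of the positions reached by free steps so far;
a step to `p` has weight `y p` times `q` to the number of attackers of `p`, diminished by `1` for
marked steps. -/
def walkSum {R : Type*} [CommSemiring R] (q : R) (y : ℕ → R) (N : ℕ) : ℕ → ℕ → List ℕ → ℕ → R
  | 0, 0, _, _ => 1
  | 0, _ + 1, _, _ => 0
  | n + 1, 0, H, l =>
    ∑ p ∈ Finset.range l, q ^ (attackers N H p - 1) * y p * walkSum q y N n 0 H p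
  | n + 1, k + 1, H, l =>
    ∑ p ∈ Finset.range (l + N), q ^ attackers N H p * y p * walkSum q y N n k (p :: H) p +
      ∑ p ∈ Finset.range l, q ^ (attackers N H p - 1) * y p * walkSum q y N n (k + 1) H p

/-- The equations that express the generating functions of walks of arbitrary length, with `k` free
steps, by the first step of the walk. -/
structure IsWalkSeries {A : Type*} [CommRing A] (q : A) (y : ℕ → A) (N : ℕ)
    (W : ℕ → List ℕ → ℕ → A) : Prop where
  zero : ∀ H l, W 0 H l =
    1 + ∑ p ∈ Finset.range l, q ^ (attackers N H p - 1) * y p * W 0 H p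
  succ : ∀ k H l, W (k + 1) H l =
    ∑ p ∈ Finset.range (l + N), q ^ attackers N H p * y p * W k (p :: H) p +
      ∑ p ∈ Finset.range l, q ^ (attackers N H p - 1) * y p * W (k + 1) H p

theorem isWalkSeries_mk {R : Type*} [CommRing R] (q : R) (y : ℕ → R) (N : ℕ) :
    IsWalkSeries (PowerSeries.C q) (fun p => PowerSeries.X * PowerSeries.C (y p)) N
      fun k H l => PowerSeries.mk fun n => walkSum q y N n k H l := by
  have key : ∀ (c : R) (p : ℕ) (F : ℕ → R) (n : ℕ), PowerSeries.coeff (n + 1)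
      (PowerSeries.C c * (PowerSeries.X * PowerSeries.C (y p)) * PowerSeries.mk F) =
      c * y p * F n := by
    intro c p F n
    rw [show PowerSeries.C c * (PowerSeries.X * PowerSeries.C (y p)) * PowerSeries.mk F =
      PowerSeries.X * (PowerSeries.C (c * y p) * PowerSeries.mk F) by rw [map_mul]; ring,
      PowerSeries.coeff_succ_X_mul, PowerSeries.coeff_C_mul, PowerSeries.coeff_mk]
  have key0 : ∀ (c : R) (p : ℕ) (F : ℕ → R), PowerSeries.constantCoeff
      (PowerSeries.C c * (PowerSeries.X * PowerSeries.C (y p)) * PowerSeries.mk F) = 0 := by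
    intro c p F
    simp
  constructor
  · intro H l
    ext n
    rw [map_add, map_sum]
    rcases n with _ | n
    · simp only [← map_pow, PowerSeries.coeff_zero_eq_constantCoeff_apply, key0]
      simp [walkSum, ← PowerSeries.coeff_zero_eq_constantCoeff_apply]
    · simp only [← map_pow, key]
      simp [walkSum, PowerSeries.coeff_one]
  · intro k H l
    ext n
    rw [map_add, map_sum, map_sum]
    rcases n with _ | n
    · simp only [← map_pow, PowerSeries.coeff_zero_eq_constantCoeff_apply, key0]
      simp [walkSum, ← PowerSeries.coeff_zero_eq_constantCoeff_apply]
    · simp only [← map_pow, key]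
      simp [walkSum]

namespace IsWalkSeries

variable {A : Type*} [CommRing A] {q : A} {y : ℕ → A} {N : ℕ} {W : ℕ → List ℕ → ℕ → A}

theorem zero_eq_prod (hW : IsWalkSeries q y N W) (H : List ℕ) (l : ℕ) :
    W 0 H l = ∏ p ∈ Finset.range l, (1 + q ^ (attackers N H p - 1) * y p) := by
  induction l with
  | zero => rw [hW.zero]; simp
  | succ l ih =>
    rw [hW.zero, Finset.sum_range_succ, ← add_assoc, ← hW.zero, Finset.prod_range_succ, ← ih]
    ring

/-- Raising the starting point by one admits one more marked and one more free first step. -/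
theorem succ_step (hW : IsWalkSeries q y N W) (k : ℕ) (H : List ℕ) (l : ℕ) :
    W (k + 1) H (l + 1) = (1 + q ^ (attackers N H l - 1) * y l) * W (k + 1) H l +
      q ^ attackers N H (l + N) * y (l + N) * W k ((l + N) :: H) (l + N) := by
  rw [hW.succ k H (l + 1), Finset.sum_range_succ, show l + 1 + N = l + N + 1 by omega,
    Finset.sum_range_succ]
  linear_combination -hW.succ k H l

end IsWalkSeries

/-! ### Walks confined to level `0` -/

section Inv

variable {A : Type*} [CommRing A] (q : A) (y : ℕ → A) (N : ℕ)

/-- The generating function of the ordered multiset partitions into `k` blocks, by inversions. The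
variable of the letter `p` is scaled by `q ^ e p`; the sum is over the last letter `p` of the first
block, which has the letters `a` of the later blocks with `a < p` as inversions. -/
def invSum : ℕ → (ℕ → ℕ) → A
  | 0, _ => 1
  | k + 1, e => ∑ p ∈ Finset.range N, q ^ e p * y p *
      (∏ a ∈ Finset.range p, (1 + q ^ e a * y a)) * invSum k fun a => if a < p then e a + 1 else e a

/-- If the positions from `N` on have weight `0`, the walk is confined to the positions below `N`,
and every free step may go to any of them; the walk is cut before each of its free steps. -/
theorem IsWalkSeries.eq_invSum {q : A} {y : ℕ → A} {N : ℕ} {W : ℕ → List ℕ → ℕ → A}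
    (hW : IsWalkSeries q y N W) (hy : ∀ p, N ≤ p → y p = 0) (k : ℕ) (H : List ℕ) (e : ℕ → ℕ)
    (he : ∀ p < N, attackers N H p = e p) : W k H 0 = invSum q y N k e := by
  -- the marked steps before the next free step form a subset of the positions below `l`
  have h1 : ∀ k H l, W k H l =
      (∏ p ∈ Finset.range l, (1 + q ^ (attackers N H p - 1) * y p)) * W k H 0 := by
    intro k H l
    rcases k with _ | k
    · rw [hW.zero_eq_prod, hW.zero_eq_prod]
      simp
    · induction l with
      | zero => simp
      | succ l ih =>
        rw [hW.succ_step, ih, hy (l + N) (by omega), Finset.prod_range_succ]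
        ring
  induction k generalizing H e with
  | zero => rw [hW.zero]; simp [invSum]
  | succ k ih =>
    rw [hW.succ, invSum]
    simp only [zero_add, Finset.range_zero, Finset.sum_empty, add_zero]
    refine Finset.sum_congr rfl fun p hp => ?_
    have hp' := Finset.mem_range.1 hp
    rw [h1, ih (p :: H) (fun a => if a < p then e a + 1 else e a), he p hp',
      mul_assoc _ _ (invSum _ _ _ _ _)]
    · congr 2
      refine Finset.prod_congr rfl fun a ha => ?_
      have ha' := Finset.mem_range.1 ha
      rw [attackers_cons, if_pos ⟨ha', by omega⟩, he a (by omega), Nat.add_sub_cancel]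
    · intro a ha
      rw [attackers_cons, he a ha]
      by_cases h : a < p
      · rw [if_pos ⟨h, by omega⟩, if_pos h]
      · rw [if_neg (fun h' => h h'.1), if_neg h, add_zero]

/-- The two terms on the left are the cases of an empty and of a nonempty first block. -/
theorem invSum_recurrence (k : ℕ) (e : ℕ → ℕ) :
    q ^ k * (invSum q y N k e + invSum q y N (k + 1) e) =
      (∏ a ∈ Finset.range N, (1 + q ^ e a * y a)) * invSum q y N k fun a => e a + 1 := by
  induction k generalizing e with
  | zero =>
    have h := one_add_sum_mul_prod (fun a => q ^ e a * y a) 0 N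
    simp only [zero_add, ← Finset.range_eq_Ico] at h
    simp [invSum, h]
  | succ k ih =>
    have h1 : invSum q y N (k + 1) e + invSum q y N (k + 1 + 1) e =
        ∑ p ∈ Finset.range N, q ^ e p * y p * (∏ a ∈ Finset.range p, (1 + q ^ e a * y a)) *
          (invSum q y N k (fun a => if a < p then e a + 1 else e a) +
            invSum q y N (k + 1) fun a => if a < p then e a + 1 else e a) := by
      rw [invSum, invSum.eq_2 q y N e (k + 1), ← Finset.sum_add_distrib]
      exact Finset.sum_congr rfl fun p _ => by ring
    rw [h1, invSum, Finset.mul_sum, Finset.mul_sum]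
    refine Finset.sum_congr rfl fun p hp => ?_
    have hp' := Finset.mem_range.1 hp
    have h2 := ih fun a => if a < p then e a + 1 else e a
    have h3 : (fun a => (if a < p then e a + 1 else e a) + 1) =
        fun a => if a < p then e a + 1 + 1 else e a + 1 := by
      funext a
      split_ifs <;> rfl
    have h4 : (∏ a ∈ Finset.range p, (1 + q ^ e a * y a)) *
        (∏ a ∈ Finset.range N, (1 + q ^ (if a < p then e a + 1 else e a) * y a)) =
        (∏ a ∈ Finset.range N, (1 + q ^ e a * y a)) *
          ∏ a ∈ Finset.range p, (1 + q ^ (e a + 1) * y a) := by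
      rw [← Finset.prod_range_mul_prod_Ico _ hp'.le, ← Finset.prod_range_mul_prod_Ico _ hp'.le]
      have h5 : ∏ a ∈ Finset.range p, (1 + q ^ (if a < p then e a + 1 else e a) * y a) =
          ∏ a ∈ Finset.range p, (1 + q ^ (e a + 1) * y a) :=
        Finset.prod_congr rfl fun a ha => by rw [if_pos (Finset.mem_range.1 ha)]
      have h6 : ∏ a ∈ Finset.Ico p N, (1 + q ^ (if a < p then e a + 1 else e a) * y a) =
          ∏ a ∈ Finset.Ico p N, (1 + q ^ e a * y a) :=
        Finset.prod_congr rfl fun a ha => by rw [if_neg (not_lt.2 (Finset.mem_Ico.1 ha).1)]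
      rw [h5, h6]
      ring
    rw [h3] at h2
    rw [pow_succ (n := k), pow_succ (n := e p)]
    linear_combination (q * (q ^ e p * y p * ∏ a ∈ Finset.range p, (1 + q ^ e a * y a))) * h2 +
      q * q ^ e p * y p * invSum q y N k (fun a => if a < p then e a + 1 + 1 else e a + 1) * h4

end Inv

/-! ### Walks without attackers -/

section Minimaj

variable {A : Type*} [CommRing A] (y : ℕ → A) (N : ℕ)

/-- The sum over the weakly increasing sequences of `k` positions that start at `c` or later and
grow by less than `N` in each step, where each of the positions passed on the way may be chosen in
addition. -/
def chainSum : ℕ → ℕ → A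
  | 0, _ => 1
  | k + 1, c => ∑ s ∈ Finset.range N, y (c + s) *
      (∏ a ∈ Finset.Ico c (c + s), (1 + y a)) * chainSum k (c + s)

/-- The same recurrence as `invSum_recurrence`, with a shift of the starting point by `N` in place
of a rise of all exponents by `1`. -/
theorem chainSum_recurrence (t : A) (hy : ∀ p, y (p + N) = t * y p) (k c : ℕ) :
    t ^ k * (chainSum y N k c + chainSum y N (k + 1) c) =
      (∏ a ∈ Finset.Ico c (c + N), (1 + y a)) * chainSum y N k (c + N) := by
  induction k generalizing c with
  | zero =>
    have h := one_add_sum_mul_prod y c N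
    simp [chainSum, h]
  | succ k ih =>
    have h1 : chainSum y N (k + 1) c + chainSum y N (k + 1 + 1) c =
        ∑ s ∈ Finset.range N, y (c + s) * (∏ a ∈ Finset.Ico c (c + s), (1 + y a)) *
          (chainSum y N k (c + s) + chainSum y N (k + 1) (c + s)) := by
      rw [chainSum, chainSum.eq_2 y N c (k + 1), ← Finset.sum_add_distrib]
      exact Finset.sum_congr rfl fun p _ => by ring
    rw [h1, chainSum, Finset.mul_sum, Finset.mul_sum]
    refine Finset.sum_congr rfl fun s _ => ?_
    have h2 := ih (c + s)
    have h3 : (∏ a ∈ Finset.Ico c (c + s), (1 + y a)) *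
        (∏ a ∈ Finset.Ico (c + s) (c + s + N), (1 + y a)) =
        (∏ a ∈ Finset.Ico c (c + N), (1 + y a)) *
          ∏ a ∈ Finset.Ico (c + N) (c + N + s), (1 + y a) := by
      rw [Finset.prod_Ico_consecutive _ (by omega) (by omega),
        Finset.prod_Ico_consecutive _ (by omega) (by omega), show c + s + N = c + N + s by omega]
    have h4 : y (c + N + s) = t * y (c + s) := by
      rw [← hy]
      congr 1
      omega
    rw [h4, pow_succ]
    rw [show c + s + N = c + N + s by omega] at h2 h3
    linear_combination (t * (y (c + s) * ∏ a ∈ Finset.Ico c (c + s), (1 + y a))) * h2 +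
      t * y (c + s) * chainSum y N k (c + N + s) * h3

/-- The positions in `H` are at most `c`, and each position below `c` has an attacker in `H`. -/
structure IsChain (N : ℕ) (H : List ℕ) (c : ℕ) : Prop where
  le : ∀ h ∈ H, h ≤ c
  attacked : ∀ p < c, 1 ≤ attackers N H p

theorem IsChain.attackers_eq_zero {N : ℕ} {H : List ℕ} {c p : ℕ} (h : IsChain N H c) (hp : c ≤ p) :
    attackers N H p = 0 := by
  rw [attackers, List.countP_eq_zero]
  intro a ha
  have := h.le a ha
  simp only [decide_eq_true_eq, not_and]
  omega

theorem IsChain.cons {N : ℕ} {H : List ℕ} {c c' : ℕ} (h : IsChain N H c) (hc : c ≤ c')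
    (hc' : c' < c + N) : IsChain N (c' :: H) c' := by
  constructor
  · intro a ha
    rcases List.mem_cons.1 ha with rfl | ha
    · exact le_rfl
    · exact (h.le a ha).trans hc
  · intro p hp
    rw [attackers_cons]
    by_cases hpc : p < c
    · have := h.attacked p hpc
      omega
    · rw [if_pos ⟨hp, by omega⟩]
      omega

open Classical in
/-- If `q = 0`, free steps go to positions without attackers, and marked steps to positions with
exactly one attacker. Each position passed by the free steps is open to a marked step at one point
of the walk only. -/
theorem IsWalkSeries.eq_chainSum {y : ℕ → A} {N : ℕ} {W : ℕ → List ℕ → ℕ → A}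
    (hW : IsWalkSeries (0 : A) y N W) (k : ℕ) (H : List ℕ) (c : ℕ) (hH : IsChain N H c) :
    W k H c = (∏ p ∈ Finset.range c, if attackers N H p = 1 then 1 + y p else 1) *
      chainSum y N k c := by
  have hfac : ∀ {H c}, IsChain N H c → ∀ p < c, 1 + (0 : A) ^ (attackers N H p - 1) * y p =
      if attackers N H p = 1 then 1 + y p else 1 := by
    intro H c hH p hp
    have := hH.attacked p hp
    split_ifs with h
    · simp [h]
    · rw [zero_pow (by omega)]
      simp
  induction k generalizing H c with
  | zero =>
    rw [hW.zero_eq_prod, chainSum, mul_one]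
    exact Finset.prod_congr rfl fun p hp => hfac hH p (Finset.mem_range.1 hp)
  | succ k ih =>
    -- the expansion by the next free step, for every starting point up to `c`
    have h1 : ∀ l ≤ c, W (k + 1) H l = ∑ c' ∈ Finset.Ico c (l + N), y c' *
        (∏ p ∈ Finset.range l, if attackers N H p = 1 ∧ c' < p + N then 1 + y p else 1) *
          W k (c' :: H) c' := by
      intro l
      induction l with
      | zero =>
        intro _
        rw [hW.succ]
        simp only [zero_add, Finset.range_zero, Finset.sum_empty, add_zero, Finset.prod_empty,
          mul_one]
        have hsub : Finset.Ico c N ⊆ Finset.range N := by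
          intro p hp
          rw [Finset.mem_range]
          exact (Finset.mem_Ico.1 hp).2
        rw [← Finset.sum_subset hsub]
        · refine Finset.sum_congr rfl fun p hp => ?_
          rw [hH.attackers_eq_zero (Finset.mem_Ico.1 hp).1, pow_zero, one_mul]
        · intro p hp hp'
          have hpc : p < c := by
            rw [Finset.mem_range] at hp
            rw [Finset.mem_Ico] at hp'
            omega
          have := hH.attacked p hpc
          rw [zero_pow (by omega)]
          ring
      | succ l ihl =>
        intro hl
        rw [hW.succ_step, ihl (by omega), hfac hH l (by omega), Finset.mul_sum]
        have h2 : ∀ c' ∈ Finset.Ico c (l + N),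
            (if attackers N H l = 1 then 1 + y l else 1) * (y c' *
              (∏ p ∈ Finset.range l, if attackers N H p = 1 ∧ c' < p + N then 1 + y p else 1) *
              W k (c' :: H) c') = y c' * (∏ p ∈ Finset.range (l + 1),
              if attackers N H p = 1 ∧ c' < p + N then 1 + y p else 1) * W k (c' :: H) c' := by
          intro c' hc'
          have hlt : c' < l + N := (Finset.mem_Ico.1 hc').2
          rw [Finset.prod_range_succ]
          simp only [hlt, and_true]
          ring
        rw [Finset.sum_congr rfl h2]
        by_cases hc : c ≤ l + N
        · rw [show l + 1 + N = l + N + 1 by omega, Finset.sum_Ico_succ_top hc]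
          congr 1
          rw [hH.attackers_eq_zero hc, pow_zero, one_mul]
          congr 1
          rw [Finset.prod_eq_one, mul_one]
          intro p hp
          rw [if_neg]
          rintro ⟨-, h⟩
          have := Finset.mem_range.1 hp
          omega
        · have := hH.attacked (l + N) (by omega)
          rw [zero_pow (by omega), Finset.Ico_eq_empty (by omega), Finset.Ico_eq_empty (by omega)]
          simp
    rw [h1 c le_rfl, Finset.sum_Ico_eq_sum_range, chainSum, Finset.mul_sum, Nat.add_sub_cancel_left]
    refine Finset.sum_congr rfl fun s hs => ?_
    have hs' := Finset.mem_range.1 hs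
    rw [ih _ _ (hH.cons (by omega) (by omega)),
      ← Finset.prod_range_mul_prod_Ico _ (show c ≤ c + s by omega)]
    have h2 : ∏ p ∈ Finset.Ico c (c + s),
        (if attackers N ((c + s) :: H) p = 1 then 1 + y p else 1) =
        ∏ p ∈ Finset.Ico c (c + s), (1 + y p) := by
      refine Finset.prod_congr rfl fun p hp => ?_
      obtain ⟨hp1, hp2⟩ := Finset.mem_Ico.1 hp
      have h4 : attackers N ((c + s) :: H) p = 1 := by
        have h5 : p < c + s ∧ c + s < p + N := ⟨hp2, by omega⟩
        rw [attackers_cons, hH.attackers_eq_zero hp1, if_pos h5]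
      rw [if_pos h4]
    have h3 : (∏ p ∈ Finset.range c,
          if attackers N H p = 1 ∧ c + s < p + N then 1 + y p else 1) *
        (∏ p ∈ Finset.range c, if attackers N ((c + s) :: H) p = 1 then 1 + y p else 1) =
        ∏ p ∈ Finset.range c, if attackers N H p = 1 then 1 + y p else 1 := by
      rw [← Finset.prod_mul_distrib]
      refine Finset.prod_congr rfl fun p hp => ?_
      have hp' := Finset.mem_range.1 hp
      have := hH.attacked p hp'
      rw [attackers_cons]
      by_cases hlt : c + s < p + N
      · simp only [hlt, and_true, show p < c + s by omega, if_true]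
        rw [if_neg (show ¬ attackers N H p + 1 = 1 by omega), mul_one]
      · simp [hlt]
    rw [h2, ← h3]
    ring

end Minimaj

/-! ### Labeled Dyck paths as walks -/

section WalkSet

/-- The number of unmarked steps of `s` before the step `i` that attack it. -/
def stepAttackers (N : ℕ) {n : ℕ} (s : Fin n → ℕ × Bool) (i : Fin n) : ℕ :=
  ∑ j, if j < i ∧ (s j).2 = false ∧ (s i).1 < (s j).1 ∧ (s j).1 < (s i).1 + N then 1 else 0

/-- The number of unmarked steps. -/
def unmarked {n : ℕ} (s : Fin n → ℕ × Bool) : ℕ := ∑ i, if (s i).2 = false then 1 else 0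

/-- The position before the step `i` of a walk that starts after position `l`. -/
def positionBefore (l : ℕ) {n : ℕ} (s : Fin n → ℕ × Bool) (i : Fin n) : ℕ :=
  (Fin.cons l (fun i => (s i).1) : Fin (n + 1) → ℕ) i.castSucc

/-- The sequences of positions and marks that are walks in the sense of `walkSum`. -/
def IsWalk (N l : ℕ) {n : ℕ} (s : Fin n → ℕ × Bool) : Prop :=
  ∀ i, (s i).1 < positionBefore l s i + if (s i).2 = false then N else 0

/-- The possible first steps of a walk that starts after position `l`. -/
def firstSteps (N l : ℕ) : Finset (ℕ × Bool) :=
  (Finset.range (l + N) ×ˢ {false}) ∪ (Finset.range l ×ˢ {true})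

theorem mem_firstSteps {N l : ℕ} {x : ℕ × Bool} :
    x ∈ firstSteps N l ↔ x.1 < l + if x.2 = false then N else 0 := by
  obtain ⟨p, b⟩ := x
  cases b <;> simp [firstSteps]

theorem sum_firstSteps {M : Type*} [AddCommMonoid M] (N l : ℕ) (f : ℕ × Bool → M) :
    ∑ x ∈ firstSteps N l, f x =
      ∑ p ∈ Finset.range (l + N), f (p, false) + ∑ p ∈ Finset.range l, f (p, true) := by
  rw [firstSteps, Finset.sum_union, Finset.sum_product, Finset.sum_product]
  · simp
  · rw [Finset.disjoint_left]
    rintro ⟨p, b⟩ h1 h2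
    simp only [Finset.mem_product, Finset.mem_singleton] at h1 h2
    rw [h1.2] at h2
    exact absurd h2.2 (by decide)

/-- The walk with a given first step and a given remainder. -/
def consWalk (n : ℕ) : ((_ : ℕ × Bool) × (Fin n → ℕ × Bool)) ↪ (Fin (n + 1) → ℕ × Bool) where
  toFun z := Fin.cons z.1 z.2
  inj' := by
    rintro ⟨x, s⟩ ⟨x', s'⟩ h
    obtain ⟨h1, h2⟩ := Fin.cons_inj.1 h
    subst h1 h2
    rfl

theorem consWalk_apply (n : ℕ) (z : (_ : ℕ × Bool) × (Fin n → ℕ × Bool)) :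
    consWalk n z = Fin.cons z.1 z.2 := rfl

/-- The finite set of the walks of length `n` that start after position `l`. -/
def walkFinset (N : ℕ) : (n : ℕ) → ℕ → Finset (Fin n → ℕ × Bool)
  | 0, _ => Finset.univ
  | n + 1, l => ((firstSteps N l).sigma fun x => walkFinset N n x.1).map (consWalk n)

theorem positionBefore_cons_zero (l : ℕ) {n : ℕ} (x : ℕ × Bool) (s : Fin n → ℕ × Bool) :
    positionBefore l (Fin.cons x s : Fin (n + 1) → ℕ × Bool) 0 = l := by
  simp [positionBefore]

theorem positionBefore_cons_succ (l : ℕ) {n : ℕ} (x : ℕ × Bool) (s : Fin n → ℕ × Bool)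
    (i : Fin n) : positionBefore l (Fin.cons x s : Fin (n + 1) → ℕ × Bool) i.succ =
      positionBefore x.1 s i := by
  rw [positionBefore, positionBefore, ← Fin.succ_castSucc, Fin.cons_succ]
  refine Fin.cases ?_ (fun j => ?_) i.castSucc <;> simp

theorem isWalk_cons (N l : ℕ) {n : ℕ} (x : ℕ × Bool) (s : Fin n → ℕ × Bool) :
    IsWalk N l (Fin.cons x s : Fin (n + 1) → ℕ × Bool) ↔ x ∈ firstSteps N l ∧ IsWalk N x.1 s := by
  rw [IsWalk, Fin.forall_fin_succ, mem_firstSteps]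
  simp only [positionBefore_cons_zero, positionBefore_cons_succ, Fin.cons_zero, Fin.cons_succ]
  rfl

theorem mem_walkFinset (N : ℕ) {n : ℕ} (l : ℕ) (s : Fin n → ℕ × Bool) :
    s ∈ walkFinset N n l ↔ IsWalk N l s := by
  induction n generalizing l with
  | zero =>
    simp only [walkFinset, Finset.mem_univ, IsWalk, true_iff]
    exact fun i => i.elim0
  | succ n ih =>
    rw [← Fin.cons_self_tail s, isWalk_cons, ← ih]
    simp only [walkFinset, Finset.mem_map, Finset.mem_sigma, consWalk_apply]
    constructor
    · rintro ⟨⟨x, s'⟩, ⟨h1, h2⟩, h3⟩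
      obtain ⟨h4, h5⟩ := Fin.cons_inj.1 h3
      simp only at h1 h2 h4 h5
      subst h5
      rw [h4] at h1 h2
      exact ⟨h1, h2⟩
    · rintro ⟨h1, h2⟩
      exact ⟨⟨s 0, Fin.tail s⟩, ⟨h1, h2⟩, rfl⟩

theorem stepAttackers_cons_zero (N : ℕ) {n : ℕ} (x : ℕ × Bool) (s : Fin n → ℕ × Bool) :
    stepAttackers N (Fin.cons x s : Fin (n + 1) → ℕ × Bool) 0 = 0 := by
  simp [stepAttackers]

theorem stepAttackers_cons_succ (N : ℕ) {n : ℕ} (x : ℕ × Bool) (s : Fin n → ℕ × Bool) (i : Fin n) :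
    stepAttackers N (Fin.cons x s : Fin (n + 1) → ℕ × Bool) i.succ =
      (if x.2 = false ∧ (s i).1 < x.1 ∧ x.1 < (s i).1 + N then 1 else 0) + stepAttackers N s i := by
  rw [stepAttackers, Fin.sum_univ_succ]
  simp only [Fin.cons_zero, Fin.cons_succ, Fin.succ_pos, true_and, Fin.succ_lt_succ_iff]
  rfl

theorem unmarked_cons {n : ℕ} (x : ℕ × Bool) (s : Fin n → ℕ × Bool) :
    unmarked (Fin.cons x s : Fin (n + 1) → ℕ × Bool) =
      (if x.2 = false then 1 else 0) + unmarked s := by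
  rw [unmarked, Fin.sum_univ_succ]
  simp only [Fin.cons_zero, Fin.cons_succ]
  rfl

variable {R : Type*} [CommSemiring R]

/-- The weight of a walk with preceding free positions `H`. -/
def walkWeight (q : R) (y : ℕ → R) (N : ℕ) (H : List ℕ) {n : ℕ} (s : Fin n → ℕ × Bool) : R :=
  ∏ i, q ^ (attackers N H (s i).1 + stepAttackers N s i - if (s i).2 = false then 0 else 1) *
    y (s i).1

theorem walkWeight_cons_false (q : R) (y : ℕ → R) (N : ℕ) (H : List ℕ) {n : ℕ} (p : ℕ)
    (s : Fin n → ℕ × Bool) :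
    walkWeight q y N H (Fin.cons (p, false) s : Fin (n + 1) → ℕ × Bool) =
      q ^ attackers N H p * y p * walkWeight q y N (p :: H) s := by
  rw [walkWeight, Fin.prod_univ_succ]
  simp only [Fin.cons_zero, Fin.cons_succ, stepAttackers_cons_zero, stepAttackers_cons_succ,
    if_true, add_zero, Nat.sub_zero, true_and, ← add_assoc]
  congr 1
  exact Finset.prod_congr rfl fun i _ => by rw [attackers_cons]

theorem walkWeight_cons_true (q : R) (y : ℕ → R) (N : ℕ) (H : List ℕ) {n : ℕ} (p : ℕ)
    (s : Fin n → ℕ × Bool) :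
    walkWeight q y N H (Fin.cons (p, true) s : Fin (n + 1) → ℕ × Bool) =
      q ^ (attackers N H p - 1) * y p * walkWeight q y N H s := by
  rw [walkWeight, Fin.prod_univ_succ]
  simp only [Fin.cons_zero, Fin.cons_succ, stepAttackers_cons_zero, stepAttackers_cons_succ,
    add_zero, Bool.true_eq_false, false_and, if_false, zero_add]
  rfl

theorem walkSum_eq_sum (q : R) (y : ℕ → R) (N n k : ℕ) (H : List ℕ) (l : ℕ) :
    walkSum q y N n k H l =
      ∑ s ∈ walkFinset N n l, if unmarked s = k then walkWeight q y N H s else 0 := by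
  induction n generalizing k H l with
  | zero =>
    cases k <;> simp [walkSum, walkFinset, unmarked, walkWeight]
  | succ n ih =>
    simp only [walkFinset]
    rw [Finset.sum_map, Finset.sum_sigma]
    simp only [consWalk_apply]
    rw [sum_firstSteps]
    simp only [unmarked_cons, walkWeight_cons_false, walkWeight_cons_true, if_true,
      Bool.true_eq_false, if_false, zero_add]
    rcases k with _ | k
    · simp only [walkSum, ih, Finset.mul_sum, mul_ite, mul_zero]
      simp
    · simp only [walkSum, ih, Finset.mul_sum, mul_ite, mul_zero,
        show ∀ m, (1 + m = k + 1) ↔ m = k from fun m => by omega]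

end WalkSet

section Position

/-- The position of a row with `a` full cells and label `b < N` in the total order by `a`, and then
by decreasing labels. -/
def position (N a b : ℕ) : ℕ := a * N + (N - 1 - b)

theorem position_lt_iff {N a b a' b' : ℕ} (hb : b < N) (hb' : b' < N) :
    position N a b < position N a' b' ↔ a < a' ∨ (a = a' ∧ b' < b) := by
  unfold position
  rcases lt_trichotomy a a' with h | h | h
  · have := Nat.mul_le_mul_right N (Nat.succ_le_of_lt h)
    rw [Nat.succ_mul] at this
    omega
  · subst h
    omega
  · have := Nat.mul_le_mul_right N (Nat.succ_le_of_lt h)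
    rw [Nat.succ_mul] at this
    omega

theorem position_add (N a b : ℕ) : position N a b + N = position N (a + 1) b := by
  unfold position
  rw [Nat.succ_mul]
  omega

theorem position_div {N a b : ℕ} (hb : b < N) : position N a b / N = a := by
  unfold position
  rw [mul_comm, Nat.mul_add_div (by omega), Nat.div_eq_of_lt (by omega), add_zero]

theorem position_mod {N a b : ℕ} (hb : b < N) : N - 1 - position N a b % N = b := by
  unfold position
  rw [mul_comm, Nat.mul_add_mod, Nat.mod_eq_of_lt (by omega)]
  omega

theorem position_div_mod {N : ℕ} (hN : 0 < N) (p : ℕ) :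
    position N (p / N) (N - 1 - p % N) = p := by
  unfold position
  have h1 := Nat.mod_lt p hN
  have h2 := Nat.div_add_mod p N
  rw [mul_comm]
  omega

theorem positionBefore_of_val_zero (l : ℕ) {n : ℕ} (s : Fin n → ℕ × Bool) (i : Fin n)
    (h : (i : ℕ) = 0) : positionBefore l s i = l := by
  rcases n with _ | n
  · exact i.elim0
  · obtain rfl : i = 0 := Fin.ext h
    simp [positionBefore]

theorem positionBefore_of_val_succ (l : ℕ) {n : ℕ} (s : Fin n → ℕ × Bool) (i j : Fin n)
    (h : (j : ℕ) + 1 = i) : positionBefore l s i = (s j).1 := by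
  have : i.castSucc = j.succ := Fin.ext h.symm
  rw [positionBefore, this, Fin.cons_succ]

end Position

namespace LabeledDyckPath

variable {n : ℕ} (P : LabeledDyckPath n)

theorem label_lt_of_weight {β : ℕ →₀ ℕ} {N : ℕ} (hβ : ∀ i ∈ β.support, i < N) (hP : P.weight = β)
    (i : Fin n) : P.label i < N :=
  hβ _ (hP ▸ P.label_mem i)

/-- The walk of a path with a set of marked rows. -/
def toWalk (N : ℕ) (S : Finset (Fin n)) (i : Fin n) : ℕ × Bool :=
  (position N (P.a i) (P.label i), decide (i ∈ S))

variable {N : ℕ}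

theorem attacks_iff (hN : ∀ i, P.label i < N) (i j : Fin n) :
    P.Attacks i j ↔ i < j ∧ position N (P.a j) (P.label j) < position N (P.a i) (P.label i) ∧
      position N (P.a i) (P.label i) < position N (P.a j) (P.label j) + N := by
  rw [Attacks, position_add, position_lt_iff (hN _) (hN _), position_lt_iff (hN _) (hN _)]
  refine and_congr_right fun _ => ?_
  omega

theorem isWalk_toWalk (hN : ∀ i, P.label i < N) (S : Finset (Fin n)) (hS : S ⊆ P.valleys) :
    IsWalk N 0 (P.toWalk N S) := by
  intro i
  by_cases hi : (i : ℕ) = 0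
  · have h1 : i ∉ S := fun h => by
      have h2 := hS h
      simp only [valleys, Finset.mem_filter] at h2
      obtain ⟨p, hp, -⟩ := h2.2
      omega
    have h2 := hN i
    rw [positionBefore_of_val_zero _ _ _ hi]
    simp only [toWalk, h1, decide_false, if_true, P.a_first i hi, position]
    omega
  · have hj : ((⟨i - 1, by omega⟩ : Fin n) : ℕ) + 1 = i := by simp only; omega
    set j : Fin n := ⟨i - 1, by omega⟩ with hjdef
    rw [positionBefore_of_val_succ _ _ _ _ hj]
    by_cases h : i ∈ S
    · have h2 := hS h
      simp only [valleys, Finset.mem_filter] at h2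
      obtain ⟨p, hp, hv⟩ := h2.2
      obtain rfl : p = j := Fin.ext (by omega)
      simp only [toWalk, h, decide_true, Bool.true_eq_false, if_false, add_zero]
      rw [position_lt_iff (hN _) (hN _)]
      exact hv
    · simp only [toWalk, h, decide_false, if_true]
      rw [position_add, position_lt_iff (hN _) (hN _)]
      have h1 := P.a_step j i hj.symm
      have h2 := P.label_lt j i hj.symm
      omega

theorem toWalk_injective {P Q : LabeledDyckPath n} (hP : ∀ i, P.label i < N)
    (hQ : ∀ i, Q.label i < N) {S T : Finset (Fin n)} (h : P.toWalk N S = Q.toWalk N T) :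
    P = Q ∧ S = T := by
  have h1 : ∀ i, position N (P.a i) (P.label i) = position N (Q.a i) (Q.label i) := fun i =>
    congrArg Prod.fst (congrFun h i)
  refine ⟨LabeledDyckPath.ext (funext fun i => ?_) (funext fun i => ?_), Finset.ext fun i => ?_⟩
  · rw [← position_div (a := P.a i) (hP i), h1, position_div (hQ i)]
  · rw [← position_mod (a := P.a i) (hP i), h1, position_mod (hQ i)]
  · have h2 := congrArg Prod.snd (congrFun h i)
    simpa [toWalk] using h2

theorem exists_toWalk (hN : 0 < N) (s : Fin n → ℕ × Bool) (hs : IsWalk N 0 s) :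
    ∃ (P : LabeledDyckPath n) (S : Finset (Fin n)), (∀ i, P.label i < N) ∧ S ⊆ P.valleys ∧
      P.toWalk N S = s := by
  have hstep : ∀ i j : Fin n, (j : ℕ) = i + 1 → (s j).1 / N < (s i).1 / N + 1 ∨
      ((s j).1 / N = (s i).1 / N + 1 ∧ N - 1 - (s i).1 % N < N - 1 - (s j).1 % N) := by
    intro i j hij
    have h1 := hs j
    rw [positionBefore_of_val_succ _ _ _ _ hij.symm] at h1
    have h2 : (s j).1 < (s i).1 + N := by
      split_ifs at h1 <;> omega
    rw [← position_div_mod hN (s j).1, ← position_div_mod hN (s i).1, position_add,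
      position_lt_iff (by omega) (by omega)] at h2
    exact h2
  let P : LabeledDyckPath n :=
    { a := fun i => (s i).1 / N
      label := fun i => N - 1 - (s i).1 % N
      a_first := fun i hi => by
        have h1 := hs i
        rw [positionBefore_of_val_zero _ _ _ hi] at h1
        apply Nat.div_eq_of_lt
        split_ifs at h1 <;> omega
      a_step := fun i j hij => by
        have := hstep i j hij
        omega
      label_lt := fun i j hij h => by
        have := hstep i j hij
        omega }
  have hP : ∀ i, P.label i < N := fun i => by
    show N - 1 - (s i).1 % N < N
    omega
  have hpos : ∀ i, position N (P.a i) (P.label i) = (s i).1 := fun i => position_div_mod hN _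
  refine ⟨P, Finset.univ.filter fun i => (s i).2 = true, hP, ?_, ?_⟩
  · intro i hi
    simp only [Finset.mem_filter, Finset.mem_univ, true_and] at hi
    simp only [valleys, Finset.mem_filter, Finset.mem_univ, true_and]
    have h1 := hs i
    rw [hi] at h1
    simp only [Bool.true_eq_false, if_false, add_zero] at h1
    by_cases hi0 : (i : ℕ) = 0
    · rw [positionBefore_of_val_zero _ _ _ hi0] at h1
      omega
    · have hj : ((⟨i - 1, by omega⟩ : Fin n) : ℕ) + 1 = i := by simp only; omega
      refine ⟨⟨i - 1, by omega⟩, hj, ?_⟩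
      rw [positionBefore_of_val_succ _ _ _ _ hj, ← hpos, ← hpos,
        position_lt_iff (hP _) (hP _)] at h1
      exact h1
  · funext i
    refine Prod.ext (hpos i) ?_
    simp [toWalk]

open Classical in
theorem stepAttackers_toWalk (hN : ∀ i, P.label i < N) (S : Finset (Fin n)) (i : Fin n) :
    stepAttackers N (P.toWalk N S) i = ∑ j ∈ Sᶜ, if P.Attacks j i then 1 else 0 := by
  rw [stepAttackers, ← Finset.sum_filter_add_sum_filter_not Finset.univ (fun j => j ∈ Sᶜ),
    Finset.filter_univ_mem]
  have h0 : ∑ j ∈ Finset.univ.filter fun j => ¬ j ∈ Sᶜ,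
      (if j < i ∧ (P.toWalk N S j).2 = false ∧ (P.toWalk N S i).1 < (P.toWalk N S j).1 ∧
        (P.toWalk N S j).1 < (P.toWalk N S i).1 + N then 1 else 0) = 0 := by
    refine Finset.sum_eq_zero fun j hj => if_neg ?_
    simp only [Finset.mem_filter, Finset.mem_compl, not_not] at hj
    simp [toWalk, hj.2]
  rw [h0, add_zero]
  refine Finset.sum_congr rfl fun j hj => ?_
  have hj' := Finset.mem_compl.1 hj
  simp [P.attacks_iff hN, toWalk, hj']

open Classical in
/-- The exponent of `q` is the sum over all rows of the number of attackers outside `S`, diminished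
by `1` for the rows in `S`. -/
theorem sum_stepAttackers (hN : ∀ i, P.label i < N) (S : Finset (Fin n)) (hS : S ⊆ P.valleys) :
    ∑ i, (stepAttackers N (P.toWalk N S) i - if (P.toWalk N S i).2 = false then 0 else 1) =
      P.dinv - ∑ i ∈ S, (P.d i + 1) := by
  have h1 : ∀ i, (if (P.toWalk N S i).2 = false then 0 else 1) = if i ∈ S then 1 else 0 := by
    intro i
    by_cases h : i ∈ S <;> simp [toWalk, h]
  have h2 : ∀ i ∈ S, 1 ≤ stepAttackers N (P.toWalk N S) i := by
    intro i hi
    have hv : P.IsValley i := by simpa [valleys] using hS hi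
    obtain ⟨j, hj, hji⟩ := P.exists_attacks_aux i i i.2 le_rfl rfl le_rfl hv
    rw [P.stepAttackers_toWalk hN]
    have hjS : j ∈ Sᶜ := by
      rw [Finset.mem_compl]
      intro hjs
      exact hj (by simpa [valleys] using hS hjs)
    calc 1 = (if P.Attacks j i then 1 else 0) := by simp [hji]
      _ ≤ _ := Finset.single_le_sum (f := fun j => if P.Attacks j i then 1 else 0)
        (fun _ _ => Nat.zero_le _) hjS
  have h3 : ∑ i, (stepAttackers N (P.toWalk N S) i -
      if (P.toWalk N S i).2 = false then 0 else 1) + S.card =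
      ∑ i, stepAttackers N (P.toWalk N S) i := by
    rw [show S.card = ∑ i, if i ∈ S then 1 else 0 by simp, ← Finset.sum_add_distrib]
    refine Finset.sum_congr rfl fun i _ => ?_
    rw [h1]
    by_cases h : i ∈ S
    · have := h2 i h
      simp only [h, if_true]
      omega
    · simp [h]
  have h4 : ∑ i, stepAttackers N (P.toWalk N S) i = ∑ j ∈ Sᶜ, P.d j := by
    simp only [P.stepAttackers_toWalk hN]
    rw [Finset.sum_comm]
    refine Finset.sum_congr rfl fun j _ => ?_
    rw [d, Finset.card_filter]
  have h5 : P.dinv = ∑ i ∈ S, P.d i + ∑ i ∈ Sᶜ, P.d i := (Finset.sum_add_sum_compl S _).symm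
  rw [Finset.sum_add_distrib, h5, ← h4, ← h3]
  simp only [Finset.sum_const, smul_eq_mul, mul_one]
  omega

end LabeledDyckPath

/-- The weight of a position, a power of `t` times a variable. -/
def positionWeight {K : Type*} [CommSemiring K] (t : K) (N p : ℕ) : MvPolynomial ℕ K :=
  MvPolynomial.C (t ^ (p / N)) * MvPolynomial.X (N - 1 - p % N)

theorem coeff_walkSum {K : Type*} [CommSemiring K] (q t : K) (n k N : ℕ) (hN : 0 < N) (hk : 1 ≤ k)
    (hkn : k ≤ n) (β : ℕ →₀ ℕ) (hβ : ∀ i ∈ β.support, i < N) :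
    MvPolynomial.coeff β
      (walkSum (MvPolynomial.C q) (positionWeight t N) N n k [] 0) = Val n (k - 1) q t β := by
  classical
  have hweight : ∀ s : Fin n → ℕ × Bool,
      walkWeight (MvPolynomial.C q) (positionWeight t N) N [] s =
      MvPolynomial.monomial (∑ i, Finsupp.single (N - 1 - (s i).1 % N) 1)
        (q ^ (∑ i, (stepAttackers N s i - if (s i).2 = false then 0 else 1)) *
          t ^ (∑ i, (s i).1 / N)) := by
    intro s
    rw [walkWeight, ← Finset.prod_pow_eq_pow_sum, ← Finset.prod_pow_eq_pow_sum,
      ← Finset.prod_mul_distrib, MvPolynomial.monomial_sum_index, map_prod,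
      ← Finset.prod_mul_distrib]
    refine Finset.prod_congr rfl fun i _ => ?_
    rw [attackers_nil, zero_add, positionWeight, map_mul, ← map_pow]
    simp only [MvPolynomial.X]
    ring
  have hterm : ∀ s : Fin n → ℕ × Bool, MvPolynomial.coeff β (if unmarked s = k then
      walkWeight (MvPolynomial.C q) (positionWeight t N) N [] s else 0) =
      if unmarked s = k ∧ ∑ i, Finsupp.single (N - 1 - (s i).1 % N) 1 = β then
        q ^ (∑ i, (stepAttackers N s i - if (s i).2 = false then 0 else 1)) *
          t ^ (∑ i, (s i).1 / N) else 0 := by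
    intro s
    rw [hweight]
    by_cases h : unmarked s = k
    · simp [h, MvPolynomial.coeff_monomial]
    · simp [h]
  rw [walkSum_eq_sum, MvPolynomial.coeff_sum, Finset.sum_congr rfl fun s _ => hterm s,
    ← Finset.sum_filter]
  unfold Val
  rw [Finset.sum_sigma']
  symm
  have hlab : ∀ P : {P : LabeledDyckPath n // P.weight = β}, ∀ i, P.1.label i < N := fun P =>
    P.1.label_lt_of_weight hβ P.2
  have hcard : ∀ (P : LabeledDyckPath n) (S : Finset (Fin n)),
      unmarked (P.toWalk N S) + S.card = n := by
    intro P S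
    have h1 : unmarked (P.toWalk N S) = Sᶜ.card := by
      rw [unmarked, ← Finset.card_filter]
      congr 1
      ext i
      simp [LabeledDyckPath.toWalk]
    rw [h1, Finset.card_compl_add_card, Fintype.card_fin]
  have hcontent : ∀ (P : LabeledDyckPath n) (S : Finset (Fin n)), (∀ i, P.label i < N) →
      ∑ i, Finsupp.single (N - 1 - (P.toWalk N S i).1 % N) 1 = P.weight := by
    intro P S hP
    refine Finset.sum_congr rfl fun i _ => ?_
    rw [LabeledDyckPath.toWalk, position_mod (hP i)]
  refine Finset.sum_bij (fun z _ => z.1.1.toWalk N z.2) ?_ ?_ ?_ ?_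
  · rintro ⟨P, S⟩ hz
    simp only [Finset.mem_sigma, Finset.mem_univ, true_and, Finset.mem_powersetCard] at hz
    rw [Finset.mem_filter, mem_walkFinset]
    have h1 := hcard P.1 S
    obtain ⟨hz1, hz2⟩ := hz
    refine ⟨P.1.isWalk_toWalk (hlab P) S hz1, ?_, (hcontent P.1 S (hlab P)).trans P.2⟩
    change S.card = _ at hz2
    change unmarked (P.1.toWalk N S) = k
    omega
  · rintro ⟨P, S⟩ _ ⟨Q, T⟩ _ h
    obtain ⟨h1, h2⟩ := LabeledDyckPath.toWalk_injective (hlab P) (hlab Q) h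
    have h3 : P = Q := Subtype.ext h1
    subst h2 h3
    rfl
  · intro s hs
    rw [Finset.mem_filter, mem_walkFinset] at hs
    obtain ⟨hs1, hs2, hs3⟩ := hs
    obtain ⟨P, S, hP, hS, rfl⟩ := LabeledDyckPath.exists_toWalk hN s hs1
    have h1 := hcard P S
    refine ⟨⟨⟨P, (hcontent P S hP).symm.trans hs3⟩, S⟩, ?_, rfl⟩
    simp only [Finset.mem_sigma, Finset.mem_univ, true_and, Finset.mem_powersetCard]
    exact ⟨hS, by omega⟩
  · rintro ⟨P, S⟩ hz
    simp only [Finset.mem_sigma, Finset.mem_univ, true_and, Finset.mem_powersetCard] at hz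
    simp only
    rw [P.1.sum_stepAttackers (hlab P) S hz.1, LabeledDyckPath.area]
    congr 2
    refine Finset.sum_congr rfl fun i _ => ?_
    rw [LabeledDyckPath.toWalk, position_div (hlab P i)]

/-! ### The two specializations of the valley series -/

section Specializations

/-- The power series ring in which the degree in the variables `x` is recorded by a variable of its
own. -/
abbrev GradedRing : Type := PowerSeries (MvPolynomial ℕ (Polynomial ℤ))

/-- The parameter `q` in `GradedRing`. -/
def gradedQ : GradedRing := PowerSeries.C (MvPolynomial.C Polynomial.X)

/-- The variable `x_b` in `GradedRing`, of degree `1`. -/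
def gradedVar (b : ℕ) : GradedRing := PowerSeries.X * PowerSeries.C (MvPolynomial.X b)

/-- The weight of a position in `GradedRing`. -/
def gradedPosition (t : Polynomial ℤ) (N p : ℕ) : GradedRing :=
  PowerSeries.X * PowerSeries.C (positionWeight t N p)

theorem gradedQ_ne_zero : gradedQ ≠ 0 := by
  rw [gradedQ, Ne, map_eq_zero_iff _ PowerSeries.C_injective,
    map_eq_zero_iff _ (MvPolynomial.C_injective _ _)]
  exact Polynomial.X_ne_zero

theorem gradedPosition_add {N : ℕ} (hN : 0 < N) (p : ℕ) :
    gradedPosition Polynomial.X N (p + N) = gradedQ * gradedPosition Polynomial.X N p := by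
  rw [gradedPosition, gradedPosition, gradedQ, positionWeight, positionWeight,
    Nat.add_div_right _ hN, Nat.add_mod_right, pow_succ, map_mul, map_mul, map_mul, map_mul]
  ring

theorem gradedPosition_mul_add {N : ℕ} (hN : 0 < N) (i p : ℕ) :
    gradedPosition Polynomial.X N (i * N + p) = gradedQ ^ i * gradedPosition Polynomial.X N p := by
  induction i with
  | zero => simp
  | succ i ih =>
    rw [show (i + 1) * N + p = i * N + p + N by ring, gradedPosition_add hN, ih, pow_succ]
    ring

theorem gradedPosition_of_lt (t : Polynomial ℤ) {N p : ℕ} (hp : p < N) :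
    gradedPosition t N p = gradedVar (N - 1 - p) := by
  rw [gradedPosition, gradedVar, positionWeight, Nat.div_eq_of_lt hp, Nat.mod_eq_of_lt hp]
  simp

theorem gradedPosition_zero_of_le {N p : ℕ} (hN : 0 < N) (hp : N ≤ p) :
    gradedPosition 0 N p = 0 := by
  have : p / N ≠ 0 := (Nat.div_pos hp hN).ne'
  rw [gradedPosition, positionWeight, zero_pow this]
  simp

/-- The generating function of the ordered multiset partitions into `k` blocks. -/
def blockSeries (N k : ℕ) : GradedRing := chainSum (gradedPosition Polynomial.X N) N k 0

theorem prod_gradedPosition (t : Polynomial ℤ) (N i : ℕ) :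
    ∏ a ∈ Finset.range N, (1 + gradedQ ^ i * gradedPosition t N a) =
      ∏ b ∈ Finset.range N, (1 + gradedQ ^ i * gradedVar b) := by
  rw [← Finset.prod_range_reflect (fun b => 1 + gradedQ ^ i * gradedVar b) N]
  exact Finset.prod_congr rfl fun a ha => by rw [gradedPosition_of_lt _ (Finset.mem_range.1 ha)]

theorem chainSum_recurrence_graded {N : ℕ} (hN : 0 < N) (k i : ℕ) :
    gradedQ ^ k * (chainSum (gradedPosition Polynomial.X N) N k (i * N) +
        chainSum (gradedPosition Polynomial.X N) N (k + 1) (i * N)) =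
      (∏ b ∈ Finset.range N, (1 + gradedQ ^ i * gradedVar b)) *
        chainSum (gradedPosition Polynomial.X N) N k ((i + 1) * N) := by
  rw [chainSum_recurrence _ N gradedQ (gradedPosition_add hN), Finset.prod_Ico_eq_prod_range,
    Nat.add_sub_cancel_left, Nat.succ_mul, ← prod_gradedPosition Polynomial.X N i]
  simp only [gradedPosition_mul_add hN]

theorem invSum_recurrence_graded (N k i : ℕ) :
    gradedQ ^ k * (invSum gradedQ (gradedPosition 0 N) N k (fun _ => i) +
        invSum gradedQ (gradedPosition 0 N) N (k + 1) (fun _ => i)) =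
      (∏ b ∈ Finset.range N, (1 + gradedQ ^ i * gradedVar b)) *
        invSum gradedQ (gradedPosition 0 N) N k (fun _ => i + 1) := by
  rw [invSum_recurrence, prod_gradedPosition]

/-- Both specializations solve the recurrence of `recurrence_unique`. -/
theorem invSum_eq_blockSeries {N : ℕ} (hN : 0 < N) (k : ℕ) :
    invSum gradedQ (gradedPosition 0 N) N k (fun _ => 0) = blockSeries N k := by
  have h := recurrence_unique gradedQ_ne_zero
    (f := fun k i => invSum gradedQ (gradedPosition 0 N) N k fun _ => i)
    (g := fun k i => chainSum (gradedPosition Polynomial.X N) N k (i * N))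
    (fun _ => rfl) (fun _ => rfl) (fun k i => invSum_recurrence_graded N k i)
    (fun k i => chainSum_recurrence_graded hN k i) k 0
  simpa [blockSeries] using h

theorem prod_eq_sum_blockSeries {N : ℕ} (hN : 0 < N) (j : ℕ) :
    ∏ i ∈ Finset.range j, ∏ b ∈ Finset.range N, (1 + gradedQ ^ i * gradedVar b) =
      ∑ k ∈ Finset.range (j + 1),
        gradedQ ^ k.choose 2 * qBinomial gradedQ j k * blockSeries N k := by
  have h := recurrence_prod (q := gradedQ)
    (f := fun k i => chainSum (gradedPosition Polynomial.X N) N k (i * N))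
    (E := fun i => ∏ b ∈ Finset.range N, (1 + gradedQ ^ i * gradedVar b))
    (fun _ => rfl) (fun k i => chainSum_recurrence_graded hN k i) j 0
  simpa [blockSeries] using h

variable {n k N : ℕ} {β : ℕ →₀ ℕ}

theorem Val_q_zero_eq_coeff (hN : 0 < N) (hk : 1 ≤ k) (hkn : k ≤ n)
    (hβ : ∀ i ∈ β.support, i < N) : Val n (k - 1) (Polynomial.X : Polynomial ℤ) 0 β =
      MvPolynomial.coeff β (PowerSeries.coeff n (blockSeries N k)) := by
  rw [← coeff_walkSum _ _ n k N hN hk hkn β hβ, ← invSum_eq_blockSeries hN]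
  have h := (isWalkSeries_mk (MvPolynomial.C Polynomial.X) (positionWeight (0 : Polynomial ℤ) N)
    N).eq_invSum (fun p hp => gradedPosition_zero_of_le hN hp) k [] (fun _ => 0)
    (fun p _ => attackers_nil N p)
  have h' := congrArg (PowerSeries.coeff n) h
  rw [PowerSeries.coeff_mk] at h'
  rw [h']
  rfl

theorem Val_zero_q_eq_coeff (hN : 0 < N) (hk : 1 ≤ k) (hkn : k ≤ n)
    (hβ : ∀ i ∈ β.support, i < N) : Val n (k - 1) 0 (Polynomial.X : Polynomial ℤ) β =
      MvPolynomial.coeff β (PowerSeries.coeff n (blockSeries N k)) := by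
  rw [← coeff_walkSum _ _ n k N hN hk hkn β hβ]
  have h0 := isWalkSeries_mk (MvPolynomial.C 0)
    (positionWeight (Polynomial.X : Polynomial ℤ) N) N
  rw [map_zero, map_zero] at h0
  have h := h0.eq_chainSum k [] 0
    ⟨fun _ h => absurd h List.not_mem_nil, fun _ h => absurd h (Nat.not_lt_zero _)⟩
  have h' := congrArg (PowerSeries.coeff n) h
  rw [PowerSeries.coeff_mk, Finset.range_zero, Finset.prod_empty, one_mul] at h'
  rw [map_zero, h']
  rfl

end Specializations

/-! ### Schur polynomials by interlacing sequences, and the dual Pieri rule -/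

/-- The indicator function of a set of rows. -/
def indicator {N : ℕ} (A : Finset (Fin N)) (i : Fin N) : ℕ := if i ∈ A then 1 else 0

theorem sum_indicator {N : ℕ} (A : Finset (Fin N)) : ∑ i, indicator A i = A.card := by
  simp [indicator]

/-- The sequences `ν` with `lam 0 ≥ ν 0 ≥ lam 1 ≥ ν 1 ≥ ⋯ ≥ lam N`, which means that `lam / ν` is a
horizontal strip. -/
def interlacing {N : ℕ} (lam : Fin (N + 1) → ℕ) : Finset (Fin N → ℕ) :=
  Fintype.piFinset fun i => Finset.Icc (lam i.succ) (lam i.castSucc)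

theorem mem_interlacing {N : ℕ} {lam : Fin (N + 1) → ℕ} {ν : Fin N → ℕ} :
    ν ∈ interlacing lam ↔ ∀ i, lam i.succ ≤ ν i ∧ ν i ≤ lam i.castSucc := by
  simp [interlacing, Fintype.mem_piFinset]

theorem antitone_of_mem_interlacing {N : ℕ} {lam : Fin (N + 1) → ℕ} {ν : Fin N → ℕ}
    (h : ν ∈ interlacing lam) : Antitone lam ∧ Antitone ν := by
  rw [mem_interlacing] at h
  have h1 : Antitone lam := Fin.antitone_iff_succ_le.2 fun i => (h i).1.trans (h i).2
  refine ⟨h1, fun i j hij => ?_⟩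
  rcases hij.eq_or_lt with rfl | hlt
  · exact le_rfl
  · refine (h j).2.trans (le_trans (h1 ?_) (h i).1)
    rw [Fin.le_def, Fin.val_succ, Fin.val_castSucc]
    exact hlt

section SchurSum

variable {R : Type*} [CommRing R] (x : ℕ → R)

/-- The Schur polynomial in the variables `x 0, …, x (N - 1)` of the partition `lam` with at most
`N` parts, as a sum over Gelfand–Tsetlin patterns. -/
def schurSum : (N : ℕ) → (Fin N → ℕ) → R
  | 0, _ => 1
  | N + 1, lam => ∑ ν ∈ interlacing lam,
      x N ^ (lam (Fin.last N) + ∑ i : Fin N, (lam i.castSucc - ν i)) * schurSum N ν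

/-- If `lam` is not a partition there is no interlacing sequence. -/
theorem schurSum_eq_zero (N : ℕ) (lam : Fin N → ℕ) (h : ¬ Antitone lam) : schurSum x N lam = 0 := by
  rcases N with _ | N
  · exact absurd (fun i => i.elim0) h
  · rw [schurSum]
    refine Finset.sum_eq_zero fun ν hν => absurd (antitone_of_mem_interlacing hν).1 h

theorem sum_prod_indicator {N : ℕ} (h : Fin N → ℕ → R) :
    ∑ A : Finset (Fin N), ∏ i, h i (indicator A i) = ∏ i, (h i 1 + h i 0) := by
  classical
  rw [Finset.prod_add, Finset.powerset_univ]
  refine Finset.sum_congr rfl fun A _ => ?_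
  rw [← Finset.prod_sdiff (Finset.subset_univ A), mul_comm]
  congr 1
  · exact Finset.prod_congr rfl fun i hi => by simp [indicator, hi]
  · exact Finset.prod_congr rfl fun i hi => by simp [indicator, (Finset.mem_sdiff.1 hi).2]

theorem prod_mul_last_of_telescoping {N : ℕ} (p : Fin (N + 1) → R) (g g' : Fin N → R)
    (h : ∀ i, g i * p i.succ = p i.castSucc * g' i) :
    (∏ i, g i) * p (Fin.last N) = p 0 * ∏ i, g' i := by
  induction N with
  | zero => simp
  | succ N ih =>
    have h1 := ih (fun i => p i.castSucc) (fun i => g i.castSucc) (fun i => g' i.castSucc)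
      fun i => h i.castSucc
    rw [Fin.prod_univ_castSucc, Fin.prod_univ_castSucc]
    have h2 := h (Fin.last N)
    rw [Fin.succ_last] at h2
    simp only [Fin.castSucc_zero] at h1
    linear_combination (∏ i : Fin N, g i.castSucc) * h2 + g' (Fin.last N) * h1

variable (z : R)

/-- The local rule for growth diagrams of dual type: for `μ` and `ν` fixed, it compares the
sequences `lam` for which `lam / μ` is a vertical strip and `lam / ν` a horizontal one with the
sequences `κ` for which `ν / κ` is a vertical strip and `μ / κ` a horizontal one. In each row there
are at most two choices. The choices for `lam` in row `i + 1` and those for `κ` in row `i` are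
restricted by the same comparison of `ν i` with `μ (i + 1)`, and only row `0` of `lam` is free from
such a restriction. -/
theorem dual_local_rule (t : R) {N : ℕ} (μ : Fin (N + 1) → ℕ) (ν : Fin N → ℕ) (hμ : Antitone μ)
    (hν : Antitone ν) :
    ∑ A : Finset (Fin (N + 1)), (if ν ∈ interlacing (fun i => μ i + indicator A i) then
        z ^ A.card * t ^ (μ (Fin.last N) + indicator A (Fin.last N) +
          ∑ i : Fin N, (μ i.castSucc + indicator A i.castSucc - ν i)) else 0) =
      (1 + z * t) * ∑ B : Finset (Fin N), ∑ κ ∈ interlacing μ,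
        if (fun i => κ i + indicator B i) = ν then
          z ^ B.card * t ^ (μ (Fin.last N) + ∑ i : Fin N, (μ i.castSucc - κ i)) else 0 := by
  classical
  -- `up` and `lo` are the contributions of row `i` to the conditions that compare `lam` with `ν`,
  -- from the row of `ν` above and from the row of `ν` at the same height
  let up : Fin (N + 1) → ℕ → R := fun i b =>
    Fin.cases 1 (fun i => if μ i.succ + b ≤ ν i then 1 else 0) i
  let lo : Fin (N + 1) → ℕ → R := fun i b =>
    Fin.lastCases (t ^ (μ (Fin.last N) + b))
      (fun i => if ν i ≤ μ i.castSucc + b then t ^ (μ i.castSucc + b - ν i) else 0) i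
  have up0 : ∀ b, up 0 b = 1 := fun b => rfl
  have ups : ∀ (i : Fin N) b, up i.succ b = if μ i.succ + b ≤ ν i then 1 else 0 := fun i b => rfl
  have lol : ∀ b, lo (Fin.last N) b = t ^ (μ (Fin.last N) + b) := fun b => by simp [lo]
  have loc : ∀ (i : Fin N) b, lo i.castSucc b =
      if ν i ≤ μ i.castSucc + b then t ^ (μ i.castSucc + b - ν i) else 0 := fun i b => by simp [lo]
  let h : Fin (N + 1) → ℕ → R := fun i b => z ^ b * (up i b * lo i b)
  have hL : ∀ A : Finset (Fin (N + 1)),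
      (if ν ∈ interlacing (fun i => μ i + indicator A i) then
        z ^ A.card * t ^ (μ (Fin.last N) + indicator A (Fin.last N) +
          ∑ i : Fin N, (μ i.castSucc + indicator A i.castSucc - ν i)) else 0) =
      ∏ i, h i (indicator A i) := by
    intro A
    simp only [h]
    rw [Finset.prod_mul_distrib, Finset.prod_mul_distrib, Finset.prod_pow_eq_pow_sum,
      sum_indicator, Fin.prod_univ_succ (fun i => up i _), Fin.prod_univ_castSucc (fun i => lo i _),
      up0, lol]
    have hcomm : ∀ c U L T : R, c * (1 * U * (L * T)) = c * T * (U * L) := fun c U L T => by ring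
    rw [hcomm, ← Finset.prod_mul_distrib]
    simp only [ups, loc]
    by_cases hc : ν ∈ interlacing (fun i => μ i + indicator A i)
    · rw [if_pos hc]
      rw [mem_interlacing] at hc
      rw [pow_add, ← Finset.prod_pow_eq_pow_sum, ← mul_assoc]
      congr 1
      refine Finset.prod_congr rfl fun i _ => ?_
      rw [if_pos (hc i).1, if_pos (hc i).2, one_mul]
    · rw [if_neg hc]
      rw [mem_interlacing] at hc
      push Not at hc
      obtain ⟨i, hi⟩ := hc
      rw [Finset.prod_eq_zero (Finset.mem_univ i)]
      · simp
      · by_cases h1 : μ i.succ + indicator A i.succ ≤ ν i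
        · rw [if_neg (not_le.2 (hi h1)), mul_zero]
        · rw [if_neg h1, zero_mul]
  rw [Finset.sum_congr rfl fun A _ => hL A, sum_prod_indicator]
  let f : Fin N → ℕ → ℕ → R := fun i b k =>
    if k + b = ν i then z ^ b * t ^ (μ i.castSucc - k) else 0
  have hR : ∀ (B : Finset (Fin N)) (κ : Fin N → ℕ),
      (if (fun i => κ i + indicator B i) = ν then
          z ^ B.card * t ^ (μ (Fin.last N) + ∑ i : Fin N, (μ i.castSucc - κ i)) else 0) =
      t ^ μ (Fin.last N) * ∏ i, f i (indicator B i) (κ i) := by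
    intro B κ
    by_cases hc : (fun i => κ i + indicator B i) = ν
    · rw [if_pos hc]
      have hf : ∀ i, f i (indicator B i) (κ i) =
          z ^ indicator B i * t ^ (μ i.castSucc - κ i) := fun i => if_pos (congrFun hc i)
      rw [Finset.prod_congr rfl fun i _ => hf i, Finset.prod_mul_distrib,
        Finset.prod_pow_eq_pow_sum, Finset.prod_pow_eq_pow_sum, sum_indicator, pow_add]
      ring
    · rw [if_neg hc]
      obtain ⟨i, hi⟩ := Function.ne_iff.1 hc
      rw [Finset.prod_eq_zero (Finset.mem_univ i), mul_zero]
      exact if_neg hi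
  let g' : Fin N → R := fun i =>
    (if μ i.succ + 1 ≤ ν i ∧ ν i ≤ μ i.castSucc + 1 then z * t ^ (μ i.castSucc + 1 - ν i) else 0) +
      if μ i.succ ≤ ν i ∧ ν i ≤ μ i.castSucc then t ^ (μ i.castSucc - ν i) else 0
  have hg' : ∀ i, ∑ k ∈ Finset.Icc (μ i.succ) (μ i.castSucc), f i 1 k +
      ∑ k ∈ Finset.Icc (μ i.succ) (μ i.castSucc), f i 0 k = g' i := by
    intro i
    simp only [f, g', add_zero, pow_zero, one_mul, pow_one, Finset.sum_ite_eq',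
      Finset.mem_Icc]
    congr 1
    rcases hm : ν i with _ | m
    · simp
    · simp only [Nat.add_right_cancel_iff, Finset.sum_ite_eq', Finset.mem_Icc,
        Nat.add_le_add_iff_right, Nat.add_sub_add_right]
  have hR' : ∑ B : Finset (Fin N), ∑ κ ∈ interlacing μ, (t ^ μ (Fin.last N) *
      ∏ i, f i (indicator B i) (κ i)) = t ^ μ (Fin.last N) * ∏ i, g' i := by
    simp only [← Finset.mul_sum, interlacing]
    congr 1
    simp only [← Finset.prod_univ_sum]
    rw [sum_prod_indicator fun i b => ∑ k ∈ Finset.Icc (μ i.succ) (μ i.castSucc), f i b k]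
    exact Finset.prod_congr rfl fun i _ => hg' i
  simp only [hR]
  rw [hR']
  -- the factor that passes from row to row in the comparison of the two products
  let p : Fin (N + 1) → R := fun i => z * t * up i 1 + up i 0
  have htel := prod_mul_last_of_telescoping p (fun i => h i.castSucc 1 + h i.castSucc 0) g' ?_
  · rw [Fin.prod_univ_castSucc]
    have hlast : h (Fin.last N) 1 + h (Fin.last N) 0 = t ^ μ (Fin.last N) * p (Fin.last N) := by
      simp only [h, p, lol]
      ring
    have hp0 : p 0 = 1 + z * t := by
      simp only [p, up0]
      ring
    rw [hlast, ← hp0]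
    linear_combination t ^ μ (Fin.last N) * htel
  · intro i
    have hup : ∀ b, μ i.castSucc + b ≤ ν i → up i.castSucc b = 1 := by
      intro b hb
      by_cases hi : i.castSucc = 0
      · rw [hi, up0]
      · obtain ⟨j, hj⟩ := Fin.exists_succ_eq.2 hi
        rw [← hj, ups, if_pos]
        rw [hj]
        refine hb.trans (hν ?_)
        have := congrArg Fin.val hj
        rw [Fin.val_succ, Fin.val_castSucc] at this
        rw [Fin.le_def]
        omega
    have hμi : μ i.succ ≤ μ i.castSucc := hμ (Fin.castSucc_lt_succ).le
    simp only [h, p, ups, loc, g', pow_one, pow_zero, add_zero, one_mul]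
    rcases lt_trichotomy (ν i) (μ i.castSucc + 1) with hlt | heq | hgt
    · obtain ⟨e, he⟩ := Nat.exists_eq_add_of_le (Nat.lt_succ_iff.1 hlt)
      have e1 : μ i.castSucc + 1 - ν i = e + 1 := by omega
      have e2 : μ i.castSucc - ν i = e := by omega
      rw [if_pos (show ν i ≤ μ i.castSucc + 1 by omega), if_pos (show ν i ≤ μ i.castSucc by omega),
        e1, e2]
      simp only [show ν i ≤ μ i.castSucc + 1 by omega, show ν i ≤ μ i.castSucc by omega, and_true]
      split_ifs <;> ring
    · rw [hup 1 heq.ge, hup 0 (by omega), heq]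
      simp [show μ i.succ ≤ μ i.castSucc + 1 by omega, hμi]
      ring
    · simp [show ¬ ν i ≤ μ i.castSucc + 1 by omega, show ¬ ν i ≤ μ i.castSucc by omega]

/-- The dual Pieri rule. Terms for which `μ + indicator A` is not weakly decreasing vanish by
`schurSum_eq_zero`, so the sum is over the vertical strips with at most one cell in each of the
first `N` rows. -/
theorem sum_schurSum_add_indicator (N : ℕ) (μ : Fin N → ℕ) (hμ : Antitone μ) :
    ∑ A : Finset (Fin N), z ^ A.card * schurSum x N (fun i => μ i + indicator A i) =
      (∏ b ∈ Finset.range N, (1 + z * x b)) * schurSum x N μ := by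
  classical
  induction N with
  | zero => simp [schurSum, Finset.eq_empty_of_isEmpty]
  | succ N ih =>
    let Big : Finset (Fin N → ℕ) := Fintype.piFinset fun _ => Finset.range (∑ i, μ i + 2)
    have hμle : ∀ i, μ i ≤ ∑ i, μ i := fun i =>
      Finset.single_le_sum (f := μ) (fun _ _ => Nat.zero_le _) (Finset.mem_univ i)
    have hind : ∀ {M : ℕ} (A : Finset (Fin M)) i, indicator A i ≤ 1 := fun A i => by
      unfold indicator
      split_ifs <;> simp
    have hL : ∀ A : Finset (Fin (N + 1)),
        z ^ A.card * schurSum x (N + 1) (fun i => μ i + indicator A i) =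
        ∑ ν ∈ Big, (if ν ∈ interlacing (fun i => μ i + indicator A i) then
        z ^ A.card * x N ^ (μ (Fin.last N) + indicator A (Fin.last N) +
          ∑ i : Fin N, (μ i.castSucc + indicator A i.castSucc - ν i)) else 0) *
          schurSum x N ν := by
      intro A
      have hsub : interlacing (fun i => μ i + indicator A i) ⊆ Big := by
        intro ν hν
        rw [mem_interlacing] at hν
        rw [Fintype.mem_piFinset]
        intro i
        rw [Finset.mem_range]
        have h1 := (hν i).2
        have h2 := hμle i.castSucc
        have h3 := hind A i.castSucc
        omega
      rw [schurSum, Finset.mul_sum, ← Finset.sum_subset hsub]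
      · refine Finset.sum_congr rfl fun ν hν => ?_
        rw [if_pos hν, mul_assoc]
      · intro ν _ hν
        rw [if_neg hν, zero_mul]
    have hR : (∏ b ∈ Finset.range (N + 1), (1 + z * x b)) * schurSum x (N + 1) μ =
        ∑ ν ∈ Big, ((1 + z * x N) * ∑ B : Finset (Fin N), ∑ κ ∈ interlacing μ,
          if (fun i => κ i + indicator B i) = ν then
            z ^ B.card * x N ^ (μ (Fin.last N) + ∑ i : Fin N, (μ i.castSucc - κ i)) else 0) *
          schurSum x N ν := by
      have h1 : ∀ κ ∈ interlacing μ, (∏ b ∈ Finset.range N, (1 + z * x b)) *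
          (x N ^ (μ (Fin.last N) + ∑ i : Fin N, (μ i.castSucc - κ i)) * schurSum x N κ) =
          ∑ B : Finset (Fin N), ∑ ν ∈ Big, (if (fun i => κ i + indicator B i) = ν then
            z ^ B.card * x N ^ (μ (Fin.last N) + ∑ i : Fin N, (μ i.castSucc - κ i)) else 0) *
          schurSum x N ν := by
        intro κ hκ
        rw [mul_left_comm, ← ih κ (antitone_of_mem_interlacing hκ).2, Finset.mul_sum]
        refine Finset.sum_congr rfl fun B _ => ?_
        rw [Finset.sum_eq_single (fun i => κ i + indicator B i)]
        · rw [if_pos rfl]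
          ring
        · intro ν _ hν
          rw [if_neg (Ne.symm hν), zero_mul]
        · intro hν
          refine absurd ?_ hν
          rw [Fintype.mem_piFinset]
          intro i
          rw [Finset.mem_range]
          rw [mem_interlacing] at hκ
          have h1 := (hκ i).2
          have h2 := hμle i.castSucc
          have h3 := hind B i
          omega
      rw [Finset.prod_range_succ, schurSum, mul_comm (∏ b ∈ Finset.range N, (1 + z * x b)),
        mul_assoc, Finset.mul_sum, Finset.sum_congr rfl h1]
      simp only [mul_assoc]
      rw [← Finset.mul_sum]
      congr 1
      simp only [Finset.sum_mul]
      rw [Finset.sum_comm]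
      simp only [Finset.sum_comm (t := Big)]
    rw [Finset.sum_congr rfl fun A _ => hL A, Finset.sum_comm, hR]
    refine Finset.sum_congr rfl fun ν _ => ?_
    rw [← Finset.sum_mul]
    by_cases hν : Antitone ν
    · rw [dual_local_rule z (x N) μ ν hμ hν]
    · rw [schurSum_eq_zero x N ν hν, mul_zero, mul_zero]

end SchurSum

/-! ### Sums over standard tableaux by their descents -/

section TableauSum

variable {R : Type*} [CommRing R] {N : ℕ}

/-- Lowering the rows in `A` by one cell leaves a partition. -/
def IsRemovable (lam : Fin N → ℕ) (A : Finset (Fin N)) : Prop :=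
  (∀ i ∈ A, 0 < lam i) ∧ Antitone fun i => lam i - indicator A i

open Classical in
/-- The sum of `f d m r` over the standard tableaux with row lengths `lam` and size `n`, where `d`
is the number of descents, `m` the major index and `r` the row of the largest entry, by recursion on
the largest entry. The empty tableau has `r = N`, so that the entry `1` never makes a descent. -/
def tableauSum : ℕ → (Fin N → ℕ) → (ℕ → ℕ → ℕ → R) → R
  | 0, _, f => f 0 0 N
  | n + 1, lam, f => ∑ r : Fin N, if IsRemovable lam {r} then
      tableauSum n (fun i => lam i - indicator {r} i)
        (fun d m r' => if r' < r then f (d + 1) (m + n) r else f d m r)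
      else 0

/-- Only admissible statistics occur in the sum. -/
theorem tableauSum_congr {n : ℕ} {lam : Fin N → ℕ} {f g : ℕ → ℕ → ℕ → R}
    (h : ∀ d m r, Admissible n d m → (n = 0 ∧ r = N ∨ 0 < n ∧ r < N) → f d m r = g d m r) :
    tableauSum n lam f = tableauSum n lam g := by
  induction n generalizing lam f g with
  | zero => exact h 0 0 N ⟨by simp, by simp, by simp⟩ (Or.inl ⟨rfl, rfl⟩)
  | succ n ih =>
    simp only [tableauSum]
    refine Finset.sum_congr rfl fun r _ => ?_
    congr 1
    refine ih fun d m r' had hr' => ?_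
    split_ifs with hlt
    · refine h _ _ _ (had.add_descent ?_) (Or.inr ⟨by omega, r.2⟩)
      have := r.2
      omega
    · exact h _ _ _ had.succ (Or.inr ⟨by omega, r.2⟩)

theorem map_tableauSum {S : Type*} [CommRing S] (φ : R →+* S) (n : ℕ) (lam : Fin N → ℕ)
    (f : ℕ → ℕ → ℕ → R) :
    φ (tableauSum n lam f) = tableauSum n lam fun d m r => φ (f d m r) := by
  induction n generalizing lam f with
  | zero => rfl
  | succ n ih =>
    simp only [tableauSum]
    rw [map_sum]
    refine Finset.sum_congr rfl fun r _ => ?_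
    split_ifs
    · rw [ih]
      congr 1
      funext d m r'
      split_ifs <;> rfl
    · rw [map_zero]

theorem tableauSum_add (n : ℕ) (lam : Fin N → ℕ) (f g : ℕ → ℕ → ℕ → R) :
    tableauSum n lam (fun d m r => f d m r + g d m r) =
      tableauSum n lam f + tableauSum n lam g := by
  induction n generalizing lam f g with
  | zero => rfl
  | succ n ih =>
    simp only [tableauSum]
    rw [← Finset.sum_add_distrib]
    refine Finset.sum_congr rfl fun r _ => ?_
    split_ifs
    · rw [← ih]
      congr 1
      funext d m r'
      split_ifs <;> rfl
    · rw [add_zero]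

theorem tableauSum_mul (n : ℕ) (lam : Fin N → ℕ) (c : R) (f : ℕ → ℕ → ℕ → R) :
    tableauSum n lam (fun d m r => c * f d m r) = c * tableauSum n lam f := by
  induction n generalizing lam f with
  | zero => rfl
  | succ n ih =>
    simp only [tableauSum]
    rw [Finset.mul_sum]
    refine Finset.sum_congr rfl fun r _ => ?_
    split_ifs
    · rw [← ih]
      congr 1
      funext d m r'
      split_ifs <;> rfl
    · rw [mul_zero]

theorem tableauSum_zero (n : ℕ) (lam : Fin N → ℕ) :
    tableauSum n lam (fun _ _ _ => (0 : R)) = 0 := by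
  have h := tableauSum_mul n lam (0 : R) fun _ _ _ => 0
  simpa using h

theorem tableauSum_sum {ι : Type*} (n : ℕ) (lam : Fin N → ℕ) (s : Finset ι)
    (f : ι → ℕ → ℕ → ℕ → R) :
    tableauSum n lam (fun d m r => ∑ i ∈ s, f i d m r) = ∑ i ∈ s, tableauSum n lam (f i) := by
  classical
  induction s using Finset.induction_on with
  | empty => simp [tableauSum_zero]
  | insert a s ha ih =>
    simp only [Finset.sum_insert ha]
    rw [tableauSum_add, ih]

theorem sum_powerset_max {α : Type*} [LinearOrder α] (s : Finset α) (g : Finset α → R) :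
    ∑ A ∈ s.powerset, g A =
      g ∅ + ∑ r ∈ s, ∑ A ∈ (s.filter (· < r)).powerset, g (insert r A) := by
  induction s using Finset.induction_on_max with
  | empty => simp
  | insert a s ha ih =>
    have has : a ∉ s := fun h => lt_irrefl a (ha a h)
    rw [Finset.sum_powerset_insert has, ih, Finset.sum_insert has]
    have h1 : (insert a s).filter (· < a) = s := by
      ext b
      simp only [Finset.mem_filter, Finset.mem_insert]
      exact ⟨fun h => h.1.resolve_left h.2.ne, fun h => ⟨Or.inr h, ha b h⟩⟩
    have h2 : ∀ r ∈ s, (insert a s).filter (· < r) = s.filter (· < r) := by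
      intro r hr
      ext b
      simp only [Finset.mem_filter, Finset.mem_insert]
      refine ⟨fun h => ⟨h.1.resolve_left ?_, h.2⟩, fun h => ⟨Or.inr h.1, h.2⟩⟩
      rintro rfl
      exact lt_asymm h.2 (ha r hr)
    rw [h1, add_assoc, add_comm (∑ r ∈ s, _)]
    congr 2
    exact Finset.sum_congr rfl fun r hr => by rw [h2 r hr]

variable (q : R)

/-- The sum of the principal weights over the standard tableaux with row lengths `lam`, which is
`s_lam'(1, q, …, q^(j-1))` for the conjugate partition `lam'`. -/
def principalSum (j n : ℕ) (lam : Fin N → ℕ) : R :=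
  tableauSum n lam fun d m _ => principalWeight q n j d m

/-- The part of `principalSum q (j + 1) n lam - principalSum q j n lam` that comes from the tableaux
with the largest entry in row `r`. -/
def principalDiff (j n : ℕ) (lam : Fin N → ℕ) (r : Fin N) : R :=
  tableauSum n lam fun d m r' =>
    if r' = r then principalWeight q n (j + 1) d m - principalWeight q n j d m else 0

open Classical in
theorem principalDiff_succ (j n : ℕ) (lam : Fin N → ℕ) (r : Fin N) :
    principalDiff q j (n + 1) lam r = if IsRemovable lam {r} then
      q ^ j * (principalSum q j n (fun i => lam i - indicator {r} i) +
        ∑ r' ∈ Finset.univ.filter (· < r),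
          principalDiff q j n (fun i => lam i - indicator {r} i) r') else 0 := by
  rw [principalDiff, tableauSum, Finset.sum_eq_single r]
  · congr 1
    simp only [principalSum, principalDiff]
    rw [← tableauSum_sum, ← tableauSum_add, ← tableauSum_mul]
    refine tableauSum_congr fun d m r' had hr' => ?_
    simp only [if_true]
    split_ifs with hlt
    · rw [Finset.sum_eq_single (⟨r', hlt.trans r.2⟩ : Fin N)]
      · have hn : 0 < n := by
          have := r.2
          omega
        rw [if_pos rfl, principalWeight_add_descent q j had hn]
        ring
      · intro b _ hb
        rw [if_neg]
        rintro rfl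
        exact hb rfl
      · intro h
        refine absurd ?_ h
        simp only [Finset.mem_filter, Finset.mem_univ, true_and, Fin.lt_def]
        exact hlt
    · rw [Finset.sum_eq_zero, principalWeight_succ q j had]
      · ring
      · intro b hb
        rw [if_neg]
        rintro rfl
        simp only [Finset.mem_filter, Finset.mem_univ, true_and, Fin.lt_def] at hb
        exact hlt hb
  · intro b _ hb
    have h : (b : ℕ) ≠ r := fun h => hb (Fin.ext h)
    simp only [h, if_false, ite_self, tableauSum_zero]
  · simp

theorem isRemovable_insert {lam : Fin N → ℕ} (hlam : Antitone lam) {r : Fin N}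
    {A : Finset (Fin N)} (hA : ∀ i ∈ A, i < r) :
    IsRemovable lam (insert r A) ↔
      IsRemovable lam {r} ∧ IsRemovable (fun i => lam i - indicator {r} i) A := by
  have hrA : r ∉ A := fun h => lt_irrefl r (hA r h)
  have h1 : ∀ i, lam i - indicator {r} i - indicator A i = lam i - indicator (insert r A) i := by
    intro i
    by_cases hi : i = r
    · subst hi
      simp [indicator, hrA]
    · simp [indicator, hi]
  have h2 : ∀ i, i ≠ r → indicator {r} i = 0 := fun i hi => by simp [indicator, hi]
  unfold IsRemovable
  simp only [h1]
  constructor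
  · rintro ⟨hpos, hanti⟩
    refine ⟨⟨fun i hi => hpos i ?_, fun i k hik => ?_⟩, fun i hi => ?_, hanti⟩
    · rw [Finset.mem_singleton.1 hi]
      exact Finset.mem_insert_self r A
    · have h3 := hlam hik
      by_cases hi : i = r
      · subst hi
        rcases hik.eq_or_lt with rfl | hlt
        · exact le_rfl
        · have h4 := hanti hik
          have h5 : k ∉ insert i A := by
            rw [Finset.mem_insert]
            rintro (rfl | h)
            · exact lt_irrefl _ hlt
            · exact lt_asymm hlt (hA k h)
          have h6 : indicator (insert i A) k = 0 := by simp [indicator, h5]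
          have h7 : indicator (insert i A) i = 1 := by simp [indicator]
          have h8 : indicator {i} i = 1 := by simp [indicator]
          simp only [h6, h7] at h4
          simp only [h8]
          omega
      · simp only [h2 i hi]
        omega
    · have := hpos i (Finset.mem_insert_of_mem hi)
      rw [h2 i (hA i hi).ne]
      exact this
  · rintro ⟨⟨hpos, -⟩, hpos', hanti⟩
    refine ⟨fun i hi => ?_, hanti⟩
    rcases Finset.mem_insert.1 hi with rfl | hi
    · exact hpos i (Finset.mem_singleton_self i)
    · have := hpos' i hi
      omega

theorem sub_indicator_insert (lam : Fin N → ℕ) {r : Fin N} {A : Finset (Fin N)} (hA : r ∉ A) :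
    (fun i => lam i - indicator {r} i - indicator A i) =
      fun i => lam i - indicator (insert r A) i := by
  funext i
  by_cases hi : i = r
  · subst hi
    simp [indicator, hA]
  · simp [indicator, hi]

theorem indicator_le {lam : Fin N → ℕ} {A : Finset (Fin N)} (h : ∀ i ∈ A, 0 < lam i) (i : Fin N) :
    indicator A i ≤ lam i := by
  unfold indicator
  split_ifs with hi
  · exact h i hi
  · exact Nat.zero_le _

theorem sum_sub_indicator {lam : Fin N → ℕ} {A : Finset (Fin N)} (h : ∀ i ∈ A, 0 < lam i) :
    ∑ i, (lam i - indicator A i) + A.card = ∑ i, lam i := by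
  rw [← sum_indicator, ← Finset.sum_add_distrib]
  exact Finset.sum_congr rfl fun i _ => Nat.sub_add_cancel (indicator_le h i)

open Classical in
/-- The contribution of the removal of the vertical strip with rows `A`. -/
def stripTerm (j n : ℕ) (lam : Fin N → ℕ) (A : Finset (Fin N)) : R :=
  if IsRemovable lam A then
    q ^ (j * A.card) * principalSum q j (n - A.card) (fun i => lam i - indicator A i) else 0

theorem stripTerm_empty (j n : ℕ) {lam : Fin N → ℕ} (hlam : Antitone lam) :
    stripTerm q j n lam ∅ = principalSum q j n lam := by
  have h : IsRemovable lam ∅ := ⟨by simp, by simpa [indicator] using hlam⟩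
  rw [stripTerm, if_pos h]
  simp [indicator]

/-- If the largest entries of a standard tableau carry the variable `q^j`, they form a vertical
strip, and the row of the largest entry is its lowest row. -/
theorem principalDiff_eq_sum (j n : ℕ) (lam : Fin N → ℕ) (hlam : Antitone lam)
    (hn : ∑ i, lam i = n) (r : Fin N) :
    principalDiff q j n lam r =
      ∑ A ∈ (Finset.univ.filter (· < r)).powerset, stripTerm q j n lam (insert r A) := by
  induction n generalizing lam r with
  | zero =>
    have h : (N : ℕ) ≠ r := r.2.ne'
    rw [principalDiff, tableauSum, if_neg h, Finset.sum_eq_zero]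
    intro A _
    refine if_neg fun hA => ?_
    have h1 := hA.1 r (Finset.mem_insert_self r A)
    have h2 := Finset.single_le_sum (f := lam) (fun _ _ => Nat.zero_le _) (Finset.mem_univ r)
    omega
  | succ n ih =>
    rw [principalDiff_succ]
    by_cases hr : IsRemovable lam {r}
    · have hcard := sum_sub_indicator hr.1
      rw [Finset.card_singleton, hn] at hcard
      rw [if_pos hr, Finset.sum_congr rfl fun r' _ => ih _ hr.2 (by omega) r',
        ← stripTerm_empty q j n hr.2]
      have hfilter : ∀ r' ∈ Finset.univ.filter (· < r), Finset.univ.filter (· < r') =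
          (Finset.univ.filter (· < r)).filter (· < r') := by
        intro r' hr'
        simp only [Finset.mem_filter, Finset.mem_univ, true_and] at hr'
        ext b
        simp only [Finset.mem_filter, Finset.mem_univ, true_and]
        exact ⟨fun h => ⟨h.trans hr', h⟩, fun h => h.2⟩
      rw [Finset.sum_congr rfl fun r' hr' => by rw [hfilter r' hr'],
        ← sum_powerset_max _ (stripTerm q j n _), Finset.mul_sum]
      refine Finset.sum_congr rfl fun A hA => ?_
      have hA' : ∀ i ∈ A, i < r := fun i hi => by
        simpa using Finset.mem_powerset.1 hA hi
      have hrA : r ∉ A := fun h => lt_irrefl r (hA' r h)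
      have hiff := isRemovable_insert hlam hA'
      unfold stripTerm
      by_cases hc : IsRemovable (fun i => lam i - indicator {r} i) A
      · rw [if_pos hc, if_pos (hiff.2 ⟨hr, hc⟩), sub_indicator_insert lam hrA,
          Finset.card_insert_of_notMem hrA, Nat.add_sub_add_right, ← mul_assoc, ← pow_add]
        congr 2
        ring
      · rw [if_neg hc, if_neg fun h => hc (hiff.1 h).2, mul_zero]
    · rw [if_neg hr, Finset.sum_eq_zero]
      intro A hA
      refine if_neg fun h => hr ?_
      exact ((isRemovable_insert hlam fun i hi => by
        simpa using Finset.mem_powerset.1 hA hi).1 h).1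

/-- The branching rule of the conjugate Schur function: the cells with the variable `q^j` form a
vertical strip. -/
theorem principalSum_succ (j n : ℕ) (lam : Fin N → ℕ) (hlam : Antitone lam)
    (hn : ∑ i, lam i = n) :
    principalSum q (j + 1) n lam = ∑ A : Finset (Fin N), stripTerm q j n lam A := by
  have hdiff : ∑ r : Fin N, principalDiff q j n lam r = ∑ r : Fin N,
      ∑ A ∈ (Finset.univ.filter (· < r)).powerset, stripTerm q j n lam (insert r A) :=
    Finset.sum_congr rfl fun r _ => principalDiff_eq_sum q j n lam hlam hn r
  rw [← Finset.powerset_univ, sum_powerset_max, stripTerm_empty q j n hlam, ← hdiff]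
  simp only [principalDiff]
  rw [← tableauSum_sum, principalSum, principalSum, ← tableauSum_add]
  refine tableauSum_congr fun d m r had hr => ?_
  rcases hr with ⟨rfl, rfl⟩ | ⟨hn, hr⟩
  · rw [Finset.sum_eq_zero fun b _ => if_neg b.2.ne']
    simp [principalWeight, qBinomial_zero_right]
  · rw [Finset.sum_eq_single (⟨r, hr⟩ : Fin N)]
    · rw [if_pos rfl]
      ring
    · intro b _ hb
      rw [if_neg]
      rintro rfl
      exact hb rfl
    · simp

theorem principalSum_eq_zero (j n : ℕ) (lam : Fin N → ℕ) (hlam : Antitone lam)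
    (hn : ∑ i, lam i = n) (i : Fin N) (hi : j < lam i) : principalSum q j n lam = 0 := by
  induction j generalizing n lam with
  | zero =>
    have h2 := Finset.single_le_sum (f := lam) (fun _ _ => Nat.zero_le _) (Finset.mem_univ i)
    rw [principalSum, ← tableauSum_zero n lam]
    refine tableauSum_congr fun d m r had _ => ?_
    have := had.1
    rw [principalWeight, qBinomial_of_lt q _ _ (by omega), mul_zero]
  | succ j ih =>
    rw [principalSum_succ q j n lam hlam hn]
    refine Finset.sum_eq_zero fun A _ => ?_
    unfold stripTerm
    split_ifs with h
    · have h1 := sum_sub_indicator h.1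
      rw [ih _ _ h.2 (by omega), mul_zero]
      have : indicator A i ≤ 1 := by
        unfold indicator
        split_ifs <;> simp
      omega
    · rfl

open Classical in
/-- The partitions with at most `N` parts and all parts at most `j`. -/
def partitionsInBox (N j : ℕ) : Finset (Fin N → ℕ) :=
  (Fintype.piFinset fun _ => Finset.range (j + 1)).filter Antitone

theorem mem_partitionsInBox {j : ℕ} {lam : Fin N → ℕ} :
    lam ∈ partitionsInBox N j ↔ (∀ i, lam i ≤ j) ∧ Antitone lam := by
  simp [partitionsInBox, Fintype.mem_piFinset]

theorem schurSum_zero (x : ℕ → R) (N : ℕ) : schurSum x N (fun _ => 0) = 1 := by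
  induction N with
  | zero => rfl
  | succ N ih =>
    have h : interlacing (fun _ : Fin (N + 1) => 0) = {fun _ => 0} := by
      ext ν
      rw [mem_interlacing, Finset.mem_singleton, funext_iff]
      simp
    rw [schurSum, h, Finset.sum_singleton, ih]
    simp

/-- The dual Cauchy identity in the variables `x 0, …, x (N - 1)` and `1, q, …, q^(j-1)`. -/
theorem sum_principalSum_mul_schurSum (x : ℕ → R) (N j : ℕ) :
    ∑ lam ∈ partitionsInBox N j, principalSum q j (∑ i, lam i) lam * schurSum x N lam =
      ∏ i ∈ Finset.range j, ∏ b ∈ Finset.range N, (1 + q ^ i * x b) := by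
  classical
  induction j with
  | zero =>
    have h : partitionsInBox N 0 = {fun _ => 0} := by
      ext ν
      rw [mem_partitionsInBox, Finset.mem_singleton, funext_iff]
      refine ⟨fun h i => Nat.le_zero.1 (h.1 i), fun h => ⟨fun i => (h i).le, fun i k _ => ?_⟩⟩
      rw [h i, h k]
    rw [h, Finset.sum_singleton, schurSum_zero]
    simp [principalSum, tableauSum, principalWeight, qBinomial_zero_right]
  | succ j ih =>
    have h1 : ∀ lam ∈ partitionsInBox N (j + 1),
        principalSum q (j + 1) (∑ i, lam i) lam * schurSum x N lam =
        ∑ A : Finset (Fin N), stripTerm q j (∑ i, lam i) lam A * schurSum x N lam := by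
      intro lam hlam
      rw [principalSum_succ q j _ lam (mem_partitionsInBox.1 hlam).2 rfl, Finset.sum_mul]
    rw [Finset.sum_congr rfl h1, Finset.sum_comm, Finset.prod_range_succ, ← ih, Finset.sum_mul]
    have h2 : ∀ μ ∈ partitionsInBox N j, principalSum q j (∑ i, μ i) μ * schurSum x N μ *
        ∏ b ∈ Finset.range N, (1 + q ^ j * x b) = ∑ A : Finset (Fin N),
          principalSum q j (∑ i, μ i) μ *
            ((q ^ j) ^ A.card * schurSum x N (fun i => μ i + indicator A i)) := by
      intro μ hμ
      rw [← Finset.mul_sum, sum_schurSum_add_indicator x (q ^ j) N μ (mem_partitionsInBox.1 hμ).2]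
      ring
    rw [Finset.sum_congr rfl h2, Finset.sum_comm (s := partitionsInBox N j)]
    refine Finset.sum_congr rfl fun A _ => ?_
    have hle1 : ∀ i, indicator A i ≤ 1 := fun i => by
      unfold indicator
      split_ifs <;> simp
    have hrem : ∀ lam, stripTerm q j (∑ i, lam i) lam A * schurSum x N lam ≠ 0 →
        IsRemovable lam A ∧ ∀ i, lam i - indicator A i ≤ j := by
      intro lam h
      have h3 : IsRemovable lam A := by
        by_contra hc
        exact h (by rw [stripTerm, if_neg hc, zero_mul])
      refine ⟨h3, fun i => ?_⟩
      by_contra hc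
      have h4 := sum_sub_indicator h3.1
      refine h ?_
      rw [stripTerm, if_pos h3, principalSum_eq_zero q j _ _ h3.2 (by omega) i (by omega)]
      simp
    have hback : ∀ lam, IsRemovable lam A →
        (fun i => lam i - indicator A i + indicator A i) = lam := by
      intro lam h
      funext i
      exact Nat.sub_add_cancel (indicator_le h.1 i)
    have hterm : ∀ lam, IsRemovable lam A → stripTerm q j (∑ i, lam i) lam A * schurSum x N lam =
        principalSum q j (∑ i, (lam i - indicator A i)) (fun i => lam i - indicator A i) *
          ((q ^ j) ^ A.card *
            schurSum x N (fun i => lam i - indicator A i + indicator A i)) := by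
      intro lam h
      have h4 := sum_sub_indicator h.1
      rw [hback lam h, stripTerm, if_pos h, pow_mul,
        show ∑ i, lam i - A.card = ∑ i, (lam i - indicator A i) by omega]
      ring
    refine Finset.sum_bij_ne_zero (fun lam _ _ => fun i => lam i - indicator A i) ?_ ?_ ?_ ?_
    · intro lam _ h
      obtain ⟨h3, h4⟩ := hrem lam h
      exact mem_partitionsInBox.2 ⟨h4, h3.2⟩
    · intro lam _ h lam' _ h' heq
      rw [← hback lam (hrem lam h).1, ← hback lam' (hrem lam' h').1]
      funext i
      rw [congrFun heq i]
    · intro μ hμ hne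
      obtain ⟨hμ1, hμ2⟩ := mem_partitionsInBox.1 hμ
      have h3 : Antitone fun i => μ i + indicator A i := by
        by_contra hc
        exact hne (by rw [schurSum_eq_zero x N _ hc]; simp)
      have h4 : (fun i => μ i + indicator A i - indicator A i) = μ := by
        funext i
        exact Nat.add_sub_cancel _ _
      have h5 : IsRemovable (fun i => μ i + indicator A i) A := by
        refine ⟨fun i hi => ?_, ?_⟩
        · simp [indicator, hi]
        · rw [h4]
          exact hμ2
      refine ⟨fun i => μ i + indicator A i, mem_partitionsInBox.2 ⟨fun i => ?_, h3⟩, ?_, h4⟩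
      · have := hμ1 i
        have := hle1 i
        omega
      · rw [hterm _ h5]
        simp only [Nat.add_sub_cancel]
        exact hne
    · intro lam _ h
      exact hterm lam (hrem lam h).1

end TableauSum

/-! ### Schur polynomials by semistandard tableaux -/

section Diagram

variable {N : ℕ}

/-- The Young diagram with row lengths `lam`. For a sequence that is not weakly decreasing this is
the smallest Young diagram whose row lengths are at least `lam`. -/
def diagram (lam : Fin N → ℕ) : YoungDiagram where
  cells := Finset.univ.biUnion fun r : Fin N =>
    Finset.range ((r : ℕ) + 1) ×ˢ Finset.range (lam r)
  isLowerSet := by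
    rintro ⟨i, j⟩ ⟨i', j'⟩ hle hc
    simp only [Finset.coe_biUnion, Finset.coe_univ, Set.mem_iUnion, Finset.mem_coe,
      Finset.mem_product, Finset.mem_range] at hc ⊢
    obtain ⟨r, hr, h1, h2⟩ := hc
    obtain ⟨h3, h4⟩ := Prod.mk_le_mk.1 hle
    exact ⟨r, hr, by omega, by omega⟩

theorem mem_diagram {lam : Fin N → ℕ} (hlam : Antitone lam) {i j : ℕ} :
    (i, j) ∈ diagram lam ↔ ∃ h : i < N, j < lam ⟨i, h⟩ := by
  rw [← YoungDiagram.mem_cells]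
  simp only [diagram, Finset.mem_biUnion, Finset.mem_univ, true_and, Finset.mem_product,
    Finset.mem_range]
  constructor
  · rintro ⟨r, h1, h2⟩
    have h3 : i < N := by omega
    refine ⟨h3, h2.trans_le (hlam ?_)⟩
    rw [Fin.le_def]
    simp only
    omega
  · rintro ⟨h, hj⟩
    exact ⟨⟨i, h⟩, by simp, hj⟩

theorem rowLen_diagram {lam : Fin N → ℕ} (hlam : Antitone lam) (i : Fin N) :
    (diagram lam).rowLen i = lam i := by
  have h : ∀ j, j < (diagram lam).rowLen i ↔ j < lam i := fun j => by
    rw [← YoungDiagram.mem_iff_lt_rowLen, mem_diagram hlam]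
    exact ⟨fun h => h.2, fun h => ⟨i.2, h⟩⟩
  have h1 := h (lam i)
  have h2 := h ((diagram lam).rowLen i)
  omega

theorem antitone_rowLen (μ : YoungDiagram) (N : ℕ) : Antitone fun i : Fin N => μ.rowLen i :=
  fun i k hik => μ.rowLen_anti i k hik

theorem diagram_rowLen {μ : YoungDiagram} (h : ∀ c ∈ μ, c.1 < N) :
    diagram (fun i : Fin N => μ.rowLen i) = μ := by
  ext ⟨i, j⟩
  rw [YoungDiagram.mem_cells, YoungDiagram.mem_cells, mem_diagram (antitone_rowLen μ N),
    YoungDiagram.mem_iff_lt_rowLen]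
  exact ⟨fun h' => h'.2, fun h' => ⟨h (i, j) (YoungDiagram.mem_iff_lt_rowLen.2 h'), h'⟩⟩

theorem card_diagram {lam : Fin N → ℕ} (hlam : Antitone lam) : (diagram lam).card = ∑ i, lam i := by
  have h : (diagram lam).cells = (Finset.univ.sigma fun r : Fin N => Finset.range (lam r)).map
      ⟨fun c => ((c.1 : ℕ), c.2), by
        rintro ⟨r, j⟩ ⟨r', j'⟩ h
        obtain ⟨h1, h2⟩ := Prod.mk.inj h
        obtain rfl := Fin.ext h1
        obtain rfl := h2
        rfl⟩ := by
    ext ⟨i, j⟩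
    rw [YoungDiagram.mem_cells, mem_diagram hlam]
    simp only [Finset.mem_map, Finset.mem_sigma, Finset.mem_univ, true_and, Finset.mem_range]
    constructor
    · rintro ⟨h1, h2⟩
      exact ⟨⟨⟨i, h1⟩, j⟩, h2, rfl⟩
    · rintro ⟨⟨r, j'⟩, h1, h⟩
      obtain ⟨rfl, rfl⟩ := Prod.mk.inj h
      exact ⟨r.2, h1⟩
  rw [YoungDiagram.card, h, Finset.card_map, Finset.card_sigma]
  simp

end Diagram

section Restriction

variable {μ ν : YoungDiagram}

theorem row_le_entry (T : SemistandardYoungTableau μ) {i j : ℕ} (h : (i, j) ∈ μ) : i ≤ T i j := by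
  induction i with
  | zero => exact Nat.zero_le _
  | succ i ih =>
    have h1 := ih (μ.up_left_mem (Nat.le_succ i) le_rfl h)
    have h2 : T i j < T (i + 1) j := T.col_strict (Nat.lt_add_one i) h
    omega

/-- The cells of a tableau with entries less than `m`. -/
def below (T : SemistandardYoungTableau μ) (m : ℕ) : YoungDiagram where
  cells := μ.cells.filter fun c => T c.1 c.2 < m
  isLowerSet := by
    rintro ⟨i, j⟩ ⟨i', j'⟩ hle hc
    simp only [Finset.coe_filter, Set.mem_ofPred_eq, YoungDiagram.mem_cells] at hc ⊢
    obtain ⟨h3, h4⟩ := Prod.mk_le_mk.1 hle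
    refine ⟨μ.up_left_mem h3 h4 hc.1, lt_of_le_of_lt ?_ hc.2⟩
    exact (T.row_weak_of_le h4 (μ.up_left_mem h3 le_rfl hc.1)).trans (T.col_weak h3 hc.1)

theorem mem_below {T : SemistandardYoungTableau μ} {m i j : ℕ} :
    (i, j) ∈ below T m ↔ (i, j) ∈ μ ∧ T i j < m := by
  rw [← YoungDiagram.mem_cells]
  simp [below]

/-- The restriction of a tableau to a smaller shape. -/
def restrict (T : SemistandardYoungTableau μ) (hle : ∀ i j, (i, j) ∈ ν → (i, j) ∈ μ) :
    SemistandardYoungTableau ν where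
  entry i j := by
    classical
    exact if (i, j) ∈ ν then T i j else 0
  row_weak' := by
    intro i j1 j2 hj h
    rw [if_pos h, if_pos (ν.up_left_mem le_rfl hj.le h)]
    exact T.row_weak hj (hle _ _ h)
  col_strict' := by
    intro i1 i2 j hi h
    rw [if_pos h, if_pos (ν.up_left_mem hi.le le_rfl h)]
    exact T.col_strict hi (hle _ _ h)
  zeros' h := if_neg h

theorem restrict_apply (T : SemistandardYoungTableau μ) (hle : ∀ i j, (i, j) ∈ ν → (i, j) ∈ μ)
    {i j : ℕ} (h : (i, j) ∈ ν) : restrict T hle i j = T i j := if_pos h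

/-- The extension of a tableau of shape `ν` by entries `m` in the horizontal strip `μ / ν`. -/
def extend (T : SemistandardYoungTableau ν) (m : ℕ) (hle : ∀ i j, (i, j) ∈ ν → (i, j) ∈ μ)
    (hstrip : ∀ i j, (i + 1, j) ∈ μ → (i, j) ∈ ν) (hm : ∀ i j, (i, j) ∈ ν → T i j < m) :
    SemistandardYoungTableau μ where
  entry i j := by
    classical
    exact if (i, j) ∈ ν then T i j else if (i, j) ∈ μ then m else 0
  row_weak' := by
    intro i j1 j2 hj h
    by_cases h2 : (i, j2) ∈ ν
    · rw [if_pos h2, if_pos (ν.up_left_mem le_rfl hj.le h2)]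
      exact T.row_weak hj h2
    · rw [if_neg h2, if_pos h]
      by_cases h1 : (i, j1) ∈ ν
      · rw [if_pos h1]
        exact (hm _ _ h1).le
      · rw [if_neg h1, if_pos (μ.up_left_mem le_rfl hj.le h)]
  col_strict' := by
    intro i1 i2 j hi h
    have h1 : (i1, j) ∈ ν := hstrip _ _ (μ.up_left_mem hi le_rfl h)
    rw [if_pos h1]
    by_cases h2 : (i2, j) ∈ ν
    · rw [if_pos h2]
      exact T.col_strict hi h2
    · rw [if_neg h2, if_pos h]
      exact hm _ _ h1
  zeros' := by
    intro i j h
    rw [if_neg fun h' => h (hle _ _ h'), if_neg h]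

section ExtendLemmas

variable (T : SemistandardYoungTableau ν) (m : ℕ) (hle : ∀ i j, (i, j) ∈ ν → (i, j) ∈ μ)
    (hstrip : ∀ i j, (i + 1, j) ∈ μ → (i, j) ∈ ν) (hm : ∀ i j, (i, j) ∈ ν → T i j < m)

theorem extend_apply_of_mem {i j : ℕ} (h : (i, j) ∈ ν) :
    extend T m hle hstrip hm i j = T i j := if_pos h

theorem extend_apply_of_notMem {i j : ℕ} (h : (i, j) ∉ ν) (h' : (i, j) ∈ μ) :
    extend T m hle hstrip hm i j = m := (if_neg h).trans (if_pos h')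

theorem below_extend : below (extend T m hle hstrip hm) m = ν := by
  ext ⟨i, j⟩
  rw [YoungDiagram.mem_cells, YoungDiagram.mem_cells, mem_below]
  constructor
  · rintro ⟨h1, h2⟩
    by_contra h
    rw [extend_apply_of_notMem T m hle hstrip hm h h1] at h2
    exact lt_irrefl _ h2
  · intro h
    refine ⟨hle _ _ h, ?_⟩
    rw [extend_apply_of_mem T m hle hstrip hm h]
    exact hm _ _ h

theorem extend_injective {T' : SemistandardYoungTableau ν}
    {hm' : ∀ i j, (i, j) ∈ ν → T' i j < m}
    (h : extend T m hle hstrip hm = extend T' m hle hstrip hm') : T = T' := by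
  refine SemistandardYoungTableau.ext fun i j => ?_
  by_cases hc : (i, j) ∈ ν
  · rw [← extend_apply_of_mem T m hle hstrip hm hc, h, extend_apply_of_mem T' m hle hstrip hm' hc]
  · rw [T.zeros hc, T'.zeros hc]

end ExtendLemmas

theorem extend_restrict (T : SemistandardYoungTableau μ) (m : ℕ)
    (hle : ∀ i j, (i, j) ∈ ν → (i, j) ∈ μ) (hstrip : ∀ i j, (i + 1, j) ∈ μ → (i, j) ∈ ν)
    (hm : ∀ i j, (i, j) ∈ ν → restrict T hle i j < m)
    (htop : ∀ i j, (i, j) ∈ μ → (i, j) ∉ ν → T i j = m) :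
    extend (restrict T hle) m hle hstrip hm = T := by
  refine SemistandardYoungTableau.ext fun i j => ?_
  by_cases hc : (i, j) ∈ ν
  · rw [extend_apply_of_mem _ m hle hstrip hm hc, restrict_apply T hle hc]
  · by_cases hc' : (i, j) ∈ μ
    · rw [extend_apply_of_notMem _ m hle hstrip hm hc hc', htop i j hc' hc]
    · rw [T.zeros hc', SemistandardYoungTableau.zeros _ hc']

end Restriction

/-- The semistandard tableaux of shape `μ` with entries less than `N`. -/
abbrev BoundedTableau (μ : YoungDiagram) (N : ℕ) : Type :=
  {T : SemistandardYoungTableau μ // ∀ c ∈ μ.cells, T c.1 c.2 ∈ Finset.range N}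

instance fintype_boundedTableau (μ : YoungDiagram) (N : ℕ) : Fintype (BoundedTableau μ N) :=
  haveI := finite_entries μ (Finset.range N)
  Fintype.ofFinite _

theorem schurSum_eq_sum_tableau {R : Type*} [CommRing R] (x : ℕ → R) (N : ℕ) (lam : Fin N → ℕ)
    (hlam : Antitone lam) : schurSum x N lam =
      ∑ T : BoundedTableau (diagram lam) N, ∏ c ∈ (diagram lam).cells, x (T.1 c.1 c.2) := by
  classical
  induction N with
  | zero =>
    have hempty : ∀ c, c ∉ diagram lam := fun ⟨i, j⟩ h => by
      obtain ⟨h, -⟩ := (mem_diagram hlam).1 h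
      omega
    have huniq : ∀ T T' : BoundedTableau (diagram lam) 0, T = T' := fun T T' =>
      Subtype.ext (SemistandardYoungTableau.ext fun i j => by
        rw [T.1.zeros (hempty _), T'.1.zeros (hempty _)])
    let T0 : BoundedTableau (diagram lam) 0 :=
      ⟨SemistandardYoungTableau.highestWeight _, fun c hc => absurd hc (hempty c)⟩
    rw [Fintype.sum_eq_single T0 fun T hT => absurd (huniq T T0) hT,
      Finset.prod_eq_one fun c hc => absurd hc (hempty c)]
    rfl
  | succ N ih =>
    let shape : BoundedTableau (diagram lam) (N + 1) → Fin N → ℕ := fun T i =>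
      (below T.1 N).rowLen i
    have hlt : ∀ (T : BoundedTableau (diagram lam) (N + 1)) {i j}, (i, j) ∈ diagram lam →
        T.1 i j < N + 1 := fun T i j h => Finset.mem_range.1 (T.2 (i, j) h)
    have hshape : ∀ T, diagram (shape T) = below T.1 N := fun T => by
      refine diagram_rowLen ?_
      rintro ⟨i, j⟩ hc
      obtain ⟨h1, h2⟩ := mem_below.1 hc
      exact (row_le_entry T.1 h1).trans_lt h2
    have hmaps : ∀ T ∈ Finset.univ, shape T ∈ interlacing lam := by
      intro T _
      rw [mem_interlacing]
      intro i
      constructor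
      · by_contra hcon
        have h1 : ((i.succ : Fin (N + 1)) : ℕ) = (i : ℕ) + 1 := Fin.val_succ i
        have h2 : ((i : ℕ) + 1, shape T i) ∈ diagram lam := by
          rw [mem_diagram hlam]
          exact ⟨by omega, not_le.1 hcon⟩
        have h3 : T.1 i (shape T i) < T.1 ((i : ℕ) + 1) (shape T i) :=
          T.1.col_strict (Nat.lt_add_one (i : ℕ)) h2
        have h4 := hlt T h2
        have h5 : ((i : ℕ), shape T i) ∈ below T.1 N :=
          mem_below.2 ⟨(diagram lam).up_left_mem (Nat.le_succ _) le_rfl h2, by omega⟩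
        rw [YoungDiagram.mem_iff_lt_rowLen] at h5
        exact lt_irrefl _ h5
      · by_contra hcon
        have h5 : ((i : ℕ), lam i.castSucc) ∈ below T.1 N := by
          rw [YoungDiagram.mem_iff_lt_rowLen]
          exact not_le.1 hcon
        obtain ⟨_, h6⟩ := (mem_diagram hlam).1 (mem_below.1 h5).1
        exact lt_irrefl _ h6
    rw [schurSum, ← Finset.sum_fiberwise_of_maps_to hmaps]
    refine Finset.sum_congr rfl fun ν hν => ?_
    have hνa := (antitone_of_mem_interlacing hν).2
    rw [ih ν hνa, Finset.mul_sum]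
    rw [mem_interlacing] at hν
    have hle : ∀ i j, (i, j) ∈ diagram ν → (i, j) ∈ diagram lam := by
      intro i j h
      obtain ⟨hi, hj⟩ := (mem_diagram hνa).1 h
      exact (mem_diagram hlam).2 ⟨by omega, hj.trans_le (hν ⟨i, hi⟩).2⟩
    have hstrip : ∀ i j, (i + 1, j) ∈ diagram lam → (i, j) ∈ diagram ν := by
      intro i j h
      obtain ⟨hi, hj⟩ := (mem_diagram hlam).1 h
      exact (mem_diagram hνa).2 ⟨by omega, hj.trans_le (hν ⟨i, by omega⟩).1⟩
    have hbd : ∀ T : BoundedTableau (diagram ν) N, ∀ i j, (i, j) ∈ diagram ν → T.1 i j < N :=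
      fun T i j h => Finset.mem_range.1 (T.2 (i, j) h)
    refine Finset.sum_bij (fun T _ => ⟨extend T.1 N hle hstrip (hbd T), ?_⟩) ?_ ?_ ?_ ?_
    · rintro ⟨i, j⟩ hc
      rw [Finset.mem_range]
      by_cases h : (i, j) ∈ diagram ν
      · rw [extend_apply_of_mem _ _ _ _ _ h]
        have := hbd T i j h
        omega
      · rw [extend_apply_of_notMem _ _ _ _ _ h hc]
        omega
    · intro T _
      rw [Finset.mem_filter]
      refine ⟨Finset.mem_univ _, ?_⟩
      funext i
      simp only [shape]
      rw [below_extend, rowLen_diagram hνa]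
    · intro T _ T' _ h
      exact Subtype.ext (extend_injective T.1 N hle hstrip (hbd T) (hm' := hbd T')
        (congrArg Subtype.val h))
    · intro T hT
      have hT' : shape T = ν := (Finset.mem_filter.1 hT).2
      have hmem : ∀ {i j}, (i, j) ∈ diagram ν ↔ (i, j) ∈ diagram lam ∧ T.1 i j < N := by
        intro i j
        rw [← hT', hshape, mem_below]
      have hr : ∀ i j, (i, j) ∈ diagram ν → restrict T.1 hle i j < N := fun i j h => by
        rw [restrict_apply _ _ h]
        exact (hmem.1 h).2
      refine ⟨⟨restrict T.1 hle, fun c hc => Finset.mem_range.2 (hr c.1 c.2 hc)⟩,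
        Finset.mem_univ _, Subtype.ext (extend_restrict T.1 N hle hstrip hr ?_)⟩
      intro i j h1 h2
      have h3 := hlt T h1
      have h4 : ¬ T.1 i j < N := fun h => h2 (hmem.2 ⟨h1, h⟩)
      omega
    · intro T _
      have hsub : (diagram ν).cells ⊆ (diagram lam).cells := fun c hc => hle c.1 c.2 hc
      rw [← Finset.prod_sdiff hsub]
      congr 1
      · have h1 : ∀ c ∈ (diagram lam).cells \ (diagram ν).cells,
            x (extend T.1 N hle hstrip (hbd T) c.1 c.2) = x N := by
          intro c hc
          obtain ⟨hc1, hc2⟩ := Finset.mem_sdiff.1 hc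
          rw [extend_apply_of_notMem _ _ _ _ _ hc2 hc1]
        rw [Finset.prod_congr rfl h1, Finset.prod_const, Finset.card_sdiff_of_subset hsub]
        congr 1
        change _ = (diagram lam).card - (diagram ν).card
        rw [card_diagram hlam, card_diagram hνa, Fin.sum_univ_castSucc]
        have h2 : ∑ i : Fin N, (lam i.castSucc - ν i) + ∑ i, ν i = ∑ i : Fin N, lam i.castSucc := by
          rw [← Finset.sum_add_distrib]
          exact Finset.sum_congr rfl fun i _ => Nat.sub_add_cancel (hν i).2
        omega
      · exact Finset.prod_congr rfl fun c hc => by rw [extend_apply_of_mem _ _ _ _ _ hc]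

/-- The Kostka number of the shape `μ` and the content `β`. -/
def kostka (μ : YoungDiagram) (β : ℕ →₀ ℕ) : ℕ :=
  Nat.card {T : SemistandardYoungTableau μ // content T = β}

theorem coeff_schurSum {N : ℕ} {β : ℕ →₀ ℕ} (hβ : ∀ i ∈ β.support, i < N) {lam : Fin N → ℕ}
    (hlam : Antitone lam) (n : ℕ) :
    MvPolynomial.coeff β (PowerSeries.coeff n (schurSum gradedVar N lam)) =
      if ∑ i, lam i = n then (kostka (diagram lam) β : Polynomial ℤ) else 0 := by
  classical
  have hprod : ∀ T : BoundedTableau (diagram lam) N,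
      ∏ c ∈ (diagram lam).cells, gradedVar (T.1 c.1 c.2) =
      PowerSeries.C (MvPolynomial.monomial (content T.1) (1 : Polynomial ℤ)) *
        PowerSeries.X ^ ∑ i, lam i := by
    intro T
    simp only [gradedVar]
    rw [Finset.prod_mul_distrib, Finset.prod_const, content, MvPolynomial.monomial_sum_one,
      map_prod, mul_comm, ← card_diagram hlam]
    rfl
  rw [schurSum_eq_sum_tableau _ _ _ hlam, map_sum, MvPolynomial.coeff_sum]
  simp only [hprod, PowerSeries.coeff_C_mul, PowerSeries.coeff_X_pow]
  by_cases hn : ∑ i, lam i = n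
  · simp only [hn, if_true, mul_one, MvPolynomial.coeff_monomial]
    rw [Finset.sum_boole, kostka, ← Fintype.card_subtype, ← Nat.card_eq_fintype_card]
    congr 1
    refine Nat.card_congr
      ⟨fun T => ⟨T.1.1, T.2⟩, fun T => ⟨⟨T.1, fun c hc => ?_⟩, T.2⟩, fun _ => rfl, fun _ => rfl⟩
    have h := entry_mem T.1 c hc
    rw [T.2] at h
    exact Finset.mem_range.2 (hβ _ h)
  · simp [hn, Ne.symm hn]

/-! ### Standard tableaux by their largest entry -/

section LargestEntry

open Classical in
/-- The row of the largest entry of a standard tableau, and `N` for the empty tableau. -/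
def lastRow {μ : YoungDiagram} (N : ℕ) (T : SYT μ) : ℕ :=
  if μ.card = 0 then N else (μ.cells.filter fun c => T.1 c.1 c.2 = μ.card).sup Prod.fst

theorem exists_cell {μ : YoungDiagram} (T : SYT μ) {m : ℕ} (h1 : 1 ≤ m) (h2 : m ≤ μ.card) :
    ∃ i j, (i, j) ∈ μ ∧ T.1 i j = m := by
  obtain ⟨⟨i, j⟩, hc, h⟩ := T.2.surjOn (Set.mem_Icc.2 ⟨h1, h2⟩)
  exact ⟨i, j, hc, h⟩

theorem entry_le {μ : YoungDiagram} (T : SYT μ) {i j : ℕ} (h : (i, j) ∈ μ) :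
    T.1 i j ≤ μ.card :=
  (T.2.mapsTo (x := (i, j)) h).2

theorem cell_unique {μ : YoungDiagram} (T : SYT μ) {i j i' j' : ℕ} (h : (i, j) ∈ μ)
    (h' : (i', j') ∈ μ) (heq : T.1 i j = T.1 i' j') : (i, j) = (i', j') :=
  T.2.injOn (x₁ := (i, j)) (x₂ := (i', j')) h h' heq

theorem lastRow_eq {μ : YoungDiagram} (N : ℕ) (T : SYT μ) {i j : ℕ} (h : (i, j) ∈ μ)
    (hij : T.1 i j = μ.card) : lastRow N T = i := by
  have h0 : μ.card ≠ 0 := Finset.card_ne_zero_of_mem h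
  have h1 : μ.cells.filter (fun c => T.1 c.1 c.2 = μ.card) = {(i, j)} := by
    ext ⟨i', j'⟩
    rw [Finset.mem_filter, Finset.mem_singleton]
    constructor
    · rintro ⟨h2, h3⟩
      exact cell_unique T h2 h (h3.trans hij.symm)
    · intro h2
      obtain ⟨rfl, rfl⟩ := Prod.mk.inj h2
      exact ⟨h, hij⟩
  rw [lastRow, if_neg h0, h1, Finset.sup_singleton]

theorem exists_lastRow {μ : YoungDiagram} (N : ℕ) (T : SYT μ) (h : 0 < μ.card) :
    ∃ j, (lastRow N T, j) ∈ μ ∧ T.1 (lastRow N T) j = μ.card := by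
  obtain ⟨i, j, hc, hij⟩ := exists_cell T h le_rfl
  rw [lastRow_eq N T hc hij]
  exact ⟨j, hc, hij⟩

theorem mem_descents {μ : YoungDiagram} (T : SYT μ) {m : ℕ} : m ∈ T.descents ↔
    1 ≤ m ∧ m + 1 ≤ μ.card ∧ ∃ i j i' j', (i, j) ∈ μ ∧ (i', j') ∈ μ ∧ T.1 i j = m ∧
      T.1 i' j' = m + 1 ∧ i < i' := by
  rw [SYT.descents, Finset.mem_filter, Finset.mem_Icc]
  constructor
  · rintro ⟨⟨h1, h2⟩, ⟨i, j⟩, hc, ⟨i', j'⟩, hc', h⟩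
    exact ⟨h1, by omega, i, j, i', j', hc, hc', h⟩
  · rintro ⟨h1, h2, i, j, i', j', hc, hc', h⟩
    exact ⟨⟨h1, by omega⟩, (i, j), hc, (i', j'), hc', h⟩

/-- The diagram `μ` arises from `ν` by adding the cell `(r, s)`. -/
structure AddsCell (ν μ : YoungDiagram) (r s : ℕ) : Prop where
  mem_iff : ∀ i j, (i, j) ∈ μ ↔ (i, j) ∈ ν ∨ i = r ∧ j = s
  notMem : (r, s) ∉ ν

namespace AddsCell

variable {μ ν : YoungDiagram} {r s : ℕ}

theorem cells_eq (h : AddsCell ν μ r s) : μ.cells = insert (r, s) ν.cells := by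
  ext ⟨i, j⟩
  rw [Finset.mem_insert, Prod.mk.injEq, or_comm]
  exact h.mem_iff i j

theorem card_eq (h : AddsCell ν μ r s) : μ.card = ν.card + 1 := by
  rw [YoungDiagram.card, h.cells_eq, Finset.card_insert_of_notMem h.notMem]

theorem mem (h : AddsCell ν μ r s) : (r, s) ∈ μ := (h.mem_iff r s).2 (Or.inr ⟨rfl, rfl⟩)

theorem le (h : AddsCell ν μ r s) (i j : ℕ) (hc : (i, j) ∈ ν) : (i, j) ∈ μ :=
  (h.mem_iff i j).2 (Or.inl hc)

theorem strip (h : AddsCell ν μ r s) (i j : ℕ) (hc : (i + 1, j) ∈ μ) : (i, j) ∈ ν := by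
  rcases (h.mem_iff i j).1 (μ.up_left_mem (Nat.le_succ i) le_rfl hc) with h1 | ⟨rfl, rfl⟩
  · exact h1
  · rcases (h.mem_iff _ _).1 hc with h2 | ⟨h2, -⟩
    · exact absurd (ν.up_left_mem (Nat.le_succ i) le_rfl h2) h.notMem
    · omega

theorem bijOn_iff (h : AddsCell ν μ r s) {f : ℕ × ℕ → ℕ} (hf : f (r, s) = ν.card + 1) :
    Set.BijOn f μ.cells (Set.Icc 1 μ.card) ↔ Set.BijOn f ν.cells (Set.Icc 1 ν.card) := by
  have h1 : Set.Icc 1 (ν.card + 1) = insert (f (r, s)) (Set.Icc 1 ν.card) := by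
    ext m
    rw [hf, Set.mem_insert_iff, Set.mem_Icc, Set.mem_Icc]
    omega
  rw [h.card_eq, h.cells_eq, Finset.coe_insert, h1]
  refine Set.BijOn.insert_iff h.notMem ?_
  rw [hf, Set.mem_Icc]
  omega

/-- The standard tableau of shape `μ` with the largest entry in the added cell. -/
def extendSYT (h : AddsCell ν μ r s) (T : SYT ν) : SYT μ :=
  ⟨extend T.1 (ν.card + 1) h.le h.strip fun _ _ hc => Nat.lt_succ_of_le (entry_le T hc), by
    rw [h.bijOn_iff (extend_apply_of_notMem _ _ _ _ _ h.notMem h.mem)]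
    exact T.2.congr fun c hc => (extend_apply_of_mem _ _ _ _ _ hc).symm⟩

theorem extendSYT_apply (h : AddsCell ν μ r s) (T : SYT ν) {i j : ℕ} (hc : (i, j) ∈ ν) :
    (h.extendSYT T).1 i j = T.1 i j := if_pos hc

theorem extendSYT_corner (h : AddsCell ν μ r s) (T : SYT ν) :
    (h.extendSYT T).1 r s = ν.card + 1 := (if_neg h.notMem).trans (if_pos h.mem)

theorem lastRow_extendSYT (h : AddsCell ν μ r s) (N : ℕ) (T : SYT ν) :
    lastRow N (h.extendSYT T) = r :=
  lastRow_eq N _ h.mem ((h.extendSYT_corner T).trans h.card_eq.symm)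

theorem extendSYT_injective (h : AddsCell ν μ r s) : Function.Injective h.extendSYT :=
  fun T T' heq => Subtype.ext (extend_injective T.1 (ν.card + 1) h.le h.strip
    (fun _ _ hc => Nat.lt_succ_of_le (entry_le T hc))
    (hm' := fun _ _ hc => Nat.lt_succ_of_le (entry_le T' hc)) (congrArg Subtype.val heq))

theorem exists_extendSYT (h : AddsCell ν μ r s) (T : SYT μ) (hT : T.1 r s = μ.card) :
    ∃ T' : SYT ν, h.extendSYT T' = T := by
  have hb : Set.BijOn (fun c : ℕ × ℕ => restrict T.1 h.le c.1 c.2) ν.cells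
      (Set.Icc 1 ν.card) :=
    ((h.bijOn_iff (f := fun c : ℕ × ℕ => T.1 c.1 c.2) (hT.trans h.card_eq)).1 T.2).congr
      fun c hc => (restrict_apply T.1 h.le hc).symm
  refine ⟨⟨restrict T.1 h.le, hb⟩, Subtype.ext ?_⟩
  refine extend_restrict T.1 (ν.card + 1) h.le h.strip
    (fun i j hc => Nat.lt_succ_of_le (hb.mapsTo (x := (i, j)) hc).2) fun i j h1 h2 => ?_
  rcases (h.mem_iff i j).1 h1 with h3 | ⟨rfl, rfl⟩
  · exact absurd h3 h2
  · exact hT.trans h.card_eq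

theorem mem_of_entry_le (h : AddsCell ν μ r s) (T : SYT ν) {i j : ℕ} (hc : (i, j) ∈ μ)
    (hle : (h.extendSYT T).1 i j ≤ ν.card) : (i, j) ∈ ν := by
  rcases (h.mem_iff i j).1 hc with h1 | ⟨rfl, rfl⟩
  · exact h1
  · rw [h.extendSYT_corner T] at hle
    omega

open Classical in
theorem descents_extendSYT (h : AddsCell ν μ r s) {N : ℕ} (hr : r < N) (T : SYT ν) :
    (h.extendSYT T).descents =
      if lastRow N T < r then insert ν.card T.descents else T.descents := by
  have hcard := h.card_eq
  have hlt : ∀ m, m < ν.card → (m ∈ (h.extendSYT T).descents ↔ m ∈ T.descents) := by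
    intro m hm
    rw [mem_descents, mem_descents]
    constructor
    · rintro ⟨h1, -, i, j, i', j', hc, hc', h3, h4, h5⟩
      have hcν := h.mem_of_entry_le T hc (by omega)
      have hcν' := h.mem_of_entry_le T hc' (by omega)
      rw [h.extendSYT_apply T hcν] at h3
      rw [h.extendSYT_apply T hcν'] at h4
      exact ⟨h1, hm, i, j, i', j', hcν, hcν', h3, h4, h5⟩
    · rintro ⟨h1, -, i, j, i', j', hc, hc', h3, h4, h5⟩
      exact ⟨h1, by omega, i, j, i', j', h.le _ _ hc, h.le _ _ hc',
        (h.extendSYT_apply T hc).trans h3, (h.extendSYT_apply T hc').trans h4, h5⟩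
  have hge : ∀ m, ν.card ≤ m → m ∉ T.descents := fun m hm hd => by
    have := ((mem_descents T).1 hd).2.1
    omega
  have heq : ν.card ∈ (h.extendSYT T).descents ↔ lastRow N T < r := by
    rw [mem_descents]
    constructor
    · rintro ⟨h1, -, i, j, i', j', hc, hc', h3, h4, h5⟩
      have hcν := h.mem_of_entry_le T hc h3.le
      rw [h.extendSYT_apply T hcν] at h3
      rw [lastRow_eq N T hcν h3]
      obtain ⟨rfl, rfl⟩ := Prod.mk.inj
        (cell_unique _ hc' h.mem (h4.trans (h.extendSYT_corner T).symm))
      exact h5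
    · intro hlr
      have h0 : 0 < ν.card := by
        by_contra h0
        rw [lastRow, if_pos (by omega)] at hlr
        omega
      obtain ⟨j, hc, hj⟩ := exists_lastRow N T h0
      exact ⟨h0, hcard.ge, _, j, r, s, h.le _ _ hc, h.mem, (h.extendSYT_apply T hc).trans hj,
        h.extendSYT_corner T, hlr⟩
  ext m
  rcases lt_trichotomy m ν.card with hm | rfl | hm
  · rw [hlt m hm]
    split_ifs
    · rw [Finset.mem_insert, or_iff_right hm.ne]
    · rfl
  · rw [heq]
    split_ifs with hlr
    · simp [hlr]
    · simp [hlr, hge _ le_rfl]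
  · have h1 : m ∉ (h.extendSYT T).descents := fun hd => by
      have := ((mem_descents _).1 hd).2.1
      omega
    have h2 := hge m hm.le
    split_ifs
    · simp [h1, h2, hm.ne']
    · simp [h1, h2]

theorem card_notMem_descents (T : SYT ν) : ν.card ∉ T.descents := fun hd => by
  have := ((mem_descents T).1 hd).2.1
  omega

theorem des_extendSYT (h : AddsCell ν μ r s) {N : ℕ} (hr : r < N) (T : SYT ν) :
    (h.extendSYT T).des = if lastRow N T < r then T.des + 1 else T.des := by
  classical
  rw [SYT.des, h.descents_extendSYT hr]
  split_ifs
  · rw [Finset.card_insert_of_notMem (card_notMem_descents T), SYT.des]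
  · rfl

theorem maj_extendSYT (h : AddsCell ν μ r s) {N : ℕ} (hr : r < N) (T : SYT ν) :
    (h.extendSYT T).maj = if lastRow N T < r then T.maj + ν.card else T.maj := by
  classical
  rw [SYT.maj, h.descents_extendSYT hr]
  split_ifs
  · rw [Finset.sum_insert (card_notMem_descents T), add_comm, SYT.maj]
  · rfl

end AddsCell

variable {N : ℕ}

theorem addsCell_diagram {lam : Fin N → ℕ} (hlam : Antitone lam) {r : Fin N}
    (hr : IsRemovable lam {r}) :
    AddsCell (diagram fun i => lam i - indicator {r} i) (diagram lam) r (lam r - 1) := by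
  have h0 := hr.1 r (Finset.mem_singleton_self r)
  have h1 : ∀ i, i ≠ r → indicator {r} i = 0 := fun i hi => by simp [indicator, hi]
  have h2 : indicator {r} r = 1 := by simp [indicator]
  constructor
  · intro i j
    rw [mem_diagram hlam, mem_diagram hr.2]
    constructor
    · rintro ⟨hi, hj⟩
      by_cases hir : (⟨i, hi⟩ : Fin N) = r
      · subst hir
        by_cases hj' : j = lam ⟨i, hi⟩ - 1
        · exact Or.inr ⟨rfl, hj'⟩
        · refine Or.inl ⟨hi, ?_⟩
          rw [h2]
          omega
      · refine Or.inl ⟨hi, ?_⟩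
        rw [h1 _ hir]
        exact hj
    · rintro (⟨hi, hj⟩ | ⟨rfl, rfl⟩)
      · exact ⟨hi, by omega⟩
      · exact ⟨r.2, by simpa using h0⟩
  · rw [mem_diagram hr.2]
    rintro ⟨hi, hj⟩
    rw [Fin.eta, h2] at hj
    exact lt_irrefl _ hj

theorem isRemovable_lastRow {lam : Fin N → ℕ} (hlam : Antitone lam) (T : SYT (diagram lam))
    {r : Fin N} {s : ℕ} (hs : ((r : ℕ), s) ∈ diagram lam) (hT : T.1 r s = (diagram lam).card) :
    IsRemovable lam {r} ∧ s = lam r - 1 := by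
  obtain ⟨_, hs'⟩ := (mem_diagram hlam).1 hs
  rw [Fin.eta] at hs'
  have h1 : s = lam r - 1 := by
    by_contra hne
    have h2 : ((r : ℕ), s + 1) ∈ diagram lam := by
      rw [mem_diagram hlam]
      refine ⟨r.2, ?_⟩
      rw [Fin.eta]
      omega
    have h3 := T.1.row_weak (Nat.lt_add_one s) h2
    have h4 := entry_le T h2
    have h5 := cell_unique T hs h2 (by omega)
    simp at h5
  refine ⟨⟨fun i hi => ?_, fun i k hik => ?_⟩, h1⟩
  · rw [Finset.mem_singleton.1 hi]
    omega
  · have h2 := hlam hik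
    simp only [indicator, Finset.mem_singleton]
    by_cases hi : i = r
    · subst hi
      rcases hik.eq_or_lt with rfl | hlt
      · exact le_rfl
      · rw [if_neg hlt.ne', if_pos rfl]
        by_contra hcon
        have h3 : ((k : ℕ), s) ∈ diagram lam := by
          rw [mem_diagram hlam]
          refine ⟨k.2, ?_⟩
          rw [Fin.eta]
          omega
        have h4 := T.1.col_strict hlt h3
        have h5 := entry_le T h3
        omega
    · rw [if_neg hi]
      omega

/-- The recursion for `tableauSum` removes the largest entry of a standard tableau. -/
theorem sum_SYT_eq_tableauSum {R : Type*} [CommRing R] (n : ℕ) (lam : Fin N → ℕ)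
    (hlam : Antitone lam) (hn : ∑ i, lam i = n) (f : ℕ → ℕ → ℕ → R) :
    ∑ T : SYT (diagram lam), f T.des T.maj (lastRow N T) = tableauSum n lam f := by
  classical
  have hcard := (card_diagram hlam).trans hn
  induction n generalizing lam f with
  | zero =>
    have hempty : ∀ c, c ∉ diagram lam := fun c hc => Finset.card_ne_zero_of_mem hc hcard
    let T0 : SYT (diagram lam) := ⟨SemistandardYoungTableau.highestWeight _, by
      have h1 : (diagram lam).cells = ∅ := Finset.card_eq_zero.1 hcard
      rw [h1, hcard]
      simp⟩
    have huniq : ∀ T : SYT (diagram lam), T = T0 := fun T =>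
      Subtype.ext (SemistandardYoungTableau.ext fun i j => by
        rw [T.1.zeros (hempty _), T0.1.zeros (hempty _)])
    have hd : T0.descents = ∅ := Finset.eq_empty_of_forall_notMem fun m hm => by
      have := ((mem_descents T0).1 hm).2.1
      omega
    rw [Fintype.sum_eq_single T0 fun T hT => absurd (huniq T) hT, tableauSum, SYT.des, SYT.maj, hd,
      lastRow, if_pos hcard]
    simp
  | succ n ih =>
    have hrow : ∀ T : SYT (diagram lam), lastRow N T < N := fun T => by
      obtain ⟨j, hc, -⟩ := exists_lastRow N T (by omega)
      exact ((mem_diagram hlam).1 hc).1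
    let row : SYT (diagram lam) → Fin N := fun T => ⟨lastRow N T, hrow T⟩
    rw [tableauSum, ← Finset.sum_fiberwise_of_maps_to (t := Finset.univ) (g := row)
      fun T _ => Finset.mem_univ _]
    refine Finset.sum_congr rfl fun r _ => ?_
    have hmax : ∀ T : SYT (diagram lam), row T = r → IsRemovable lam {r} ∧
        T.1 r (lam r - 1) = (diagram lam).card := by
      rintro T rfl
      obtain ⟨j, hc, hj⟩ := exists_lastRow N T (by omega)
      obtain ⟨h1, rfl⟩ := isRemovable_lastRow hlam T (r := row T) hc hj
      exact ⟨h1, hj⟩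
    by_cases hr : IsRemovable lam {r}
    · have hsum := sum_sub_indicator hr.1
      rw [Finset.card_singleton, hn, Nat.add_right_cancel_iff] at hsum
      have hcard' := (card_diagram hr.2).trans hsum
      have hadd := addsCell_diagram hlam hr
      rw [if_pos hr, ← ih _ hr.2 hsum _ hcard']
      symm
      refine Finset.sum_bij (fun T _ => hadd.extendSYT T) ?_ ?_ ?_ ?_
      · intro T _
        rw [Finset.mem_filter]
        exact ⟨Finset.mem_univ _, Fin.ext (hadd.lastRow_extendSYT N T)⟩
      · exact fun T _ T' _ h => hadd.extendSYT_injective h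
      · intro T hT
        obtain ⟨T', hT'⟩ := hadd.exists_extendSYT T (hmax T (Finset.mem_filter.1 hT).2).2
        exact ⟨T', Finset.mem_univ _, hT'⟩
      · intro T _
        rw [hadd.des_extendSYT r.2, hadd.maj_extendSYT r.2, hadd.lastRow_extendSYT, hcard']
        split_ifs <;> rfl
    · rw [if_neg hr]
      refine Finset.sum_eq_zero fun T hT => absurd (hmax T (Finset.mem_filter.1 hT).2).1 hr

end LargestEntry

/-! ### The Schur expansion -/

theorem map_qBinomial {R S : Type*} [CommSemiring R] [CommSemiring S] (φ : R →+* S) (q : R)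
    (n k : ℕ) : φ (qBinomial q n k) = qBinomial (φ q) n k := by
  induction n generalizing k with
  | zero => cases k <;> simp [qBinomial]
  | succ n ih => cases k <;> simp [qBinomial, ih]

theorem map_principalSum {R S : Type*} [CommRing R] [CommRing S] (φ : R →+* S) (q : R) {N : ℕ}
    (j n : ℕ) (lam : Fin N → ℕ) :
    φ (principalSum q j n lam) = principalSum (φ q) j n lam := by
  rw [principalSum, map_tableauSum]
  simp only [principalWeight, map_mul, map_pow, map_qBinomial]
  rfl

/-- The sum of the valley weights over the standard tableaux of shape `μ`; for `r = n - k` this is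
the coefficient of the Schur function of `μ` in the specialized valley series. -/
def valleySum {R : Type*} [CommRing R] (q : R) (μ : YoungDiagram) (r : ℕ) : R :=
  ∑ T : SYT μ, valleyWeight q r T.des T.maj

theorem principalSum_eq_sum_valleySum {R : Type*} [CommRing R] (q : R) {N : ℕ} (j n : ℕ)
    {lam : Fin N → ℕ} (hlam : Antitone lam) (hn : ∑ i, lam i = n) :
    principalSum q j n lam = ∑ k ∈ Finset.range (n + 1),
      q ^ k.choose 2 * qBinomial q j k * valleySum q (diagram lam) (n - k) := by
  rw [principalSum, tableauSum_congr fun d m r had _ => principalWeight_eq_sum q j had,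
    tableauSum_sum]
  refine Finset.sum_congr rfl fun k _ => ?_
  rw [tableauSum_mul, valleySum,
    ← sum_SYT_eq_tableauSum n lam hlam hn fun d m _ => valleyWeight q (n - k) d m]

/-- The embedding of the coefficient ring. -/
def gradedC : Polynomial ℤ →+* GradedRing := (PowerSeries.C).comp MvPolynomial.C

theorem coeff_gradedC_mul (a : Polynomial ℤ) (F : GradedRing) (n : ℕ) (β : ℕ →₀ ℕ) :
    MvPolynomial.coeff β (PowerSeries.coeff n (gradedC a * F)) =
      a * MvPolynomial.coeff β (PowerSeries.coeff n F) := by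
  rw [gradedC, RingHom.comp_apply, PowerSeries.coeff_C_mul, MvPolynomial.coeff_C_mul]

theorem row_lt_card {μ : YoungDiagram} {c : ℕ × ℕ} (hc : c ∈ μ) : c.1 < μ.card :=
  Finset.mem_range.1 (Finset.mem_product.1 (cells_subset μ hc)).1

theorem Shape.diagram_rowLen {N n : ℕ} (hnN : n ≤ N) (μ : Shape n) :
    diagram (fun i : Fin N => μ.1.rowLen i) = μ.1 :=
  DeltaVal.diagram_rowLen fun _ hc => (row_lt_card hc).trans_le (μ.2.le.trans hnN)

theorem Shape.sum_rowLen {N n : ℕ} (hnN : n ≤ N) (μ : Shape n) :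
    ∑ i : Fin N, μ.1.rowLen i = n := by
  rw [← card_diagram (antitone_rowLen μ.1 N), μ.diagram_rowLen hnN, μ.2]

/-- The coefficients of the dual Cauchy product, by shapes. The shapes outside the box contribute
`0` by `principalSum_eq_zero`. -/
theorem coeff_prod_eq_sum_kostka {N n : ℕ} (hnN : n ≤ N) {β : ℕ →₀ ℕ}
    (hβ : ∀ i ∈ β.support, i < N) (j : ℕ) :
    MvPolynomial.coeff β (PowerSeries.coeff n
      (∏ i ∈ Finset.range j, ∏ b ∈ Finset.range N, (1 + gradedQ ^ i * gradedVar b))) =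
    ∑ μ : Shape n, principalSum Polynomial.X j n (fun i : Fin N => μ.1.rowLen i) *
      (kostka μ.1 β : Polynomial ℤ) := by
  classical
  have hq : gradedQ = gradedC Polynomial.X := rfl
  rw [← sum_principalSum_mul_schurSum, map_sum, MvPolynomial.coeff_sum]
  have hterm : ∀ lam ∈ partitionsInBox N j,
      MvPolynomial.coeff β (PowerSeries.coeff n
        (principalSum gradedQ j (∑ i, lam i) lam * schurSum gradedVar N lam)) =
      if ∑ i, lam i = n then
        principalSum Polynomial.X j n lam * (kostka (diagram lam) β : Polynomial ℤ) else 0 := by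
    intro lam hlam
    rw [hq, ← map_principalSum, coeff_gradedC_mul,
      coeff_schurSum hβ ((mem_partitionsInBox).1 hlam).2]
    split_ifs with h
    · rw [h]
    · rw [mul_zero]
  rw [Finset.sum_congr rfl hterm, ← Finset.sum_filter,
    ← Finset.sum_filter_of_ne (p := fun μ : Shape n => ∀ i : Fin N, μ.1.rowLen i ≤ j)]
  · refine Finset.sum_bij (fun lam hlam => ⟨diagram lam, (card_diagram
      (mem_partitionsInBox.1 (Finset.mem_filter.1 hlam).1).2).trans
        (Finset.mem_filter.1 hlam).2⟩) ?_ ?_ ?_ ?_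
    · intro lam hlam
      obtain ⟨h1, h2⟩ := mem_partitionsInBox.1 (Finset.mem_filter.1 hlam).1
      rw [Finset.mem_filter]
      refine ⟨Finset.mem_univ _, fun i => ?_⟩
      rw [rowLen_diagram h2]
      exact h1 i
    · intro lam hlam lam' hlam' h
      have h2 := (mem_partitionsInBox.1 (Finset.mem_filter.1 hlam).1).2
      have h2' := (mem_partitionsInBox.1 (Finset.mem_filter.1 hlam').1).2
      funext i
      have h3 : diagram lam = diagram lam' := congrArg Subtype.val h
      rw [← rowLen_diagram h2, ← rowLen_diagram h2', h3]
    · intro μ hμ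
      refine ⟨fun i => μ.1.rowLen i, ?_, Subtype.ext (μ.diagram_rowLen hnN)⟩
      rw [Finset.mem_filter, mem_partitionsInBox]
      exact ⟨⟨(Finset.mem_filter.1 hμ).2, antitone_rowLen μ.1 N⟩, μ.sum_rowLen hnN⟩
    · intro lam hlam
      have h2 := (mem_partitionsInBox.1 (Finset.mem_filter.1 hlam).1).2
      simp only [rowLen_diagram h2]
  · intro μ _ hne i
    by_contra hcon
    refine hne ?_
    rw [principalSum_eq_zero _ _ _ _ (antitone_rowLen μ.1 N) (μ.sum_rowLen hnN) i
      (not_le.1 hcon), zero_mul]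

/-- Both sides are determined by the coefficients of the products
`∏_{i < j} ∏_b (1 + q^i x_b)` for `j ≤ n`. -/
theorem coeff_blockSeries {N n k : ℕ} (hN : 0 < N) (hnN : n ≤ N) (hk : k ≤ n) {β : ℕ →₀ ℕ}
    (hβ : ∀ i ∈ β.support, i < N) :
    MvPolynomial.coeff β (PowerSeries.coeff n (blockSeries N k)) =
      ∑ μ : Shape n, valleySum Polynomial.X μ.1 (n - k) * (kostka μ.1 β : Polynomial ℤ) := by
  refine eq_of_sum_qBinomial_eq (q := (Polynomial.X : Polynomial ℤ)) Polynomial.X_ne_zero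
    (a := fun k => MvPolynomial.coeff β (PowerSeries.coeff n (blockSeries N k)))
    (b := fun k => ∑ μ : Shape n, valleySum Polynomial.X μ.1 (n - k) *
      (kostka μ.1 β : Polynomial ℤ)) n (fun j hj => ?_) k hk
  have h1 := coeff_prod_eq_sum_kostka hnN hβ j
  have hc : ∀ k, gradedQ ^ k.choose 2 * qBinomial gradedQ j k =
      gradedC (Polynomial.X ^ k.choose 2 * qBinomial Polynomial.X j k) := fun k => by
    rw [map_mul, map_pow, map_qBinomial]
    rfl
  rw [prod_eq_sum_blockSeries hN, map_sum, MvPolynomial.coeff_sum] at h1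
  simp only [hc, coeff_gradedC_mul] at h1
  rw [h1]
  simp only [principalSum_eq_sum_valleySum _ j n (antitone_rowLen _ N) (Shape.sum_rowLen hnN _),
    Shape.diagram_rowLen hnN,
    Finset.sum_mul, Finset.mul_sum]
  rw [Finset.sum_comm]
  symm
  refine Finset.sum_subset_zero_on_sdiff (Finset.range_subset_range.2 (by omega)) ?_ ?_
  · intro k hk
    have hjk : j < k := by
      have := (Finset.mem_sdiff.1 hk).2
      rw [Finset.mem_range] at this
      omega
    exact Finset.sum_eq_zero fun μ _ => by rw [qBinomial_of_lt _ _ _ hjk]; ring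
  · exact fun k _ => Finset.sum_congr rfl fun μ _ => by ring

section Values

variable {n k : ℕ}

theorem exists_bound (n : ℕ) (β : ℕ →₀ ℕ) : ∃ N, 0 < N ∧ n ≤ N ∧ ∀ i ∈ β.support, i < N := by
  refine ⟨max n (β.support.sup id + 1), by omega, by omega, fun i hi => ?_⟩
  have h : i ≤ β.support.sup id := Finset.le_sup (f := id) hi
  omega

theorem Val_q_zero_eq_Val_zero_q (hk : 1 ≤ k) (hkn : k ≤ n) :
    Val n (k - 1) (Polynomial.X : Polynomial ℤ) 0 =
      Val n (k - 1) 0 (Polynomial.X : Polynomial ℤ) := by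
  funext β
  obtain ⟨N, hN, -, hβ⟩ := exists_bound n β
  rw [Val_q_zero_eq_coeff hN hk hkn hβ, Val_zero_q_eq_coeff hN hk hkn hβ]

theorem coeff_sum_schur (c : Shape n → Polynomial ℤ) (β : ℕ →₀ ℕ) :
    MvPowerSeries.coeff β (∑ μ : Shape n, c μ • schur (Polynomial ℤ) μ.1) =
      ∑ μ : Shape n, c μ * (kostka μ.1 β : Polynomial ℤ) := by
  rw [map_sum]
  rfl

theorem Val_zero_q_eq_sum_schur (hk : 1 ≤ k) (hkn : k ≤ n) :
    Val n (k - 1) 0 (Polynomial.X : Polynomial ℤ) =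
      ∑ μ : Shape n, valleySum (Polynomial.X : Polynomial ℤ) μ.1 (n - k) •
        schur (Polynomial ℤ) μ.1 := by
  refine MvPowerSeries.ext fun β => ?_
  obtain ⟨N, hN, hnN, hβ⟩ := exists_bound n β
  rw [coeff_sum_schur, ← coeff_blockSeries hN hnN hkn hβ]
  exact Val_zero_q_eq_coeff hN hk hkn hβ

end Values

/-! ### Uniqueness and positivity of the coefficients -/

theorem sum_entries_eq {μ ν : YoungDiagram} {T : SemistandardYoungTableau μ}
    {U : SemistandardYoungTableau ν} (h : content T = content U) :
    ∑ c ∈ μ.cells, T c.1 c.2 = ∑ c ∈ ν.cells, U c.1 c.2 := by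
  have h1 := congrArg (Finsupp.linearCombination ℕ (id : ℕ → ℕ)) h
  simpa [content, map_sum, Finsupp.linearCombination_single] using h1

theorem content_eq_rowLen {μ : YoungDiagram} {T : SemistandardYoungTableau μ}
    (hT : ∀ c ∈ μ.cells, T c.1 c.2 = c.1) (i : ℕ) : content T i = μ.rowLen i := by
  classical
  rw [content, Finsupp.finsetSum_apply, YoungDiagram.rowLen_eq_card, YoungDiagram.row,
    Finset.card_filter]
  exact Finset.sum_congr rfl fun c hc => by rw [hT c hc, Finsupp.single_apply]

theorem kostka_ne_zero {μ : YoungDiagram} {β : ℕ →₀ ℕ} :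
    kostka μ β ≠ 0 ↔ ∃ T : SemistandardYoungTableau μ, content T = β := by
  rw [kostka, Nat.card_ne_zero]
  constructor
  · rintro ⟨⟨T⟩, -⟩
    exact ⟨T.1, T.2⟩
  · rintro ⟨T, hT⟩
    exact ⟨⟨T, hT⟩, inferInstance⟩

/-- The sum of the row indices of the cells of a diagram. -/
def rowSum (μ : YoungDiagram) : ℕ := ∑ c ∈ μ.cells, c.1

/-- The Kostka matrix is triangular with respect to `rowSum`, since the entries of a tableau are at
least their row indices. -/
theorem rowSum_le_of_kostka_ne_zero {μ ν : YoungDiagram}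
    (h : kostka μ (content (SemistandardYoungTableau.highestWeight ν)) ≠ 0) :
    rowSum μ ≤ rowSum ν ∧ (rowSum μ = rowSum ν → μ = ν) := by
  obtain ⟨T, hT⟩ := kostka_ne_zero.1 h
  have hhw : ∀ c ∈ ν.cells, SemistandardYoungTableau.highestWeight ν c.1 c.2 = c.1 :=
    fun c hc => if_pos hc
  have hge : ∀ c ∈ μ.cells, c.1 ≤ T c.1 c.2 := fun c hc => row_le_entry T hc
  have h1 : ∑ c ∈ μ.cells, T c.1 c.2 = rowSum ν :=
    (sum_entries_eq hT).trans (Finset.sum_congr rfl hhw)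
  refine ⟨h1 ▸ Finset.sum_le_sum hge, fun heq => ?_⟩
  have h2 : ∀ c ∈ μ.cells, T c.1 c.2 = c.1 := fun c hc =>
    ((Finset.sum_eq_sum_iff_of_le hge).1 (heq.trans h1.symm) c hc).symm
  ext ⟨i, j⟩
  rw [YoungDiagram.mem_cells, YoungDiagram.mem_cells, YoungDiagram.mem_iff_lt_rowLen,
    YoungDiagram.mem_iff_lt_rowLen, ← content_eq_rowLen h2, hT, content_eq_rowLen hhw]

theorem eq_zero_of_sum_schur_eq_zero {n : ℕ} {d : Shape n → Polynomial ℤ}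
    (h : ∑ μ : Shape n, d μ • schur (Polynomial ℤ) μ.1 = 0) (μ : Shape n) : d μ = 0 := by
  classical
  by_contra hμ
  obtain ⟨ν, hν, hmin⟩ := Finset.exists_min_image (Finset.univ.filter fun μ => d μ ≠ 0)
    (fun μ : Shape n => rowSum μ.1) ⟨μ, by simpa using hμ⟩
  have hdν : d ν ≠ 0 := (Finset.mem_filter.1 hν).2
  set β := content (SemistandardYoungTableau.highestWeight ν.1) with hβ
  have h1 := coeff_sum_schur d β
  rw [h, map_zero, Finset.sum_eq_single ν] at h1
  · have h2 : kostka ν.1 β ≠ 0 := kostka_ne_zero.2 ⟨_, rfl⟩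
    exact (mul_ne_zero hdν (Nat.cast_ne_zero.2 h2)) h1.symm
  · intro ρ _ hρ
    by_contra hne
    obtain ⟨hdρ, hk⟩ := mul_ne_zero_iff.1 hne
    obtain ⟨h2, h3⟩ := rowSum_le_of_kostka_ne_zero (Nat.cast_ne_zero.1 hk)
    have h4 := hmin ρ (by simpa using hdρ)
    exact hρ (Subtype.ext (h3 (le_antisymm h2 h4)))
  · simp

theorem valleySum_coeff_nonneg (μ : YoungDiagram) (r m : ℕ) :
    0 ≤ (valleySum (Polynomial.X : Polynomial ℤ) μ r).coeff m := by
  rw [valleySum, Polynomial.finsetSum_coeff]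
  refine Finset.sum_nonneg fun T _ => ?_
  -- the weight has coefficients in `ℕ`
  have h : valleyWeight (Polynomial.X : Polynomial ℤ) r T.des T.maj =
      Polynomial.mapRingHom (Nat.castRingHom ℤ)
        (Polynomial.X ^ (T.maj + r.choose 2 - r * T.des) * qBinomial Polynomial.X T.des r) := by
    rw [map_mul, map_pow, map_qBinomial, Polynomial.coe_mapRingHom, Polynomial.map_X]
    rfl
  rw [h, Polynomial.coe_mapRingHom, Polynomial.coeff_map]
  exact Nat.cast_nonneg _

end DeltaVal

end

theorem mainTheorem10 (n k : ℕ) (hk : 1 ≤ k) (hkn : k ≤ n) :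
    DeltaVal.Val n (k - 1) (Polynomial.X : Polynomial ℤ) 0 =
      DeltaVal.Val n (k - 1) 0 (Polynomial.X : Polynomial ℤ) ∧
    (∀ c : DeltaVal.Shape n → Polynomial ℤ,
      DeltaVal.Val n (k - 1) 0 (Polynomial.X : Polynomial ℤ) =
          ∑ μ : DeltaVal.Shape n, c μ • DeltaVal.schur (Polynomial ℤ) μ.1 ↔
        ∀ μ : DeltaVal.Shape n,
          c μ = ∑ T : DeltaVal.SYT μ.1,
            (Polynomial.X : Polynomial ℤ) ^ (T.maj + (n - k).choose 2 - (n - k) * T.des) *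
              DeltaVal.qBinomial (Polynomial.X : Polynomial ℤ) T.des (n - k)) ∧
    DeltaVal.SchurPositive n (DeltaVal.Val n (k - 1) 0 (Polynomial.X : Polynomial ℤ)) := by
  have hexp := DeltaVal.Val_zero_q_eq_sum_schur hk hkn
  refine ⟨DeltaVal.Val_q_zero_eq_Val_zero_q hk hkn, fun c => ⟨fun hc μ => ?_, fun hc => ?_⟩,
    _, hexp, fun μ m => DeltaVal.valleySum_coeff_nonneg μ.1 (n - k) m⟩
  · refine sub_eq_zero.1 (DeltaVal.eq_zero_of_sum_schur_eq_zero
      (d := fun μ => c μ - DeltaVal.valleySum Polynomial.X μ.1 (n - k)) ?_ μ)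
    simp only [sub_smul]
    rw [Finset.sum_sub_distrib, ← hc, ← hexp, sub_self]
  · rw [hexp]
    exact Finset.sum_congr rfl fun μ _ => by rw [hc μ]; rfl
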